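/- Let $\mathbb F$ be the field with two elements. Let $\mathcal A(1)=\mathbb F\langle Sq^1,Sq^2\rangle/\big((Sq^1)^2,\ (Sq^2)^2+Sq^1Sq^2Sq^1\big)$, graded by $|Sq^i|=i$, and let $\mathcal E(1)\subset\mathcal A(1)$ be the exterior algebra on $Q_0=Sq^1$ (degree $1$) and $Q_1=Sq^1Sq^2+Sq^2Sq^1$ (degree $3$). For $A=\mathcal A(1)$ or $\mathcal E(1)$, let $\mathbf{St}(A)$ be the stable category: its objects are the $\mathbb Z$-graded left $A$-modules, and its morphisms are the degree-zero $A$-linear maps modulo those that factor through a free graded $A$-module. Let $N$ be the graded $\mathcal E(1)$-module with $\mathbb F$-basis $n_{-1},n_0,n_1,n_2$, where $n_k$ has degree $k$, with $Q_0n_{-1}=n_0$, $Q_0n_1=n_2$, $Q_1n_{-1}=n_2$, all other actions of $Q_0$ and $Q_1$ on basis elements being zero. Then there are at most $8$ isomorphism classes of objects $M$ of $\mathbf{St}(\mathcal A(1))$ whose underlying $\mathcal E(1)$-module is isomorphic to $N$ in $\mathbf{St}(\mathcal E(1))$. Moreover this bound is sharp: there are exactly $8$ such classes. -/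

import Mathlib

open CategoryTheory

/-! ### Algebras given by homogeneous generators -/

/-- The degree `d` part of an algebra over the field with two elements that is generated by
elements `g i` of degree `wt i`: the span of the words of total degree `d` in the generators. -/
def wordPiece {ι A : Type} [Ring A] [Algebra (ZMod 2) A] (g : ι → A) (wt : ι → ℤ) (d : ℤ) :
    Submodule (ZMod 2) A :=
  Submodule.span (ZMod 2) {x | ∃ w : List ι, (w.map wt).sum = d ∧ x = (w.map g).prod}

theorem gen_mem_wordPiece {ι A : Type} [Ring A] [Algebra (ZMod 2) A] (g : ι → A) (wt : ι → ℤ)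
    (i : ι) : g i ∈ wordPiece g wt (wt i) :=
  Submodule.subset_span ⟨[i], by simp, by simp⟩

theorem one_mem_wordPiece {ι A : Type} [Ring A] [Algebra (ZMod 2) A] (g : ι → A) (wt : ι → ℤ) :
    (1 : A) ∈ wordPiece g wt 0 :=
  Submodule.subset_span ⟨[], by simp, by simp⟩

theorem mul_mem_wordPiece {ι A : Type} [Ring A] [Algebra (ZMod 2) A] (g : ι → A) (wt : ι → ℤ)
    {c d : ℤ} {x y : A} (hx : x ∈ wordPiece g wt c) (hy : y ∈ wordPiece g wt d) :
    x * y ∈ wordPiece g wt (c + d) := by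
  have h := Submodule.mul_mem_mul hx hy
  rw [wordPiece, wordPiece, Submodule.span_mul_span] at h
  refine Submodule.span_mono ?_ h
  rintro _ ⟨_, ⟨v, hv, rfl⟩, _, ⟨w, hw, rfl⟩, rfl⟩
  exact ⟨v ++ w, by simp [hv, hw], by simp⟩

/-- A homomorphism sending generators to elements of the right degree preserves degrees. -/
theorem map_mem_wordPiece {ι κ A B : Type} [Ring A] [Algebra (ZMod 2) A] [Ring B]
    [Algebra (ZMod 2) B] (g : ι → A) (wt : ι → ℤ) (h : κ → B) (wt' : κ → ℤ)
    (φ : B →ₐ[ZMod 2] A) (hφ : ∀ k, φ (h k) ∈ wordPiece g wt (wt' k)) (d : ℤ) (b : B)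
    (hb : b ∈ wordPiece h wt' d) : φ b ∈ wordPiece g wt d := by
  have key : wordPiece h wt' d ≤ (wordPiece g wt d).comap φ.toLinearMap := by
    refine Submodule.span_le.2 ?_
    rintro _ ⟨w, rfl, rfl⟩
    clear hb
    induction w with
    | nil => simpa using one_mem_wordPiece g wt
    | cons k w ih =>
      have := mul_mem_wordPiece g wt (hφ k) ih
      simpa using this
  exact key hb

/-! ### The algebra `𝒜(1)` -/

/-- The generators of `𝒜(1)`: the first two Steenrod squares. -/
inductive SqGen : Type
  | sq1 : SqGen
  | sq2 : SqGen

/-- The relations `(Sq¹)² = 0` and `(Sq²)² = Sq¹ Sq² Sq¹`. -/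
inductive A1Rel : FreeAlgebra (ZMod 2) SqGen → FreeAlgebra (ZMod 2) SqGen → Prop
  | sq1_sq1 : A1Rel (FreeAlgebra.ι _ SqGen.sq1 * FreeAlgebra.ι _ SqGen.sq1) 0
  | sq2_sq2 : A1Rel (FreeAlgebra.ι _ SqGen.sq2 * FreeAlgebra.ι _ SqGen.sq2)
      (FreeAlgebra.ι _ SqGen.sq1 * FreeAlgebra.ι _ SqGen.sq2 * FreeAlgebra.ι _ SqGen.sq1)

/-- `𝒜(1) = 𝔽₂⟨Sq¹, Sq²⟩ / ((Sq¹)², (Sq²)² + Sq¹ Sq² Sq¹)`. -/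
abbrev A1 : Type := RingQuot A1Rel

namespace A1

/-- The generators of `𝒜(1)`, as elements of `𝒜(1)`. -/
noncomputable def gen (s : SqGen) : A1 := RingQuot.mkAlgHom (ZMod 2) A1Rel (FreeAlgebra.ι _ s)

noncomputable def Sq1 : A1 := gen SqGen.sq1

noncomputable def Sq2 : A1 := gen SqGen.sq2

/-- The degrees of the generators. -/
def wt : SqGen → ℤ
  | SqGen.sq1 => 1
  | SqGen.sq2 => 2

/-- The grading of `𝒜(1)`. -/
noncomputable def piece : ℤ → Submodule (ZMod 2) A1 := wordPiece gen wt

theorem Sq1_mul_Sq1 : Sq1 * Sq1 = 0 := by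
  simpa [Sq1, gen] using RingQuot.mkAlgHom_rel (ZMod 2) A1Rel.sq1_sq1

theorem Sq2_mul_Sq2 : Sq2 * Sq2 = Sq1 * Sq2 * Sq1 := by
  simpa [Sq1, Sq2, gen] using RingQuot.mkAlgHom_rel (ZMod 2) A1Rel.sq2_sq2

/-- The Milnor operation `Q₀ = Sq¹`. -/
noncomputable def Q0 : A1 := Sq1

/-- The Milnor operation `Q₁ = Sq¹ Sq² + Sq² Sq¹`. -/
noncomputable def Q1 : A1 := Sq1 * Sq2 + Sq2 * Sq1

theorem add_self (x : A1) : x + x = 0 := by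
  have : ((1 : ZMod 2) + 1) • x = 0 := by
    rw [show (1 : ZMod 2) + 1 = 0 from by decide, zero_smul]
  simpa [add_smul] using this

theorem Q0_mul_Q0 : Q0 * Q0 = 0 := Sq1_mul_Sq1

theorem Q0_mul_Q1 : Q0 * Q1 = Q1 * Q0 := by
  simp only [Q0, Q1, mul_add, add_mul]
  rw [← mul_assoc, Sq1_mul_Sq1, mul_assoc Sq2, Sq1_mul_Sq1]
  simp [mul_assoc]

theorem Q1_mul_Q1 : Q1 * Q1 = 0 := by
  have h1 : Sq1 * Sq2 * (Sq2 * Sq1) = 0 := by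
    rw [mul_assoc, ← mul_assoc Sq2, Sq2_mul_Sq2, mul_assoc _ Sq1 Sq1, Sq1_mul_Sq1]; simp
  have h2 : Sq2 * Sq1 * (Sq1 * Sq2) = 0 := by
    rw [mul_assoc, ← mul_assoc Sq1, Sq1_mul_Sq1]; simp
  have h3 : Sq2 * Sq1 * (Sq2 * Sq1) = Sq1 * Sq2 * (Sq1 * Sq2) := by
    have h : Sq2 * (Sq2 * Sq2) = Sq2 * Sq2 * Sq2 := (mul_assoc _ _ _).symm
    rw [Sq2_mul_Sq2] at h
    simpa only [mul_assoc] using h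
  rw [Q1, mul_add, add_mul, add_mul, h1, h2, h3]
  simp [add_self]

end A1

/-! ### The algebra `ℰ(1)` -/

/-- The generators of `ℰ(1)`: the first two Milnor operations. -/
inductive QGen : Type
  | q0 : QGen
  | q1 : QGen

/-- The relations of the exterior algebra on `Q₀` and `Q₁`. -/
inductive E1Rel : FreeAlgebra (ZMod 2) QGen → FreeAlgebra (ZMod 2) QGen → Prop
  | q0_q0 : E1Rel (FreeAlgebra.ι _ QGen.q0 * FreeAlgebra.ι _ QGen.q0) 0
  | q1_q1 : E1Rel (FreeAlgebra.ι _ QGen.q1 * FreeAlgebra.ι _ QGen.q1) 0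
  | q0_q1 : E1Rel (FreeAlgebra.ι _ QGen.q0 * FreeAlgebra.ι _ QGen.q1)
      (FreeAlgebra.ι _ QGen.q1 * FreeAlgebra.ι _ QGen.q0)

/-- The exterior algebra `ℰ(1)` on `Q₀` and `Q₁`. It is identified with the subalgebra of `𝒜(1)`
generated by `Q₀` and `Q₁` in `E1.toA1_injective` and `E1.range_toA1`. -/
abbrev E1 : Type := RingQuot E1Rel

namespace E1

/-- The generators of `ℰ(1)`, as elements of `ℰ(1)`. -/
noncomputable def gen (s : QGen) : E1 := RingQuot.mkAlgHom (ZMod 2) E1Rel (FreeAlgebra.ι _ s)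

noncomputable def Q0 : E1 := gen QGen.q0

noncomputable def Q1 : E1 := gen QGen.q1

/-- The degrees of the generators. -/
def wt : QGen → ℤ
  | QGen.q0 => 1
  | QGen.q1 => 3

/-- The grading of `ℰ(1)`. -/
noncomputable def piece : ℤ → Submodule (ZMod 2) E1 := wordPiece gen wt

theorem Q0_mul_Q0 : Q0 * Q0 = 0 := by
  simpa [Q0, gen] using RingQuot.mkAlgHom_rel (ZMod 2) E1Rel.q0_q0

theorem Q1_mul_Q1 : Q1 * Q1 = 0 := by
  simpa [Q1, gen] using RingQuot.mkAlgHom_rel (ZMod 2) E1Rel.q1_q1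

theorem Q0_mul_Q1 : Q0 * Q1 = Q1 * Q0 := by
  simpa [Q0, Q1, gen] using RingQuot.mkAlgHom_rel (ZMod 2) E1Rel.q0_q1

/-- The algebra homomorphism out of `ℰ(1)` determined by two commuting elements of square zero. -/
noncomputable def lift {B : Type} [Ring B] [Algebra (ZMod 2) B] (x y : B) (hx : x * x = 0)
    (hy : y * y = 0) (hxy : x * y = y * x) : E1 →ₐ[ZMod 2] B :=
  RingQuot.liftAlgHom (ZMod 2)
    ⟨FreeAlgebra.lift (ZMod 2) (fun s => match s with | QGen.q0 => x | QGen.q1 => y), by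
      rintro _ _ (_ | _ | _) <;> simp [hx, hy, hxy]⟩

theorem lift_Q0 {B : Type} [Ring B] [Algebra (ZMod 2) B] (x y : B) (hx : x * x = 0)
    (hy : y * y = 0) (hxy : x * y = y * x) : lift x y hx hy hxy Q0 = x := by
  simp [lift, Q0, gen]

theorem lift_Q1 {B : Type} [Ring B] [Algebra (ZMod 2) B] (x y : B) (hx : x * x = 0)
    (hy : y * y = 0) (hxy : x * y = y * x) : lift x y hx hy hxy Q1 = y := by
  simp [lift, Q1, gen]

/-- The inclusion `ℰ(1) → 𝒜(1)`, sending `Q₀` to `Sq¹` and `Q₁` to `Sq¹ Sq² + Sq² Sq¹`. -/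
noncomputable def toA1 : E1 →ₐ[ZMod 2] A1 :=
  lift A1.Q0 A1.Q1 A1.Q0_mul_Q0 A1.Q1_mul_Q1 A1.Q0_mul_Q1

theorem toA1_Q0 : toA1 Q0 = A1.Q0 := lift_Q0 _ _ _ _ _

theorem toA1_Q1 : toA1 Q1 = A1.Q1 := lift_Q1 _ _ _ _ _

theorem toA1_mem_piece (d : ℤ) (b : E1) (hb : b ∈ piece d) : toA1 b ∈ A1.piece d := by
  refine map_mem_wordPiece A1.gen A1.wt gen wt toA1 ?_ d b hb
  have h1 := gen_mem_wordPiece A1.gen A1.wt SqGen.sq1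
  have h2 := gen_mem_wordPiece A1.gen A1.wt SqGen.sq2
  rintro (_ | _)
  · rw [← Q0, toA1_Q0]
    exact h1
  · rw [← Q1, toA1_Q1, A1.Q1]
    have h12 := mul_mem_wordPiece A1.gen A1.wt h1 h2
    have h21 := mul_mem_wordPiece A1.gen A1.wt h2 h1
    exact Submodule.add_mem (wordPiece A1.gen A1.wt 3) h12 h21

theorem induction {C : E1 → Prop} (hc : ∀ c : ZMod 2, C (algebraMap _ _ c)) (h0 : C Q0) (h1 : C Q1)
    (hmul : ∀ x y, C x → C y → C (x * y)) (hadd : ∀ x y, C x → C y → C (x + y)) (x : E1) : C x := by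
  obtain ⟨y, rfl⟩ := RingQuot.mkAlgHom_surjective (ZMod 2) E1Rel x
  induction y using FreeAlgebra.induction with
  | grade0 r => rw [AlgHom.commutes]; exact hc r
  | grade1 s => cases s with
    | q0 => exact h0
    | q1 => exact h1
  | mul a b ha hb => rw [map_mul]; exact hmul _ _ ha hb
  | add a b ha hb => rw [map_add]; exact hadd _ _ ha hb

theorem range_toA1 : toA1.range = Algebra.adjoin (ZMod 2) {A1.Q0, A1.Q1} := by
  apply le_antisymm
  · rintro _ ⟨x, rfl⟩
    refine induction (C := fun x => toA1 x ∈ Algebra.adjoin (ZMod 2) {A1.Q0, A1.Q1})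
      (fun c => ?_) ?_ ?_ (fun x y hx hy => ?_) (fun x y hx hy => ?_) x
    · rw [AlgHom.commutes]; exact Subalgebra.algebraMap_mem _ c
    · rw [toA1_Q0]; exact Algebra.subset_adjoin (by simp)
    · rw [toA1_Q1]; exact Algebra.subset_adjoin (by simp)
    · rw [map_mul]; exact mul_mem hx hy
    · rw [map_add]; exact add_mem hx hy
  · refine Algebra.adjoin_le ?_
    rintro _ (rfl | rfl)
    · exact ⟨Q0, toA1_Q0⟩
    · exact ⟨Q1, toA1_Q1⟩

/-- Every element of `ℰ(1)` is a combination of `1`, `Q₀`, `Q₁` and `Q₀ Q₁`. -/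
theorem exists_coords (x : E1) : ∃ c : Fin 4 → ZMod 2,
    x = c 0 • (1 : E1) + c 1 • Q0 + c 2 • Q1 + c 3 • (Q0 * Q1) := by
  let C : E1 → Prop := fun x => ∀ c : Fin 4 → ZMod 2, ∃ d : Fin 4 → ZMod 2,
    x * (c 0 • (1 : E1) + c 1 • Q0 + c 2 • Q1 + c 3 • (Q0 * Q1)) =
      d 0 • (1 : E1) + d 1 • Q0 + d 2 • Q1 + d 3 • (Q0 * Q1)
  have h : C x := by
    refine induction (C := C) (fun r c => ⟨r • c, ?_⟩) (fun c => ⟨![0, c 0, 0, c 2], ?_⟩)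
      (fun c => ⟨![0, 0, c 0, c 1], ?_⟩) (fun x y hx hy c => ?_) (fun x y hx hy c => ?_) x
    · rw [← Algebra.smul_def]
      simp only [smul_add, smul_smul, Pi.smul_apply, smul_eq_mul]
    · have e : Q0 * (Q0 * Q1) = 0 := by rw [← mul_assoc, Q0_mul_Q0, zero_mul]
      simp only [mul_add, mul_smul_comm, mul_one, e, Q0_mul_Q0]
      simp
    · have e : Q1 * (Q0 * Q1) = 0 := by rw [Q0_mul_Q1, ← mul_assoc, Q1_mul_Q1, zero_mul]
      simp only [mul_add, mul_smul_comm, mul_one, e, Q1_mul_Q1, ← Q0_mul_Q1]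
      simp
    · obtain ⟨d, hd⟩ := hy c
      obtain ⟨e, he⟩ := hx d
      exact ⟨e, by rw [mul_assoc, hd, he]⟩
    · obtain ⟨d, hd⟩ := hx c
      obtain ⟨e, he⟩ := hy c
      refine ⟨d + e, ?_⟩
      rw [add_mul, hd, he]
      simp only [Pi.add_apply, add_smul]
      abel
  obtain ⟨d, hd⟩ := h ![1, 0, 0, 0]
  exact ⟨d, by simpa using hd⟩

theorem toA1_injective : Function.Injective toA1 := by
  -- The regular representation of `𝒜(1)` on the basis `1, a, b, ab, ba, aba, bab, abab`,
  -- where `a = Sq¹` and `b = Sq²`.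
  let m1 : Matrix (Fin 8) (Fin 8) (ZMod 2) := Matrix.of fun i j =>
    if (j, i) ∈ [((0 : Fin 8), (1 : Fin 8)), (2, 3), (4, 5), (6, 7)] then 1 else 0
  let m2 : Matrix (Fin 8) (Fin 8) (ZMod 2) := Matrix.of fun i j =>
    if (j, i) ∈ [((0 : Fin 8), (2 : Fin 8)), (1, 4), (2, 5), (3, 6), (5, 7)] then 1 else 0
  have r1 : m1 * m1 = 0 := by decide
  have r2 : m2 * m2 = m1 * m2 * m1 := by decide
  let ρ : A1 →ₐ[ZMod 2] Matrix (Fin 8) (Fin 8) (ZMod 2) := RingQuot.liftAlgHom (ZMod 2)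
    ⟨FreeAlgebra.lift (ZMod 2) (fun s => match s with | SqGen.sq1 => m1 | SqGen.sq2 => m2), by
      rintro _ _ (_ | _)
      · simpa using r1
      · simpa using r2⟩
  have ρ1 : ρ A1.Sq1 = m1 := by simp [ρ, A1.Sq1, A1.gen]
  have ρ2 : ρ A1.Sq2 = m2 := by simp [ρ, A1.Sq2, A1.gen]
  have h0 : ρ (toA1 Q0) = m1 := by rw [toA1_Q0, A1.Q0, ρ1]
  have h1 : ρ (toA1 Q1) = m1 * m2 + m2 * m1 := by
    rw [toA1_Q1, A1.Q1, map_add, map_mul, map_mul, ρ1, ρ2]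
  refine (injective_iff_map_eq_zero toA1).2 fun x hx => ?_
  obtain ⟨c, rfl⟩ := exists_coords x
  have h := congrArg ρ hx
  simp only [map_add, map_smul, map_mul, map_one, h0, h1, map_zero] at h
  have key : ∀ c0 c1 c2 c3 : ZMod 2, (∀ i : Fin 8, (c0 • (1 : Matrix (Fin 8) (Fin 8) (ZMod 2)) +
      c1 • m1 + c2 • (m1 * m2 + m2 * m1) + c3 • (m1 * (m1 * m2 + m2 * m1))) i 0 = 0) →
      c0 = 0 ∧ c1 = 0 ∧ c2 = 0 ∧ c3 = 0 := by decide
  obtain ⟨e0, e1, e2, e3⟩ := key _ _ _ _ fun i => congrFun (congrFun h i) 0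
  rw [e0, e1, e2, e3]
  simp

end E1

/-! ### Graded modules -/

/-- A `ℤ`-graded left module over an algebra `A` with grading `𝒜`. -/
structure GrMod {A : Type} [Ring A] [Algebra (ZMod 2) A] (𝒜 : ℤ → Submodule (ZMod 2) A) where
  carrier : Type
  [addCommGroup : AddCommGroup carrier]
  [module : Module A carrier]
  /-- The subgroup of homogeneous elements of a given degree. -/
  grading : ℤ → AddSubgroup carrier
  isInternal : DirectSum.IsInternal grading
  smul_mem : ∀ (i j : ℤ) (a : A) (x : carrier), a ∈ 𝒜 i → x ∈ grading j → a • x ∈ grading (i + j)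

namespace GrMod

attribute [instance] GrMod.addCommGroup GrMod.module

/-- Morphisms of graded modules: linear maps of degree zero. -/
structure Hom {A : Type} [Ring A] [Algebra (ZMod 2) A] {𝒜 : ℤ → Submodule (ZMod 2) A}
    (M N : GrMod 𝒜) where
  toLin : M.carrier →ₗ[A] N.carrier
  map_mem : ∀ (i : ℤ) (x : M.carrier), x ∈ M.grading i → toLin x ∈ N.grading i

/-- The category of graded modules. -/
instance category {A : Type} [Ring A] [Algebra (ZMod 2) A] (𝒜 : ℤ → Submodule (ZMod 2) A) :
    Category (GrMod 𝒜) where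
  Hom M N := Hom M N
  id M := ⟨LinearMap.id, fun _ _ h => h⟩
  comp f g := ⟨g.toLin.comp f.toLin, fun i x h => g.map_mem i _ (f.map_mem i x h)⟩

/-- A graded module is free when it has a basis of homogeneous elements. -/
def IsFree {A : Type} [Ring A] [Algebra (ZMod 2) A] {𝒜 : ℤ → Submodule (ZMod 2) A}
    (P : GrMod 𝒜) : Prop :=
  ∃ (κ : Type) (b : Module.Basis κ A P.carrier) (deg : κ → ℤ), ∀ k, b k ∈ P.grading (deg k)

/-- Two morphisms are stably equal when their difference factors through a free graded module. -/
def StablyEqual {A : Type} [Ring A] [Algebra (ZMod 2) A] (𝒜 : ℤ → Submodule (ZMod 2) A) :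
    HomRel (GrMod 𝒜) :=
  fun M N f g => ∃ (P : GrMod 𝒜) (_ : P.IsFree) (u : M ⟶ P) (v : P ⟶ N),
    ∀ x : M.carrier, f.toLin x - g.toLin x = v.toLin (u.toLin x)

/-- Restriction of graded modules along a degree preserving homomorphism `φ : B → A`. -/
def restrict {A B : Type} [Ring A] [Algebra (ZMod 2) A] [Ring B] [Algebra (ZMod 2) B]
    {𝒜 : ℤ → Submodule (ZMod 2) A} {ℬ : ℤ → Submodule (ZMod 2) B} (φ : B →ₐ[ZMod 2] A)
    (hφ : ∀ (d : ℤ) (b : B), b ∈ ℬ d → φ b ∈ 𝒜 d) (M : GrMod 𝒜) : GrMod ℬ :=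
  letI : Module B M.carrier := Module.compHom M.carrier φ.toRingHom
  { carrier := M.carrier
    grading := M.grading
    isInternal := M.isInternal
    smul_mem := fun i j b x hb hx => M.smul_mem i j (φ b) x (hφ i b hb) hx }

end GrMod

/-- The stable category of graded modules: the quotient of the category of graded modules by the
morphisms that factor through a free module. -/
abbrev StCat {A : Type} [Ring A] [Algebra (ZMod 2) A] (𝒜 : ℤ → Submodule (ZMod 2) A) : Type 1 :=
  CategoryTheory.Quotient (GrMod.StablyEqual 𝒜)

/-- A graded module, as an object of the stable category. -/
abbrev StCat.of {A : Type} [Ring A] [Algebra (ZMod 2) A] {𝒜 : ℤ → Submodule (ZMod 2) A}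
    (M : GrMod 𝒜) : StCat 𝒜 :=
  (CategoryTheory.Quotient.functor (GrMod.StablyEqual 𝒜)).obj M

/-- The underlying `ℰ(1)`-module of an `𝒜(1)`-module. -/
noncomputable def underlyingE1 (M : GrMod A1.piece) : GrMod E1.piece :=
  M.restrict E1.toA1 E1.toA1_mem_piece

/-- For an `ℰ(1)`-module `N`, the set of isomorphism classes of objects `M` of the stable category
of `𝒜(1)`-modules whose underlying `ℰ(1)`-module is stably isomorphic to `N`. -/
def stableLifts (N : GrMod E1.piece) : Set (Quotient (isIsomorphicSetoid (StCat A1.piece))) :=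
  {X | ∃ M : GrMod A1.piece, X = Quotient.mk _ (StCat.of M) ∧
    Nonempty (StCat.of (underlyingE1 M) ≅ StCat.of N)}

/-! ### The module `N` -/

namespace moduleN

/-- The matrix of `Q₀` on the basis `n₋₁, n₀, n₁, n₂`: it sends `n₋₁` to `n₀` and `n₁` to `n₂`. -/
def matQ0 : Matrix (Fin 4) (Fin 4) (ZMod 2) :=
  !![0, 0, 0, 0; 1, 0, 0, 0; 0, 0, 0, 0; 0, 0, 1, 0]

/-- The matrix of `Q₁` on the basis `n₋₁, n₀, n₁, n₂`: it sends `n₋₁` to `n₂`. -/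
def matQ1 : Matrix (Fin 4) (Fin 4) (ZMod 2) :=
  !![0, 0, 0, 0; 0, 0, 0, 0; 0, 0, 0, 0; 1, 0, 0, 0]

/-- The degrees of the basis elements `n₋₁, n₀, n₁, n₂`. -/
def deg : Fin 4 → ℤ := ![-1, 0, 1, 2]

/-- The action of `ℰ(1)` on `N`. -/
noncomputable def action : E1 →ₐ[ZMod 2] Module.End (ZMod 2) (Fin 4 → ZMod 2) :=
  (Matrix.toLinAlgEquiv' : Matrix (Fin 4) (Fin 4) (ZMod 2) ≃ₐ[ZMod 2] _).toAlgHom.comp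
    (E1.lift matQ0 matQ1 (by decide) (by decide) (by decide))

end moduleN

/-- The homogeneous elements of degree `d` of the vector space with basis `κ`, where the basis
element `k` has degree `deg k`. -/
def coordGrading {κ : Type} (deg : κ → ℤ) (d : ℤ) : AddSubgroup (κ → ZMod 2) where
  carrier := {v | ∀ k, deg k ≠ d → v k = 0}
  zero_mem' := fun _ _ => rfl
  add_mem' := fun {u v} hu hv k hk => by simp [hu k hk, hv k hk]
  neg_mem' := fun {v} hv k hk => by simp [hv k hk]

theorem coordGrading_single_mem {κ : Type} [DecidableEq κ] (deg : κ → ℤ) (k : κ) (c : ZMod 2) :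
    Pi.single k c ∈ coordGrading deg (deg k) := by
  intro l hl
  exact Pi.single_eq_of_ne (M := fun _ : κ => ZMod 2) (fun h : l = k => hl (by rw [h])) c

theorem coordGrading_isInternal {κ : Type} [Fintype κ] [DecidableEq κ] (deg : κ → ℤ) :
    DirectSum.IsInternal (coordGrading deg) := by
  let s : (k : κ) → ZMod 2 →+ (DirectSum ℤ fun d => coordGrading deg d) := fun k =>
    (DirectSum.of (fun d => coordGrading deg d) (deg k)).comp
      { toFun := fun c => ⟨Pi.single k c, coordGrading_single_mem deg k c⟩
        map_zero' := Subtype.ext (Pi.single_zero k)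
        map_add' := fun a b => Subtype.ext (Pi.single_add (f := fun _ : κ => ZMod 2) k a b) }
  let D : (κ → ZMod 2) →+ (DirectSum ℤ fun d => coordGrading deg d) :=
    ∑ k, (s k).comp (Pi.evalAddMonoidHom _ k)
  have hs : ∀ k c, DirectSum.coeAddMonoidHom (coordGrading deg) (s k c) = Pi.single k c :=
    fun k c => DirectSum.coeAddMonoidHom_of _ _ _
  have hD : ∀ v, D v = ∑ k, s k (v k) := fun v => by simp [D]
  have hcoe : ∀ v, DirectSum.coeAddMonoidHom (coordGrading deg) (D v) = v := fun v => by
    rw [hD, map_sum]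
    simp only [hs]
    exact Finset.univ_sum_single v
  have hinv : D.comp (DirectSum.coeAddMonoidHom (coordGrading deg)) = AddMonoidHom.id _ := by
    refine DirectSum.addHom_ext fun d x => ?_
    simp only [AddMonoidHom.comp_apply, DirectSum.coeAddMonoidHom_of, AddMonoidHom.id_apply]
    rw [hD]
    have hp : ∀ k, deg k = d → ∀ c : ZMod 2, Pi.single k c ∈ coordGrading deg d :=
      fun k h c => h ▸ coordGrading_single_mem deg k c
    have hd : ∀ k (h : deg k = d) (c : ZMod 2), s k c =
        DirectSum.of (fun d => coordGrading deg d) d ⟨Pi.single k c, hp k h c⟩ := by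
      clear_value D
      clear x
      intro k h c
      subst h
      rfl
    have hk : ∀ k, s k (x.1 k) = DirectSum.of (fun d => coordGrading deg d) d
        (if h : deg k = d then ⟨Pi.single k (x.1 k), hp k h _⟩ else 0) := by
      intro k
      by_cases h : deg k = d
      · rw [dif_pos h, hd k h]
      · rw [dif_neg h, x.2 k h, map_zero, map_zero]
    rw [Finset.sum_congr rfl (fun k _ => hk k), ← map_sum]
    congr 1
    apply Subtype.ext
    rw [AddSubgroup.val_finsetSum]
    conv_rhs => rw [← Finset.univ_sum_single x.1]
    refine Finset.sum_congr rfl fun k _ => ?_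
    by_cases h : deg k = d
    · rw [dif_pos h]
    · rw [dif_neg h, x.2 k h, Pi.single_zero]; rfl
  constructor
  · intro a b hab
    have := congrArg D hab
    exact (DFunLike.congr_fun hinv a).symm.trans (this.trans (DFunLike.congr_fun hinv b))
  · exact fun v => ⟨D v, hcoe v⟩

/-- A module is graded as soon as the generators act with the right degrees. -/
theorem smul_mem_of_gen {ι A M : Type} [Ring A] [Algebra (ZMod 2) A] [AddCommGroup M] [Module A M]
    (g : ι → A) (wt : ι → ℤ) (G : ℤ → AddSubgroup M)
    (hg : ∀ (s : ι) (j : ℤ) (x : M), x ∈ G j → g s • x ∈ G (wt s + j)) (i j : ℤ) (a : A) (x : M)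
    (ha : a ∈ wordPiece g wt i) (hx : x ∈ G j) : a • x ∈ G (i + j) := by
  induction ha using Submodule.span_induction with
  | mem a h =>
    obtain ⟨w, rfl, rfl⟩ := h
    induction w with
    | nil => simpa using hx
    | cons s w ih =>
      have := hg s _ _ ih
      simpa [mul_smul, add_assoc] using this
  | zero => simp
  | add a b _ _ iha ihb =>
    rw [add_smul]
    exact (G (i + j)).add_mem iha ihb
  | smul c a _ iha =>
    have hc : c = 0 ∨ c = 1 := by revert c; decide
    rcases hc with rfl | rfl
    · simp
    · simpa using iha

/-- The `ℰ(1)`-module `N` with basis `n₋₁, n₀, n₁, n₂`, where `nₖ` has degree `k`, and with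
`Q₀ n₋₁ = n₀`, `Q₀ n₁ = n₂` and `Q₁ n₋₁ = n₂`, the other basis elements being sent to zero. -/
noncomputable def moduleN : GrMod E1.piece :=
  letI : Module E1 (Fin 4 → ZMod 2) := Module.compHom _ moduleN.action.toRingHom
  { carrier := Fin 4 → ZMod 2
    grading := coordGrading moduleN.deg
    isInternal := coordGrading_isInternal moduleN.deg
    smul_mem := smul_mem_of_gen E1.gen E1.wt (coordGrading moduleN.deg) (by
      rintro (_ | _) j x hx k hk
      · have h : moduleN.action (E1.gen QGen.q0) = Matrix.toLinAlgEquiv' moduleN.matQ0 :=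
          congrArg Matrix.toLinAlgEquiv' (E1.lift_Q0 _ _ _ _ _)
        change moduleN.action (E1.gen QGen.q0) x k = 0
        rw [h, Matrix.toLinAlgEquiv'_apply]
        have h0 := hx 0
        have h2 := hx 2
        fin_cases k <;>
          simp [moduleN.matQ0, Matrix.mulVec, dotProduct, Fin.sum_univ_four, moduleN.deg, E1.wt]
            at hk h0 h2 ⊢
        · exact h0 (by omega)
        · exact h2 (by omega)
      · have h : moduleN.action (E1.gen QGen.q1) = Matrix.toLinAlgEquiv' moduleN.matQ1 :=
          congrArg Matrix.toLinAlgEquiv' (E1.lift_Q1 _ _ _ _ _)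
        change moduleN.action (E1.gen QGen.q1) x k = 0
        rw [h, Matrix.toLinAlgEquiv'_apply]
        have h0 := hx 0
        fin_cases k <;>
          simp [moduleN.matQ1, Matrix.mulVec, dotProduct, Fin.sum_univ_four, moduleN.deg, E1.wt]
            at hk h0 ⊢
        · exact h0 (by omega)) }

/-!
# The eight lifts of `N`

Write `T = Q₀ Q₁ = (Sq²)²` and `t = (Sq²)³`, the top element of `𝒜(1)`. Call a graded
`𝒜(1)`-module reduced when `t` acts on it as zero.

*Reduction.* Over a Frobenius algebra, the sum `∑ eᵢ H eⁱ` over dual bases turns an additive map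
`H` into a linear one (`A1.trace`, `E1.trace`). Applied to a map that reads off the coordinates of
the multiples of `t`, this splits off a maximal free summand, so that every module is stably
isomorphic to a reduced one (`A1.exists_reduced`). On reduced modules little is lost on passing to
the stable category: an endomorphism that factors through a free module has its values in
`Sq¹ M + Sq² M`, hence is nilpotent, so stably isomorphic reduced modules embed into each other
(`A1.bijective_of_stablyEqual`, `A1.exists_injective`).

*Normal forms.* Let `M` be reduced and stably isomorphic to `N` over `ℰ(1)`. The images `n`, `m` of
the generators of `N` in the degrees `-1` and `1` form a `Frame`: they span a copy of `N`, and every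
homogeneous `z` with `T z = 0` is congruent to `0`, `n` or `m` modulo the decomposables
`Q₀ M + Q₁ M`. As `M` is reduced, this applies to every `z = Sq² w`, and since `Sq² Sq² w = T w`,
the `w` with `T w ≠ 0`, which generate the free part of `M` over `ℰ(1)`, are strongly restricted:
they occur in the degrees `-2` and `0` if `Sq² n` involves `m`, and in the degrees `-3` and `-1`
otherwise, and `T` has rank at most one in each degree (`A1.Frame.cases_of_top_ne_zero`,
`A1.Frame.top_smul_eq`). Hence `M` is determined by three independent bits: whether `Sq² n`
involves `m`, and which of the two possible free generators `x`, `y` are present. After a change of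
`n`, `m`, `x`, `y` by decomposables, `Sq²` is given by explicit formulas
(`A1.Frame.exists_normalForm`), and `M` is isomorphic to the corresponding explicit `model`
(`A1.NormalForm.nonempty_stable_iso`).

*Count.* Every one of the eight models occurs: its free part over `ℰ(1)` is split off by the trace
again (`Model.nonempty_stable_iso`). As stably isomorphic models embed into each other, they have
elements in the same degrees and `Sq²` is nonzero in the same degrees, which distinguishes the
eight models (`Model.eq_of_stable_iso`).
-/

/-! ### Morphisms of graded modules and the stable category -/

namespace GrMod

section Generic

variable {A : Type} [Ring A] [Algebra (ZMod 2) A] {𝒜 : ℤ → Submodule (ZMod 2) A}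

theorem comp_toLin {L M N : GrMod 𝒜} (f : L ⟶ M) (g : M ⟶ N) (x : L.carrier) :
    (f ≫ g).toLin x = g.toLin (f.toLin x) := rfl

theorem id_toLin (M : GrMod 𝒜) (x : M.carrier) : Hom.toLin (𝟙 M) x = x := rfl

theorem hom_ext {M N : GrMod 𝒜} {f g : M ⟶ N} (h : ∀ x, f.toLin x = g.toLin x) : f = g := by
  obtain ⟨f, hf⟩ := f
  obtain ⟨g, hg⟩ := g
  obtain rfl : f = g := LinearMap.ext h
  rfl

/-- The ungraded counterpart of `StablyEqual`: the difference factors through a free module that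
need not be graded. This is a congruence, without any need for direct sums of graded modules. -/
def UngradedStablyEqual (𝒜 : ℤ → Submodule (ZMod 2) A) : HomRel (GrMod 𝒜) :=
  fun M N f g => ∃ (P : Type) (_ : AddCommGroup P) (_ : Module A P) (_ : Module.Free A P)
    (u : M.carrier →ₗ[A] P) (v : P →ₗ[A] N.carrier), ∀ x, f.toLin x - g.toLin x = v (u x)

theorem StablyEqual.ungraded {M N : GrMod 𝒜} {f g : M ⟶ N} (h : StablyEqual 𝒜 f g) :
    UngradedStablyEqual 𝒜 f g := by
  obtain ⟨P, ⟨κ, b, -⟩, u, v, h⟩ := h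
  exact ⟨P.carrier, inferInstance, inferInstance, Module.Free.of_basis b, u.toLin, v.toLin, h⟩

instance : Congruence (UngradedStablyEqual 𝒜) where
  comp_left f := by
    rintro g g' ⟨P, _, _, _, u, v, h⟩
    exact ⟨P, _, _, inferInstance, u.comp f.toLin, v, fun x => h (f.toLin x)⟩
  comp_right g := by
    rintro ⟨P, _, _, _, u, v, h⟩
    refine ⟨P, _, _, inferInstance, u, g.toLin.comp v, fun x => ?_⟩
    rw [comp_toLin, comp_toLin, ← map_sub, h]
    rfl
  equivalence :=
    { refl := fun f => ⟨A, inferInstance, inferInstance, inferInstance, 0, 0, fun x => by simp⟩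
      symm := by
        rintro f g ⟨P, _, _, _, u, v, h⟩
        exact ⟨P, _, _, inferInstance, -u, v, fun x => by
          rw [LinearMap.neg_apply, map_neg, ← h, neg_sub]⟩
      trans := by
        rintro f g k ⟨P, _, _, _, u, v, h⟩ ⟨P', _, _, _, u', v', h'⟩
        exact ⟨P × P', inferInstance, inferInstance, inferInstance, u.prod u', v.coprod v',
          fun x => by simp [← h, ← h']⟩ }

/-- Morphisms that agree in the stable category are related by the congruence generated by
`StablyEqual`, hence by every congruence that contains it. -/
theorem ungradedStablyEqual_of_map_eq {M N : GrMod 𝒜} {f g : M ⟶ N}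
    (h : (CategoryTheory.Quotient.functor (StablyEqual 𝒜)).map f =
      (CategoryTheory.Quotient.functor (StablyEqual 𝒜)).map g) :
    UngradedStablyEqual 𝒜 f g := by
  rw [← CategoryTheory.Quotient.functor_map_eq_iff (UngradedStablyEqual 𝒜)]
  have key := congrArg (CategoryTheory.Quotient.lift (StablyEqual 𝒜)
    (CategoryTheory.Quotient.functor (UngradedStablyEqual 𝒜))
    (fun _ _ _ _ h => CategoryTheory.Quotient.sound _ h.ungraded)).map h
  exact key

/-- What a stable isomorphism provides: two morphisms of graded modules whose composites differ
from the identity by maps factoring through a free module. -/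
theorem exists_of_stable_iso {M N : GrMod 𝒜} (e : StCat.of M ≅ StCat.of N) :
    ∃ (f : M ⟶ N) (g : N ⟶ M), UngradedStablyEqual 𝒜 (f ≫ g) (𝟙 M) ∧
      UngradedStablyEqual 𝒜 (g ≫ f) (𝟙 N) := by
  obtain ⟨f, hf⟩ := (CategoryTheory.Quotient.functor (StablyEqual 𝒜)).map_surjective e.hom
  obtain ⟨g, hg⟩ := (CategoryTheory.Quotient.functor (StablyEqual 𝒜)).map_surjective e.inv
  refine ⟨f, g, ungradedStablyEqual_of_map_eq ?_, ungradedStablyEqual_of_map_eq ?_⟩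
  · rw [CategoryTheory.Functor.map_comp, hf, hg, CategoryTheory.Functor.map_id, e.hom_inv_id]
  · rw [CategoryTheory.Functor.map_comp, hf, hg, CategoryTheory.Functor.map_id, e.inv_hom_id]

theorem nonempty_stable_iso {M N : GrMod 𝒜} (f : M ⟶ N) (g : N ⟶ M)
    (h : StablyEqual 𝒜 (f ≫ g) (𝟙 M)) (h' : StablyEqual 𝒜 (g ≫ f) (𝟙 N)) :
    Nonempty (StCat.of M ≅ StCat.of N) :=
  ⟨{ hom := (CategoryTheory.Quotient.functor _).map f
     inv := (CategoryTheory.Quotient.functor _).map g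
     hom_inv_id := by
      rw [← CategoryTheory.Functor.map_comp, CategoryTheory.Quotient.sound _ h,
        CategoryTheory.Functor.map_id]
     inv_hom_id := by
      rw [← CategoryTheory.Functor.map_comp, CategoryTheory.Quotient.sound _ h',
        CategoryTheory.Functor.map_id] }⟩

/-! ### Homogeneous components -/

noncomputable instance (M : GrMod 𝒜) : DirectSum.Decomposition M.grading :=
  M.isInternal.chooseDecomposition

/-- The projection of a graded module to its homogeneous component of degree `d`. -/
noncomputable def proj (M : GrMod 𝒜) (d : ℤ) : M.carrier →+ M.carrier :=
  (M.grading d).subtype.comp ((DFinsupp.evalAddMonoidHom d).comp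
    (DirectSum.decomposeAddEquiv M.grading).toAddMonoidHom)

theorem proj_mem (M : GrMod 𝒜) (d : ℤ) (x : M.carrier) : M.proj d x ∈ M.grading d :=
  (DirectSum.decompose M.grading x d).2

theorem proj_same (M : GrMod 𝒜) {d : ℤ} {x : M.carrier} (h : x ∈ M.grading d) :
    M.proj d x = x := DirectSum.decompose_of_mem_same _ h

theorem proj_ne (M : GrMod 𝒜) {d e : ℤ} {x : M.carrier} (h : x ∈ M.grading d) (hde : d ≠ e) :
    M.proj e x = 0 := DirectSum.decompose_of_mem_ne _ h hde

theorem homogeneous_induction (M : GrMod 𝒜) {C : M.carrier → Prop} (zero : C 0)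
    (hom : ∀ d, ∀ x ∈ M.grading d, C x) (add : ∀ x y, C x → C y → C (x + y)) (x : M.carrier) :
    C x :=
  DirectSum.Decomposition.inductionOn M.grading zero (fun m => hom _ m.1 m.2) add x

theorem eq_zero_of_mem_ne (M : GrMod 𝒜) {d e : ℤ} {x : M.carrier} (hd : x ∈ M.grading d)
    (he : x ∈ M.grading e) (hde : d ≠ e) : x = 0 := by
  rw [← M.proj_same hd, M.proj_ne he hde.symm]

/-- An additive map that shifts degrees by `c` commutes with taking components. -/
theorem proj_map {M N : GrMod 𝒜} (F : M.carrier →+ N.carrier) (c : ℤ)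
    (hF : ∀ d x, x ∈ M.grading d → F x ∈ N.grading (c + d)) (d : ℤ) (x : M.carrier) :
    N.proj (c + d) (F x) = F (M.proj d x) := by
  induction x using M.homogeneous_induction with
  | zero => simp
  | add x y hx hy => simp [hx, hy]
  | hom e x hx =>
    by_cases h : e = d
    · subst h
      rw [M.proj_same hx, N.proj_same (hF _ _ hx)]
    · rw [M.proj_ne hx h, N.proj_ne (hF _ _ hx) (by omega), map_zero]

theorem proj_hom {M N : GrMod 𝒜} (f : M ⟶ N) (d : ℤ) (x : M.carrier) :
    N.proj d (f.toLin x) = f.toLin (M.proj d x) := by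
  have := proj_map (f.toLin : M.carrier →+ N.carrier) 0
    (fun d x hx => by rw [zero_add]; exact f.map_mem d x hx) d x
  rwa [zero_add] at this

theorem proj_smul (M : GrMod 𝒜) {c : ℤ} {a : A} (ha : a ∈ 𝒜 c) (d : ℤ) (x : M.carrier) :
    M.proj (c + d) (a • x) = a • M.proj d x :=
  proj_map (DistribSMul.toAddMonoidHom M.carrier a) c
    (fun d x hx => M.smul_mem c d a x ha hx) d x

theorem mem_of_proj (M : GrMod 𝒜) {d : ℤ} {x : M.carrier}
    (h : ∀ e, e ≠ d → M.proj e x = 0) : x ∈ M.grading d := by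
  classical
  have hs := DirectSum.sum_support_decompose M.grading x
  rw [← hs]
  refine AddSubgroup.sum_mem _ fun e _ => ?_
  by_cases hed : e = d
  · subst hed; exact (DirectSum.decompose M.grading x e).2
  · have : ((DirectSum.decompose M.grading x e : M.grading e) : M.carrier) = 0 := h e hed
    rw [this]; exact zero_mem _

/-- A criterion for a family of subgroups to be a grading. -/
theorem isInternal_of_proj {M : Type} [AddCommGroup M] (G : ℤ → AddSubgroup M)
    (π : ℤ → M →+ M) (same : ∀ d, ∀ x ∈ G d, π d x = x)
    (ne : ∀ d e, e ≠ d → ∀ x ∈ G d, π e x = 0) (top : ∀ x, x ∈ ⨆ d, G d) :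
    DirectSum.IsInternal G := by
  classical
  have hπ : ∀ d, (π d).comp (DirectSum.coeAddMonoidHom G) =
      (G d).subtype.comp (DFinsupp.evalAddMonoidHom d) := by
    intro d
    refine DirectSum.addHom_ext fun e y => ?_
    simp only [AddMonoidHom.comp_apply, DirectSum.coeAddMonoidHom_of]
    by_cases h : e = d
    · subst h
      rw [same _ _ y.2]
      exact congrArg Subtype.val (DirectSum.of_eq_same (β := fun i => G i) e y).symm
    · rw [ne e d (Ne.symm h) _ y.2]
      have : DFinsupp.evalAddMonoidHom (β := fun i => G i) d
          (DirectSum.of (fun i => G i) e y) = 0 :=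
        DirectSum.of_eq_of_ne _ _ _ (Ne.symm h)
      rw [this]; rfl
  constructor
  · intro x y hxy
    refine DFinsupp.ext fun d => Subtype.ext ?_
    have := congrArg (π d) hxy
    exact (DFunLike.congr_fun (hπ d) x).symm.trans (this.trans (DFunLike.congr_fun (hπ d) y))
  · intro x
    refine AddSubgroup.iSup_induction G
      (C := fun x => ∃ y, DirectSum.coeAddMonoidHom G y = x) (top x) ?_ ?_ ?_
    · exact fun d x hx => ⟨DirectSum.of (fun d => G d) d ⟨x, hx⟩,
        DirectSum.coeAddMonoidHom_of _ _ _⟩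
    · exact ⟨0, map_zero _⟩
    · rintro _ _ ⟨y, rfl⟩ ⟨z, rfl⟩
      exact ⟨y + z, map_add _ _ _⟩

/-- A bijective morphism of graded modules is an isomorphism. -/
noncomputable def isoOfBijective {M N : GrMod 𝒜} (f : M ⟶ N) (hf : Function.Bijective f.toLin) :
    M ≅ N where
  hom := f
  inv :=
    { toLin := (LinearEquiv.ofBijective f.toLin hf).symm
      map_mem := fun d y hy => by
        obtain ⟨x, rfl⟩ := hf.2 y
        have hx : (LinearEquiv.ofBijective f.toLin hf).symm (f.toLin x) = x :=
          (LinearEquiv.ofBijective f.toLin hf).symm_apply_apply x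
        rw [LinearEquiv.coe_coe, hx]
        refine M.mem_of_proj fun e he => hf.1 ?_
        rw [← proj_hom, N.proj_ne hy he.symm, map_zero] }
  hom_inv_id := hom_ext fun x => (LinearEquiv.ofBijective f.toLin hf).symm_apply_apply x
  inv_hom_id := hom_ext fun x => (LinearEquiv.ofBijective f.toLin hf).apply_symm_apply x

theorem nonempty_stable_iso_of_bijective {M N : GrMod 𝒜} (f : M ⟶ N)
    (hf : Function.Bijective f.toLin) : Nonempty (StCat.of M ≅ StCat.of N) :=
  ⟨(CategoryTheory.Quotient.functor _).mapIso (isoOfBijective f hf)⟩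

/-- The graded submodule formed by the kernel of a morphism. -/
noncomputable def ker {M N : GrMod 𝒜} (f : M ⟶ N) : GrMod 𝒜 where
  carrier := LinearMap.ker f.toLin
  grading d := (M.grading d).comap (LinearMap.ker f.toLin).toAddSubgroup.subtype
  isInternal := by
    have hp : ∀ d (x : LinearMap.ker f.toLin), M.proj d x ∈ LinearMap.ker f.toLin := by
      intro d x
      rw [LinearMap.mem_ker, ← proj_hom, LinearMap.mem_ker.1 x.2, map_zero]
    let π : ℤ → LinearMap.ker f.toLin →+ LinearMap.ker f.toLin := fun d =>
      { toFun := fun x => ⟨M.proj d x, hp d x⟩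
        map_zero' := Subtype.ext (map_zero (M.proj d))
        map_add' := fun x y => Subtype.ext (map_add (M.proj d) x.1 y.1) }
    refine isInternal_of_proj _ π (fun d x hx => Subtype.ext (M.proj_same hx))
      (fun d e he x hx => Subtype.ext (M.proj_ne hx he.symm)) fun x => ?_
    classical
    have hx : x = ∑ d ∈ (DirectSum.decompose M.grading x.1).support, π d x := by
      apply Subtype.ext
      rw [AddSubmonoidClass.coe_finsetSum]
      exact (DirectSum.sum_support_decompose M.grading x.1).symm
    rw [hx]
    exact AddSubgroup.sum_mem _ fun d _ => (le_iSup
      (fun d => (M.grading d).comap (LinearMap.ker f.toLin).toAddSubgroup.subtype) d)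
      (M.proj_mem d x.1)
  smul_mem := fun i j a x ha hx => M.smul_mem i j a x.1 ha hx

/-- The inclusion of the kernel of a morphism. -/
noncomputable def kerι {M N : GrMod 𝒜} (f : M ⟶ N) : ker f ⟶ M where
  toLin := (LinearMap.ker f.toLin).subtype
  map_mem _ _ h := h

/-! ### Graded free modules -/

/-- The free graded module with basis elements indexed by `κ`, of degrees `deg`. -/
noncomputable def free (h𝒜 : SetLike.GradedMonoid 𝒜)
    (hint : DirectSum.IsInternal fun d => (𝒜 d).toAddSubgroup) (κ : Type) (deg : κ → ℤ) :
    GrMod 𝒜 where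
  carrier := κ →₀ A
  grading d :=
    { carrier := {f | ∀ k, f k ∈ 𝒜 (d - deg k)}
      zero_mem' := fun k => zero_mem _
      add_mem' := fun hf hg k => add_mem (hf k) (hg k)
      neg_mem' := fun hf k => neg_mem (hf k) }
  isInternal := by
    let reg : GrMod 𝒜 :=
      { carrier := A
        grading := fun d => (𝒜 d).toAddSubgroup
        isInternal := hint
        smul_mem := fun i j a x ha hx => h𝒜.mul_mem ha hx }
    refine isInternal_of_proj _ (fun d => Finsupp.liftAddHom fun k =>
      (Finsupp.singleAddHom k).comp (reg.proj (d - deg k))) (fun d f hf => ?_)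
      (fun d e he f hf => ?_) fun f => ?_
    · conv_rhs => rw [← f.sum_single]
      exact Finset.sum_congr rfl fun k _ => congrArg (Finsupp.single k) (reg.proj_same (hf k))
    · refine Finset.sum_eq_zero fun k _ => ?_
      exact (congrArg (Finsupp.single k) (reg.proj_ne (hf k) (by omega))).trans
        (Finsupp.single_zero k)
    · induction f using Finsupp.induction_linear with
      | zero => exact zero_mem _
      | add f g hf hg => exact add_mem hf hg
      | single k a =>
        induction a using reg.homogeneous_induction with
        | zero => rw [Finsupp.single_zero]; exact zero_mem _
        | add x y hx hy => rw [Finsupp.single_add]; exact add_mem hx hy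
        | hom e a ha =>
          refine AddSubgroup.mem_iSup_of_mem (e + deg k) fun l => ?_
          by_cases hl : k = l
          · subst hl
            rw [Finsupp.single_eq_same, add_sub_cancel_right]
            exact ha
          · rw [Finsupp.single_eq_of_ne' hl]
            exact zero_mem _
  smul_mem := fun i j a f ha hf k => by
    rw [Finsupp.smul_apply, add_sub_assoc]
    exact h𝒜.mul_mem ha (hf k)

theorem free_isFree (h𝒜 : SetLike.GradedMonoid 𝒜)
    (hint : DirectSum.IsInternal fun d => (𝒜 d).toAddSubgroup) (κ : Type) (deg : κ → ℤ) :
    (free h𝒜 hint κ deg).IsFree := by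
  refine ⟨κ, Finsupp.basisSingleOne, deg, fun k l => ?_⟩
  change (Finsupp.basisSingleOne (R := A) k) l ∈ 𝒜 (deg k - deg l)
  rw [Finsupp.coe_basisSingleOne]
  by_cases hl : k = l
  · subst hl
    rw [Finsupp.single_eq_same, sub_self]
    exact h𝒜.one_mem
  · rw [Finsupp.single_eq_of_ne' hl]
    exact zero_mem _

/-- The morphism from a free graded module determined by homogeneous elements. -/
noncomputable def freeLift (h𝒜 : SetLike.GradedMonoid 𝒜)
    (hint : DirectSum.IsInternal fun d => (𝒜 d).toAddSubgroup) {κ : Type} {deg : κ → ℤ}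
    (M : GrMod 𝒜) (s : κ → M.carrier) (hs : ∀ k, s k ∈ M.grading (deg k)) :
    free h𝒜 hint κ deg ⟶ M where
  toLin := Finsupp.linearCombination A s
  map_mem := fun d (f : κ →₀ A) hf => by
    change (f.sum fun k a => a • s k) ∈ M.grading d
    refine AddSubgroup.sum_mem _ fun k _ => ?_
    have := M.smul_mem _ _ _ _ (hf k) (hs k)
    rwa [sub_add_cancel] at this

end Generic

end GrMod

/-! ### Gradings by weights of words -/

section WordPiece

variable {ι A : Type} [Ring A] [Algebra (ZMod 2) A] (g : ι → A) (wt : ι → ℤ)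

theorem wordPiece_gradedMonoid : SetLike.GradedMonoid (wordPiece g wt) where
  one_mem := one_mem_wordPiece g wt
  mul_mem _ _ _ _ := mul_mem_wordPiece g wt

/-- If an algebra generated by elements `g i` has a coaction of the Laurent polynomials giving
`g i` the weight `wt i`, then the spans of the words of given weights form a grading. -/
theorem wordPiece_isInternal (δ : A →ₐ[ZMod 2] AddMonoidAlgebra A ℤ)
    (hδ : ∀ i, δ (g i) = AddMonoidAlgebra.single (wt i) (g i))
    (hgen : ∀ x : A, x ∈ Algebra.adjoin (ZMod 2) (Set.range g)) :
    DirectSum.IsInternal fun d => (wordPiece g wt d).toAddSubgroup := by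
  have key : ∀ d, ∀ x ∈ wordPiece g wt d, δ x = AddMonoidAlgebra.single d x := by
    intro d x hx
    induction hx using Submodule.span_induction with
    | mem x h =>
      obtain ⟨w, rfl, rfl⟩ := h
      induction w with
      | nil =>
        simp only [List.map_nil, List.prod_nil, List.sum_nil, map_one, AddMonoidAlgebra.one_def]
      | cons i w ih =>
        rw [List.map_cons, List.map_cons, List.prod_cons, List.sum_cons, map_mul, hδ, ih,
          AddMonoidAlgebra.single_mul_single]
    | zero => rw [map_zero, AddMonoidAlgebra.single_zero]
    | add x y _ _ hx hy => rw [map_add, hx, hy, AddMonoidAlgebra.single_add]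
    | smul c x _ hx => rw [map_smul, hx, AddMonoidAlgebra.smul_single]
  have words : ∀ x ∈ Submonoid.closure (Set.range g), ∃ w : List ι, x = (w.map g).prod := by
    intro x hx
    induction hx using Submonoid.closure_induction with
    | mem x h => obtain ⟨i, rfl⟩ := h; exact ⟨[i], by simp⟩
    | one => exact ⟨[], rfl⟩
    | mul x y _ _ hx hy =>
      obtain ⟨v, rfl⟩ := hx
      obtain ⟨w, rfl⟩ := hy
      exact ⟨v ++ w, by simp⟩
  refine GrMod.isInternal_of_proj _ (fun d => (Finsupp.applyAddHom d).comp
    ((AddMonoidAlgebra.coeffAddEquiv).toAddMonoidHom.comp δ.toRingHom.toAddMonoidHom))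
    (fun d x hx => ?_) (fun d e he x hx => ?_) fun x => ?_
  · change (δ x).coeff d = x
    rw [key d x hx, AddMonoidAlgebra.coeff_single, Finsupp.single_eq_same]
  · change (δ x).coeff e = 0
    rw [key d x hx, AddMonoidAlgebra.coeff_single, Finsupp.single_eq_of_ne he]
  · have hx : x ∈ Submodule.span (ZMod 2) (Submonoid.closure (Set.range g) : Set A) := by
      rw [← Algebra.adjoin_eq_span]
      exact hgen x
    induction hx using Submodule.span_induction with
    | mem x h =>
      obtain ⟨w, rfl⟩ := words x h
      exact AddSubgroup.mem_iSup_of_mem _ (Submodule.subset_span ⟨w, rfl, rfl⟩)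
    | zero => exact zero_mem _
    | add x y _ _ hx hy => exact add_mem hx hy
    | smul c x _ hx =>
      have hc : c = 0 ∨ c = 1 := by revert c; decide
      rcases hc with rfl | rfl
      · rw [zero_smul]; exact zero_mem _
      · rwa [one_smul]

end WordPiece

/-! ### Modules over `𝒜(1)` -/

section CharTwo

variable {X : Type} [AddCommGroup X]

theorem add_self_of_algebra (A : Type) [Ring A] [Algebra (ZMod 2) A] [Module A X] (x : X) :
    x + x = 0 := by
  have h : (1 : A) + 1 = 0 := by
    rw [← map_one (algebraMap (ZMod 2) A), ← map_add, show (1 : ZMod 2) + 1 = 0 from by decide,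
      map_zero]
  rw [← one_smul A x, ← add_smul, h, zero_smul]

theorem eq_of_add_eq_zero_of_algebra (A : Type) [Ring A] [Algebra (ZMod 2) A] [Module A X]
    {x y : X} (h : x + y = 0) : x = y := by
  rw [eq_neg_of_add_eq_zero_left h]
  exact (eq_neg_of_add_eq_zero_left (add_self_of_algebra A y)).symm

theorem sub_eq_add_of_algebra (A : Type) [Ring A] [Algebra (ZMod 2) A] [Module A X] (x y : X) :
    x - y = x + y := by
  rw [sub_eq_add_neg, ← eq_neg_of_add_eq_zero_left (add_self_of_algebra A y)]

end CharTwo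

namespace A1

theorem induction {C : A1 → Prop} (hc : ∀ c : ZMod 2, C (algebraMap _ _ c)) (h1 : C Sq1)
    (h2 : C Sq2) (hmul : ∀ x y, C x → C y → C (x * y)) (hadd : ∀ x y, C x → C y → C (x + y))
    (x : A1) : C x := by
  obtain ⟨y, rfl⟩ := RingQuot.mkAlgHom_surjective (ZMod 2) A1Rel x
  induction y using FreeAlgebra.induction with
  | grade0 r => rw [AlgHom.commutes]; exact hc r
  | grade1 s => cases s with
    | sq1 => exact h1
    | sq2 => exact h2
  | mul a b ha hb => rw [map_mul]; exact hmul _ _ ha hb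
  | add a b ha hb => rw [map_add]; exact hadd _ _ ha hb

/-- The algebra homomorphism out of `𝒜(1)` determined by two elements satisfying the defining
relations. -/
noncomputable def lift {B : Type} [Ring B] [Algebra (ZMod 2) B] (x y : B) (hx : x * x = 0)
    (hy : y * y = x * y * x) : A1 →ₐ[ZMod 2] B :=
  RingQuot.liftAlgHom (ZMod 2)
    ⟨FreeAlgebra.lift (ZMod 2) (fun s => match s with | SqGen.sq1 => x | SqGen.sq2 => y), by
      rintro _ _ (_ | _) <;> simp [hx, hy]⟩

theorem lift_Sq1 {B : Type} [Ring B] [Algebra (ZMod 2) B] (x y : B) (hx : x * x = 0)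
    (hy : y * y = x * y * x) : lift x y hx hy Sq1 = x := by
  simp [lift, Sq1, gen]

theorem lift_Sq2 {B : Type} [Ring B] [Algebra (ZMod 2) B] (x y : B) (hx : x * x = 0)
    (hy : y * y = x * y * x) : lift x y hx hy Sq2 = y := by
  simp [lift, Sq2, gen]

theorem mem_adjoin_gen (x : A1) : x ∈ Algebra.adjoin (ZMod 2) (Set.range gen) :=
  induction (C := fun x => x ∈ Algebra.adjoin (ZMod 2) (Set.range gen))
    (fun c => Subalgebra.algebraMap_mem _ c) (Algebra.subset_adjoin ⟨SqGen.sq1, rfl⟩)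
    (Algebra.subset_adjoin ⟨SqGen.sq2, rfl⟩) (fun _ _ hx hy => mul_mem hx hy)
    (fun _ _ hx hy => add_mem hx hy) x

theorem piece_gradedMonoid : SetLike.GradedMonoid piece := wordPiece_gradedMonoid gen wt

theorem piece_isInternal : DirectSum.IsInternal fun d => (piece d).toAddSubgroup := by
  refine wordPiece_isInternal gen wt (lift (AddMonoidAlgebra.single 1 Sq1)
    (AddMonoidAlgebra.single 2 Sq2) ?_ ?_) ?_ mem_adjoin_gen
  · rw [AddMonoidAlgebra.single_mul_single, Sq1_mul_Sq1, AddMonoidAlgebra.single_zero]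
  · rw [AddMonoidAlgebra.single_mul_single, AddMonoidAlgebra.single_mul_single,
      AddMonoidAlgebra.single_mul_single, Sq2_mul_Sq2]
    norm_num
  · rintro (_ | _)
    · exact lift_Sq1 _ _ _ _
    · exact lift_Sq2 _ _ _ _

section Module

variable {X Y : Type} [AddCommGroup X] [Module A1 X] [AddCommGroup Y] [Module A1 Y]

theorem add_self_smul (x : X) : x + x = 0 := add_self_of_algebra A1 x

theorem Sq1_Sq1_smul (x : X) : Sq1 • Sq1 • x = 0 := by rw [← mul_smul, Sq1_mul_Sq1, zero_smul]

theorem Sq2_Sq2_smul (x : X) : Sq2 • Sq2 • x = Sq1 • Sq2 • Sq1 • x := by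
  rw [← mul_smul, Sq2_mul_Sq2, mul_smul, mul_smul]

/-- The two expressions of the top element of `𝒜(1)` as an alternating word agree. -/
theorem Sq2_Sq1_Sq2_Sq1_smul (x : X) :
    Sq2 • Sq1 • Sq2 • Sq1 • x = Sq1 • Sq2 • Sq1 • Sq2 • x := by
  rw [← Sq2_Sq2_smul x, Sq2_Sq2_smul (Sq2 • x)]

theorem top_smul_Sq1_smul (x : X) : Sq2 • Sq2 • Sq2 • Sq1 • x = 0 := by
  rw [Sq2_Sq2_smul, Sq2_Sq1_Sq2_Sq1_smul, Sq1_Sq1_smul]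

theorem top_smul_Sq2_smul (x : X) : Sq2 • Sq2 • Sq2 • Sq2 • x = 0 := by
  rw [Sq2_Sq2_smul, Sq2_Sq2_smul, Sq1_Sq1_smul, smul_zero, smul_zero]

theorem Q0_smul (x : X) : Q0 • x = Sq1 • x := rfl

theorem Q1_smul (x : X) : Q1 • x = Sq1 • Sq2 • x + Sq2 • Sq1 • x := by
  rw [Q1, add_smul, mul_smul, mul_smul]

/-- An additive map commuting with the two generators is linear. -/
noncomputable def linOfCommutes (F : X →+ Y) (h1 : ∀ x, F (Sq1 • x) = Sq1 • F x)
    (h2 : ∀ x, F (Sq2 • x) = Sq2 • F x) : X →ₗ[A1] Y :=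
  { F with
    map_smul' := fun a => by
      refine induction (C := fun a => ∀ x, F (a • x) = a • F x) (fun c x => ?_) h1 h2
        (fun x y hx hy z => ?_) (fun x y hx hy z => ?_) a
      · have hc : c = 0 ∨ c = 1 := by revert c; decide
        rcases hc with rfl | rfl <;> simp
      · rw [mul_smul, mul_smul, hx, hy]
      · rw [add_smul, add_smul, map_add, hx, hy] }

theorem linOfCommutes_apply (F : X →+ Y) (h1 : ∀ x, F (Sq1 • x) = Sq1 • F x)
    (h2 : ∀ x, F (Sq2 • x) = Sq2 • F x) (x : X) : linOfCommutes F h1 h2 x = F x := rfl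

/-- A linear endomorphism with values in `Sq¹ X + Sq² X` is nilpotent, since all words of length
five in `Sq¹` and `Sq²` vanish. -/
theorem isNilpotent_of_rad (φ : X →ₗ[A1] X) (h : ∀ x, ∃ y z, φ x = Sq1 • y + Sq2 • z) :
    IsNilpotent φ := by
  have h2 : ∀ x, ∃ y z, (φ ^ 2) x = Sq1 • Sq2 • y + Sq2 • Sq1 • z := by
    intro x
    obtain ⟨y, z, e⟩ := h x
    obtain ⟨y1, y2, e1⟩ := h y
    obtain ⟨z1, z2, e2⟩ := h z
    refine ⟨y2 + Sq1 • z2, z1, ?_⟩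
    rw [pow_succ', pow_one, Module.End.mul_apply, e, map_add, map_smul, map_smul, e1, e2]
    simp only [smul_add, Sq1_Sq1_smul, Sq2_Sq2_smul]
    abel
  have h3 : ∀ x, ∃ y z, (φ ^ 3) x = Sq1 • Sq2 • Sq1 • y + Sq2 • Sq1 • Sq2 • z := by
    intro x
    obtain ⟨y, z, e⟩ := h2 x
    obtain ⟨y1, y2, e1⟩ := h y
    obtain ⟨z1, z2, e2⟩ := h z
    refine ⟨y1, z2, ?_⟩
    rw [pow_succ', Module.End.mul_apply, e]
    simp only [map_add, map_smul, e1, e2, smul_add, Sq1_Sq1_smul, Sq2_Sq2_smul, smul_zero]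
    abel
  have h4 : ∀ x, ∃ y, (φ ^ 4) x = Sq1 • Sq2 • Sq1 • Sq2 • y := by
    intro x
    obtain ⟨y, z, e⟩ := h3 x
    obtain ⟨y1, y2, e1⟩ := h y
    obtain ⟨z1, z2, e2⟩ := h z
    refine ⟨y2 + z1, ?_⟩
    rw [pow_succ', Module.End.mul_apply, e]
    simp only [map_add, map_smul, e1, e2, smul_add, Sq1_Sq1_smul, Sq2_Sq2_smul, smul_zero,
      Sq2_Sq1_Sq2_Sq1_smul]
    abel
  refine ⟨5, LinearMap.ext fun x => ?_⟩
  obtain ⟨y, e⟩ := h4 x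
  obtain ⟨y1, y2, e1⟩ := h y
  rw [pow_succ', Module.End.mul_apply, e]
  simp only [map_smul, e1, smul_add, Sq1_Sq1_smul, Sq2_Sq2_smul,
      Sq2_Sq1_Sq2_Sq1_smul, add_zero, LinearMap.zero_apply]

end Module

/-- The top element of `𝒜(1)` is nonzero. -/
theorem Sq2_pow_three_ne_zero : Sq2 * Sq2 * Sq2 ≠ 0 := by
  -- The regular representation on the basis `1, a, b, ab, ba, aba, bab, abab`, where
  -- `a = Sq¹` and `b = Sq²`.
  let m1 : Matrix (Fin 8) (Fin 8) (ZMod 2) := Matrix.of fun i j =>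
    if (j, i) ∈ [((0 : Fin 8), (1 : Fin 8)), (2, 3), (4, 5), (6, 7)] then 1 else 0
  let m2 : Matrix (Fin 8) (Fin 8) (ZMod 2) := Matrix.of fun i j =>
    if (j, i) ∈ [((0 : Fin 8), (2 : Fin 8)), (1, 4), (2, 5), (3, 6), (5, 7)] then 1 else 0
  have h3 : m2 * m2 * m2 ≠ 0 := by decide
  intro h
  have := congrArg (lift m1 m2 (by decide) (by decide)) h
  rw [map_mul, map_mul, lift_Sq2, map_zero] at this
  exact h3 this

/-- Every element of `𝒜(1)` is the sum of a scalar and an element of the augmentation ideal. -/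
theorem exists_scalar_add (x : A1) :
    ∃ (c : ZMod 2) (y z : A1), x = algebraMap _ _ c + (Sq1 * y + Sq2 * z) := by
  refine induction (C := fun x => ∃ (c : ZMod 2) (y z : A1),
    x = algebraMap _ _ c + (Sq1 * y + Sq2 * z)) (fun c => ⟨c, 0, 0, by simp⟩)
    ⟨0, 1, 0, by simp⟩ ⟨0, 0, 1, by simp⟩ ?_ ?_ x
  · rintro _ v ⟨c, y, z, rfl⟩ ⟨c', y', z', rfl⟩
    refine ⟨c * c', c • y' + y * (algebraMap _ _ c' + (Sq1 * y' + Sq2 * z')),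
      c • z' + z * (algebraMap _ _ c' + (Sq1 * y' + Sq2 * z')), ?_⟩
    rw [add_mul (algebraMap _ _ c)]
    simp only [mul_add (algebraMap (ZMod 2) A1 c), ← Algebra.smul_def, map_mul, mul_add, add_mul,
      mul_smul_comm, mul_assoc]
    abel
  · rintro _ _ ⟨c, y, z, rfl⟩ ⟨c', y', z', rfl⟩
    refine ⟨c + c', y + y', z + z', ?_⟩
    rw [map_add, mul_add, mul_add]
    abel

/-- In a free module, the elements killed by the top element are decomposable. -/
theorem exists_of_top_smul_eq_zero {P : Type} [AddCommGroup P] [Module A1 P] [Module.Free A1 P]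
    {p : P} (h : Sq2 • Sq2 • Sq2 • p = 0) : ∃ y z, p = Sq1 • y + Sq2 • z := by
  let b := Module.Free.chooseBasis A1 P
  have hk : ∀ k, ∃ y z : A1, b.repr p k = Sq1 * y + Sq2 * z := by
    intro k
    obtain ⟨c, y, z, e⟩ := exists_scalar_add (b.repr p k)
    have h' : Sq2 • Sq2 • Sq2 • b.repr p k = 0 := by
      have := congrArg (fun q => b.repr q k) h
      simpa only [map_smul, Finsupp.smul_apply, map_zero, Finsupp.zero_apply] using this
    have h' : Sq2 • Sq2 • Sq2 • ((algebraMap _ _ c : A1) + (Sq1 • y + Sq2 • z)) = 0 := by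
      rw [e] at h'
      exact h'
    have hy : Sq2 • Sq2 • Sq2 • Sq1 • y = 0 := top_smul_Sq1_smul y
    have hz : Sq2 • Sq2 • Sq2 • Sq2 • z = 0 := top_smul_Sq2_smul z
    rw [smul_add, smul_add, smul_add, smul_add, smul_add, smul_add, hy, hz, add_zero,
      add_zero] at h'
    have hc : c = 0 ∨ c = 1 := (by decide : ∀ c : ZMod 2, c = 0 ∨ c = 1) c
    rcases hc with rfl | rfl
    · exact ⟨y, z, by rw [e, map_zero, zero_add]⟩
    · exfalso
      apply Sq2_pow_three_ne_zero
      rw [map_one] at h'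
      simpa only [smul_eq_mul, mul_one, mul_assoc] using h'
  choose y z e using hk
  refine ⟨(b.repr p).sum fun k _ => y k • b k, (b.repr p).sum fun k _ => z k • b k, ?_⟩
  conv_lhs => rw [← b.linearCombination_repr p, Finsupp.linearCombination_apply]
  simp only [Finsupp.sum, Finset.smul_sum, ← Finset.sum_add_distrib]
  refine Finset.sum_congr rfl fun k _ => ?_
  rw [e, add_smul, mul_smul, mul_smul]

theorem Sq1_mem {M : GrMod piece} {d e : ℤ} {x : M.carrier} (hx : x ∈ M.grading d)
    (he : e = d + 1) : Sq1 • x ∈ M.grading e := by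
  rw [he, add_comm]
  exact M.smul_mem 1 d Sq1 x (gen_mem_wordPiece gen wt SqGen.sq1) hx

theorem Sq2_mem {M : GrMod piece} {d e : ℤ} {x : M.carrier} (hx : x ∈ M.grading d)
    (he : e = d + 2) : Sq2 • x ∈ M.grading e := by
  rw [he, add_comm]
  exact M.smul_mem 2 d Sq2 x (gen_mem_wordPiece gen wt SqGen.sq2) hx

/-- The trace of an additive map `H` of degree `-6` between graded modules, with respect to the
dual bases `1, a, b, ab, ba, aba, bab, abab` and `abab, bab, aba, ab, ba, b, a, 1` of the Frobenius
algebra `𝒜(1)`, where `a = Sq¹` and `b = Sq²`. -/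
noncomputable def trace {M P : GrMod piece} (H : M.carrier →+ P.carrier)
    (hH : ∀ d, ∀ x ∈ M.grading d, H x ∈ P.grading (d - 6)) : M ⟶ P where
  toLin := linOfCommutes
    { toFun := fun x => H (Sq1 • Sq2 • Sq1 • Sq2 • x) + Sq1 • H (Sq2 • Sq1 • Sq2 • x) +
        Sq2 • H (Sq1 • Sq2 • Sq1 • x) + Sq1 • Sq2 • H (Sq1 • Sq2 • x) +
        Sq2 • Sq1 • H (Sq2 • Sq1 • x) + Sq1 • Sq2 • Sq1 • H (Sq2 • x) +
        Sq2 • Sq1 • Sq2 • H (Sq1 • x) + Sq1 • Sq2 • Sq1 • Sq2 • H x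
      map_zero' := by simp
      map_add' := fun x y => by simp only [smul_add, map_add]; abel }
    (fun x => by
      simp only [AddMonoidHom.coe_mk, ZeroHom.coe_mk, smul_add, Sq1_Sq1_smul,
        Sq2_Sq1_Sq2_Sq1_smul, smul_zero, map_zero, add_zero, zero_add])
    (fun x => by
      simp only [AddMonoidHom.coe_mk, ZeroHom.coe_mk, smul_add, Sq1_Sq1_smul, Sq2_Sq2_smul,
        Sq2_Sq1_Sq2_Sq1_smul, smul_zero, map_zero, add_zero, zero_add])
  map_mem := fun d x hx => by
    have ha : ∀ {e : ℤ} {y : M.carrier}, y ∈ M.grading e → Sq1 • y ∈ M.grading (e + 1) :=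
      fun h => Sq1_mem h rfl
    have hb : ∀ {e : ℤ} {y : M.carrier}, y ∈ M.grading e → Sq2 • y ∈ M.grading (e + 2) :=
      fun h => Sq2_mem h rfl
    have ha' : ∀ {e : ℤ} {y : P.carrier}, y ∈ P.grading e → Sq1 • y ∈ P.grading (e + 1) :=
      fun h => Sq1_mem h rfl
    have hb' : ∀ {e : ℤ} {y : P.carrier}, y ∈ P.grading e → Sq2 • y ∈ P.grading (e + 2) :=
      fun h => Sq2_mem h rfl
    have cast : ∀ {e : ℤ} {y : P.carrier}, y ∈ P.grading e → e = d → y ∈ P.grading d :=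
      fun h h' => h' ▸ h
    rw [linOfCommutes_apply]
    refine add_mem (add_mem (add_mem (add_mem (add_mem (add_mem (add_mem ?_ ?_) ?_) ?_) ?_) ?_) ?_)
      ?_
    · exact cast (hH _ _ (ha (hb (ha (hb hx))))) (by ring)
    · exact cast (ha' (hH _ _ (hb (ha (hb hx))))) (by ring)
    · exact cast (hb' (hH _ _ (ha (hb (ha hx))))) (by ring)
    · exact cast (ha' (hb' (hH _ _ (ha (hb hx))))) (by ring)
    · exact cast (hb' (ha' (hH _ _ (hb (ha hx))))) (by ring)
    · exact cast (ha' (hb' (ha' (hH _ _ (hb hx))))) (by ring)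
    · exact cast (hb' (ha' (hb' (hH _ _ (ha hx))))) (by ring)
    · exact cast (ha' (hb' (ha' (hb' (hH _ _ hx))))) (by ring)

theorem trace_apply {M P : GrMod piece} (H : M.carrier →+ P.carrier)
    (hH : ∀ d, ∀ x ∈ M.grading d, H x ∈ P.grading (d - 6)) (x : M.carrier) :
    (trace H hH).toLin x = H (Sq1 • Sq2 • Sq1 • Sq2 • x) + Sq1 • H (Sq2 • Sq1 • Sq2 • x) +
        Sq2 • H (Sq1 • Sq2 • Sq1 • x) + Sq1 • Sq2 • H (Sq1 • Sq2 • x) +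
        Sq2 • Sq1 • H (Sq2 • Sq1 • x) + Sq1 • Sq2 • Sq1 • H (Sq2 • x) +
        Sq2 • Sq1 • Sq2 • H (Sq1 • x) + Sq1 • Sq2 • Sq1 • Sq2 • H x := rfl

end A1

/-! ### Splitting off free summands -/

namespace A1

/-- Homogeneous elements `s k` of a graded module whose multiples by the top element form a basis
of the multiples of the top element, and a graded map reading off the coordinates. -/
theorem exists_top_coordinates (M : GrMod piece) :
    ∃ (κ : Type) (deg : κ → ℤ) (s : κ → M.carrier) (ℓ : M.carrier →+ (κ →₀ ZMod 2)),
      (∀ k, s k ∈ M.grading (deg k)) ∧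
      (∀ k, ℓ (Sq2 • Sq2 • Sq2 • s k) = Finsupp.single k 1) ∧
      (∀ d, ∀ x ∈ M.grading d, ∀ k, ℓ x k ≠ 0 → deg k + 6 = d) ∧
      (∀ x, ℓ (Sq2 • Sq2 • Sq2 • x) = 0 → Sq2 • Sq2 • Sq2 • x = 0) := by
  classical
  let _ : Module (ZMod 2) M.carrier := Module.compHom M.carrier (algebraMap (ZMod 2) A1)
  have hb : ∀ {e : ℤ} {y : M.carrier}, y ∈ M.grading e → Sq2 • y ∈ M.grading (e + 2) :=
    fun h => Sq2_mem h rfl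
  let top : M.carrier →+ M.carrier :=
    { toFun := fun x => Sq2 • Sq2 • Sq2 • x
      map_zero' := by simp
      map_add' := fun x y => by simp only [smul_add] }
  let S : Set M.carrier := {y | ∃ d, ∃ x ∈ M.grading d, y = top x}
  obtain ⟨B, hBS, hspan, hli⟩ := exists_linearIndependent (ZMod 2) S
  choose deg s hs hsB using fun k : B => hBS k.2
  have htopd : ∀ d, ∀ x ∈ M.grading d, top x ∈ M.grading (6 + d) := fun d x hx => by
    have := hb (hb (hb hx))
    rwa [show d + 2 + 2 + 2 = 6 + d by ring] at this
  obtain ⟨ℓ₀, hℓ₀⟩ := LinearMap.exists_extend hli.repr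
  have hℓ₀s : ∀ k : B, ℓ₀ k.1 = Finsupp.single k 1 := by
    intro k
    have h := LinearMap.congr_fun hℓ₀ ⟨k.1, Submodule.subset_span ⟨k, rfl⟩⟩
    exact h.trans (hli.repr_eq_single k _ rfl)
  -- `ℓ₀` is made homogeneous by keeping only the coordinates of the right degree
  let ℓ : M.carrier →+ (B →₀ ZMod 2) :=
    (DirectSum.toAddMonoid fun d => (Finsupp.filterAddHom fun k => deg k + 6 = d).comp
      (ℓ₀.toAddMonoidHom.comp (M.grading d).subtype)).comp
      (DirectSum.decomposeAddEquiv M.grading).toAddMonoidHom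
  have hℓ : ∀ d, ∀ x ∈ M.grading d, ℓ x = (ℓ₀ x).filter fun k => deg k + 6 = d := by
    intro d x hx
    have : DirectSum.decompose M.grading x = DirectSum.of (fun d => M.grading d) d ⟨x, hx⟩ :=
      DirectSum.decompose_of_mem _ hx
    change DirectSum.toAddMonoid _ (DirectSum.decompose M.grading x) = _
    rw [this, DirectSum.toAddMonoid_of]
    rfl
  have hℓs : ∀ k, ℓ (top (s k)) = Finsupp.single k 1 := by
    intro k
    rw [hℓ _ _ (htopd _ _ (hs k)), ← hsB, hℓ₀s]
    exact Finsupp.filter_single_of_pos _ (by ring)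
  refine ⟨B, deg, s, ℓ, hs, hℓs, fun d x hx k hk => ?_, fun x hx => ?_⟩
  · by_contra h
    rw [hℓ d x hx] at hk
    exact hk (Finsupp.filter_apply_neg (fun k => deg k + 6 = d) _ h)
  · -- the multiples of the top element are the span of the elements `top (s k)`
    have hmem : ∀ x, top x ∈ Submodule.span (ZMod 2) B := by
      intro x
      rw [hspan]
      induction x using M.homogeneous_induction with
      | zero => rw [map_zero]; exact zero_mem _
      | add x y hx hy => rw [map_add]; exact add_mem hx hy
      | hom d x hx => exact Submodule.subset_span ⟨d, x, hx, rfl⟩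
    have hinv : ∀ y ∈ Submodule.span (ZMod 2) B,
        Finsupp.linearCombination (ZMod 2) (fun k : B => k.1) (ℓ y) = y := by
      intro y hy
      induction hy using Submodule.span_induction with
      | mem y h =>
        have e := hsB ⟨y, h⟩
        change y = _ at e
        rw [e, hℓs, Finsupp.linearCombination_single, one_smul]
        exact e
      | zero => simp
      | add y z _ _ hy hz => rw [map_add, map_add, hy, hz]
      | smul c y _ hy =>
        have hc : c = 0 ∨ c = 1 := (by decide : ∀ c : ZMod 2, c = 0 ∨ c = 1) c
        rcases hc with rfl | rfl
        · simp
        · rwa [one_smul]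
    have h := hinv _ (hmem x)
    change ℓ (top x) = 0 at hx
    rw [hx, map_zero] at h
    exact h.symm

/-- Every graded `𝒜(1)`-module is stably isomorphic to one killed by the top element. -/
theorem exists_reduced (M : GrMod piece) : ∃ M' : GrMod piece,
    (∀ x : M'.carrier, Sq2 • Sq2 • Sq2 • x = 0) ∧ Nonempty (StCat.of M' ≅ StCat.of M) := by
  classical
  obtain ⟨κ, deg, s, ℓ, hs, hℓs, hℓd, hℓ0⟩ := exists_top_coordinates M
  let P := GrMod.free piece_gradedMonoid piece_isInternal κ deg
  let ι : (κ →₀ ZMod 2) →+ P.carrier :=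
    Finsupp.mapRange.addMonoidHom (algebraMap (ZMod 2) A1 : ZMod 2 →+ A1)
  let H : M.carrier →+ P.carrier := ι.comp ℓ
  have hH : ∀ d, ∀ x ∈ M.grading d, H x ∈ P.grading (d - 6) := by
    intro d x hx k
    change algebraMap (ZMod 2) A1 (ℓ x k) ∈ piece (d - 6 - deg k)
    by_cases hk : ℓ x k = 0
    · rw [hk, map_zero]; exact zero_mem _
    · rw [show d - 6 - deg k = 0 by have := hℓd d x hx k hk; omega]
      rw [Algebra.algebraMap_eq_smul_one]
      exact Submodule.smul_mem _ _ (one_mem_wordPiece gen wt)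
  let r : M ⟶ P := trace H hH
  let j : P ⟶ M := GrMod.freeLift piece_gradedMonoid piece_isInternal M s hs
  let e : κ → P.carrier := fun k => (Finsupp.single k 1 : κ →₀ A1)
  have hj : ∀ k, j.toLin (e k) = s k := by
    intro k
    exact (Finsupp.linearCombination_single A1 1 k).trans (one_smul _ _)
  -- `j ≫ r` is the identity modulo decomposables, hence invertible
  let ε : P.carrier →ₗ[A1] P.carrier := r.toLin.comp j.toLin - LinearMap.id
  let R : Submodule A1 P.carrier :=
    { carrier := {p | ∃ y z, p = Sq1 • y + Sq2 • z}
      zero_mem' := ⟨0, 0, by simp⟩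
      add_mem' := by
        rintro _ _ ⟨y, z, rfl⟩ ⟨y', z', rfl⟩
        exact ⟨y + y', z + z', by simp only [smul_add]; abel⟩
      smul_mem' := by
        rintro a _ ⟨y, z, rfl⟩
        obtain ⟨c, u, v, rfl⟩ := exists_scalar_add a
        have hc : c = 0 ∨ c = 1 := (by decide : ∀ c : ZMod 2, c = 0 ∨ c = 1) c
        rcases hc with rfl | rfl
        · exact ⟨u • (Sq1 • y + Sq2 • z), v • (Sq1 • y + Sq2 • z), by
            rw [map_zero, zero_add, add_smul, mul_smul, mul_smul]⟩
        · exact ⟨y + u • (Sq1 • y + Sq2 • z), z + v • (Sq1 • y + Sq2 • z), by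
            rw [map_one, add_smul, one_smul, add_smul, mul_smul, mul_smul, smul_add Sq1 y,
              smul_add Sq2 z]
            abel⟩ }
  have hR1 : ∀ p : P.carrier, Sq1 • p ∈ R := fun p => ⟨p, 0, by rw [smul_zero, add_zero]⟩
  have hR2 : ∀ p : P.carrier, Sq2 • p ∈ R := fun p => ⟨0, p, by rw [smul_zero, zero_add]⟩
  have hε1 : ∀ k, ε (e k) ∈ R := by
    intro k
    have hH1 : H (Sq1 • Sq2 • Sq1 • Sq2 • s k) = e k := by
      rw [← Sq2_Sq2_smul]
      change ι (ℓ _) = _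
      rw [hℓs]
      exact (Finsupp.mapRange_single (hf := map_zero _)).trans
        (congrArg _ (map_one (algebraMap (ZMod 2) A1)))
    change r.toLin (j.toLin (e k)) - e k ∈ R
    rw [hj, trace_apply, hH1]
    simp only [add_assoc]
    rw [add_sub_cancel_left]
    exact add_mem (hR1 _) (add_mem (hR2 _) (add_mem (hR1 _) (add_mem (hR2 _)
      (add_mem (hR1 _) (add_mem (hR2 _) (hR1 _))))))
  have hε : ∀ p, ∃ y z, ε p = Sq1 • y + Sq2 • z := by
    intro p
    change ε p ∈ R
    revert p
    change ∀ p : κ →₀ A1, ε p ∈ R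
    intro p
    induction p using Finsupp.induction_linear with
    | zero => rw [show ε (0 : κ →₀ A1) = 0 from map_zero ε]; exact zero_mem _
    | add p q hp hq =>
      rw [show ε (p + q : κ →₀ A1) = ε p + ε q from map_add ε p q]; exact add_mem hp hq
    | single k a =>
      have ha : (Finsupp.single k a : κ →₀ A1) = a • e k :=
        ((Finsupp.smul_single a k (1 : A1)).trans (by rw [smul_eq_mul, mul_one])).symm
      rw [ha, map_smul]
      exact R.smul_mem a (hε1 k)
  have hbij : Function.Bijective (j ≫ r).toLin := by
    have h1 : IsUnit (1 + ε) := (isNilpotent_of_rad ε hε).isUnit_one_add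
    have h2 : 1 + ε = (j ≫ r).toLin := add_sub_cancel _ _
    rw [h2] at h1
    exact (Module.End.isUnit_iff _).1 h1
  let φ := GrMod.isoOfBijective (j ≫ r) hbij
  have hφ : ∀ p, r.toLin (j.toLin (φ.inv.toLin p)) = p := fun p =>
    congrArg (fun f : P ⟶ P => f.toLin p) φ.inv_hom_id
  let q : M ⟶ GrMod.ker r :=
    { toLin := LinearMap.codRestrict (LinearMap.ker r.toLin)
        (LinearMap.id + (j.toLin.comp (φ.inv.toLin.comp r.toLin))) fun x => by
          rw [LinearMap.mem_ker, LinearMap.add_apply, map_add]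
          change r.toLin x + r.toLin (j.toLin (φ.inv.toLin (r.toLin x))) = 0
          rw [hφ, add_self_smul]
      map_mem := fun d x hx => by
        change x + j.toLin (φ.inv.toLin (r.toLin x)) ∈ M.grading d
        exact add_mem hx (j.map_mem _ _ (φ.inv.map_mem _ _ (r.map_mem _ _ hx))) }
  refine ⟨GrMod.ker r, fun x => ?_, GrMod.nonempty_stable_iso (GrMod.kerι r) q
    ⟨P, GrMod.free_isFree _ _ _ _, ⟨0, fun _ _ _ => zero_mem _⟩, ⟨0, fun _ _ _ => zero_mem _⟩,
      fun x => ?_⟩ ⟨P, GrMod.free_isFree _ _ _ _, r ≫ φ.inv, j, fun x => ?_⟩⟩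
  · -- the coordinate of `r (top • x)` at the top element is `ℓ (top • x)`
    obtain ⟨x, hx⟩ := x
    apply Subtype.ext
    change Sq2 • Sq2 • Sq2 • x = 0
    apply hℓ0
    have h : r.toLin (Sq2 • Sq2 • Sq2 • x) = 0 := by
      rw [map_smul, map_smul, map_smul, LinearMap.mem_ker.1 hx, smul_zero, smul_zero, smul_zero]
    rw [trace_apply] at h
    simp only [Sq2_Sq2_smul, Sq2_Sq1_Sq2_Sq1_smul, Sq1_Sq1_smul, smul_zero,
      map_zero, add_zero, zero_add] at h
    rw [← Sq2_Sq1_Sq2_Sq1_smul, ← Sq2_Sq2_smul, ← Sq2_Sq1_Sq2_Sq1_smul, ← Sq2_Sq2_smul] at h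
    refine Finsupp.ext fun k => ?_
    have hc : ∀ c : ZMod 2, Sq2 * (Sq2 * (Sq2 * algebraMap (ZMod 2) A1 c)) = 0 → c = 0 := by
      intro c
      have hc : c = 0 ∨ c = 1 := (by decide : ∀ c : ZMod 2, c = 0 ∨ c = 1) c
      rcases hc with rfl | rfl
      · exact fun _ => rfl
      · intro h
        rw [map_one, mul_one, ← mul_assoc] at h
        exact absurd h Sq2_pow_three_ne_zero
    exact hc _ (congrArg (fun f : κ →₀ A1 => f k) h)
  · apply Subtype.ext
    change x.1 + j.toLin (φ.inv.toLin (r.toLin x.1)) - x.1 = 0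
    rw [LinearMap.mem_ker.1 x.2, map_zero, map_zero, add_zero, sub_self]
  · change x + j.toLin (φ.inv.toLin (r.toLin x)) - x = j.toLin (φ.inv.toLin (r.toLin x))
    rw [add_sub_cancel_left]

end A1

/-! ### Modules over `ℰ(1)` -/

namespace E1

theorem mem_adjoin_gen (x : E1) : x ∈ Algebra.adjoin (ZMod 2) (Set.range gen) :=
  induction (C := fun x => x ∈ Algebra.adjoin (ZMod 2) (Set.range gen))
    (fun c => Subalgebra.algebraMap_mem _ c) (Algebra.subset_adjoin ⟨QGen.q0, rfl⟩)
    (Algebra.subset_adjoin ⟨QGen.q1, rfl⟩) (fun _ _ hx hy => mul_mem hx hy)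
    (fun _ _ hx hy => add_mem hx hy) x

theorem piece_gradedMonoid : SetLike.GradedMonoid piece := wordPiece_gradedMonoid gen wt

theorem piece_isInternal : DirectSum.IsInternal fun d => (piece d).toAddSubgroup := by
  refine wordPiece_isInternal gen wt (lift (AddMonoidAlgebra.single 1 Q0)
    (AddMonoidAlgebra.single 3 Q1) ?_ ?_ ?_) ?_ mem_adjoin_gen
  · rw [AddMonoidAlgebra.single_mul_single, Q0_mul_Q0, AddMonoidAlgebra.single_zero]
  · rw [AddMonoidAlgebra.single_mul_single, Q1_mul_Q1, AddMonoidAlgebra.single_zero]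
  · rw [AddMonoidAlgebra.single_mul_single, AddMonoidAlgebra.single_mul_single, Q0_mul_Q1]
    norm_num
  · rintro (_ | _)
    · exact lift_Q0 _ _ _ _ _
    · exact lift_Q1 _ _ _ _ _

section Module

variable {X Y : Type} [AddCommGroup X] [Module E1 X] [AddCommGroup Y] [Module E1 Y]

theorem Q0_Q0_smul (x : X) : Q0 • Q0 • x = 0 := by rw [← mul_smul, Q0_mul_Q0, zero_smul]

theorem Q1_Q1_smul (x : X) : Q1 • Q1 • x = 0 := by rw [← mul_smul, Q1_mul_Q1, zero_smul]

theorem Q1_Q0_smul (x : X) : Q1 • Q0 • x = Q0 • Q1 • x := by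
  rw [← mul_smul, ← Q0_mul_Q1, mul_smul]

/-- An additive map commuting with the two generators is linear. -/
noncomputable def linOfCommutes (F : X →+ Y) (h0 : ∀ x, F (Q0 • x) = Q0 • F x)
    (h1 : ∀ x, F (Q1 • x) = Q1 • F x) : X →ₗ[E1] Y :=
  { F with
    map_smul' := fun a => by
      refine induction (C := fun a => ∀ x, F (a • x) = a • F x) (fun c x => ?_) h0 h1
        (fun x y hx hy z => ?_) (fun x y hx hy z => ?_) a
      · have hc : c = 0 ∨ c = 1 := by revert c; decide
        rcases hc with rfl | rfl <;> simp
      · rw [mul_smul, mul_smul, hx, hy]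
      · rw [add_smul, add_smul, map_add, hx, hy] }

end Module

theorem Q0_mul_Q1_ne_zero : Q0 * Q1 ≠ 0 := by
  -- the regular representation on the basis `1, Q₀, Q₁, Q₀ Q₁`
  let m0 : Matrix (Fin 4) (Fin 4) (ZMod 2) := Matrix.of fun i j =>
    if (j, i) ∈ [((0 : Fin 4), (1 : Fin 4)), (2, 3)] then 1 else 0
  let m1 : Matrix (Fin 4) (Fin 4) (ZMod 2) := Matrix.of fun i j =>
    if (j, i) ∈ [((0 : Fin 4), (2 : Fin 4)), (1, 3)] then 1 else 0
  have h3 : m0 * m1 ≠ 0 := by decide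
  intro h
  have := congrArg (lift m0 m1 (by decide) (by decide) (by decide)) h
  rw [map_mul, lift_Q0, lift_Q1, map_zero] at this
  exact h3 this

/-- In a free module, the elements killed by `Q₀ Q₁` are decomposable. -/
theorem exists_of_Q0_Q1_smul_eq_zero {P : Type} [AddCommGroup P] [Module E1 P] [Module.Free E1 P]
    {p : P} (h : Q0 • Q1 • p = 0) : ∃ y z, p = Q0 • y + Q1 • z := by
  let b := Module.Free.chooseBasis E1 P
  have hk : ∀ k, ∃ y z : E1, b.repr p k = Q0 * y + Q1 * z := by
    intro k
    obtain ⟨c, e⟩ := exists_coords (b.repr p k)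
    have h' : Q0 * (Q1 * b.repr p k) = 0 := by
      have := congrArg (fun q => b.repr q k) h
      rw [map_smul, map_smul, map_zero] at this
      exact this
    have e0 : Q1 * (Q0 * Q1) = 0 := by rw [Q0_mul_Q1, ← mul_assoc, Q1_mul_Q1, zero_mul]
    have e1 : Q0 * (Q1 * Q0) = 0 := by rw [← Q0_mul_Q1, ← mul_assoc, Q0_mul_Q0, zero_mul]
    simp only [e, mul_add, mul_smul_comm, mul_one, Q1_mul_Q1, e0, e1, smul_zero,
      add_zero] at h'
    have hc : c 0 = 0 ∨ c 0 = 1 := (by decide : ∀ c : ZMod 2, c = 0 ∨ c = 1) _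
    rcases hc with hc | hc
    · refine ⟨c 1 • 1 + c 3 • Q1, c 2 • 1, ?_⟩
      rw [e, hc]
      simp only [mul_add, mul_smul_comm, mul_one, zero_smul, zero_add]
      abel
    · rw [hc, one_smul] at h'
      exact absurd h' Q0_mul_Q1_ne_zero
  choose y z e using hk
  refine ⟨(b.repr p).sum fun k _ => y k • b k, (b.repr p).sum fun k _ => z k • b k, ?_⟩
  conv_lhs => rw [← b.linearCombination_repr p, Finsupp.linearCombination_apply]
  simp only [Finsupp.sum, Finset.smul_sum, ← Finset.sum_add_distrib]
  refine Finset.sum_congr rfl fun k _ => ?_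
  rw [e, add_smul, mul_smul, mul_smul]

theorem Q0_mem {M : GrMod piece} {d e : ℤ} {x : M.carrier} (hx : x ∈ M.grading d)
    (he : e = d + 1) : Q0 • x ∈ M.grading e := by
  rw [he, add_comm]
  exact M.smul_mem 1 d Q0 x (gen_mem_wordPiece gen wt QGen.q0) hx

theorem Q1_mem {M : GrMod piece} {d e : ℤ} {x : M.carrier} (hx : x ∈ M.grading d)
    (he : e = d + 3) : Q1 • x ∈ M.grading e := by
  rw [he, add_comm]
  exact M.smul_mem 3 d Q1 x (gen_mem_wordPiece gen wt QGen.q1) hx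

/-- The trace of an additive map `H` of degree `-4` between graded modules, with respect to the
dual bases `1, Q₀, Q₁, Q₀ Q₁` and `Q₀ Q₁, Q₁, Q₀, 1` of the Frobenius algebra `ℰ(1)`. -/
noncomputable def trace {M P : GrMod piece} (H : M.carrier →+ P.carrier)
    (hH : ∀ d, ∀ x ∈ M.grading d, H x ∈ P.grading (d - 4)) : M ⟶ P where
  toLin := linOfCommutes
    { toFun := fun x => H (Q0 • Q1 • x) + Q0 • H (Q1 • x) + Q1 • H (Q0 • x) + Q0 • Q1 • H x
      map_zero' := by simp
      map_add' := fun x y => by simp only [smul_add, map_add]; abel }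
    (fun x => by
      simp only [AddMonoidHom.coe_mk, ZeroHom.coe_mk, smul_add, Q0_Q0_smul, Q1_Q0_smul,
        smul_zero, map_zero, add_zero, zero_add])
    (fun x => by
      simp only [AddMonoidHom.coe_mk, ZeroHom.coe_mk, smul_add, Q1_Q1_smul, Q1_Q0_smul,
        smul_zero, map_zero, add_zero, zero_add])
  map_mem := fun d x hx => by
    refine add_mem (add_mem (add_mem ?_ ?_) ?_) ?_
    · have := hH _ _ (Q0_mem (Q1_mem hx rfl) rfl)
      rwa [show d + 3 + 1 - 4 = d by ring] at this
    · exact Q0_mem (hH _ _ (Q1_mem hx rfl)) (by ring)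
    · exact Q1_mem (hH _ _ (Q0_mem hx rfl)) (by ring)
    · exact Q0_mem (Q1_mem (hH _ _ hx) rfl) (by ring)

theorem trace_apply {M P : GrMod piece} (H : M.carrier →+ P.carrier)
    (hH : ∀ d, ∀ x ∈ M.grading d, H x ∈ P.grading (d - 4)) (x : M.carrier) :
    (trace H hH).toLin x =
      H (Q0 • Q1 • x) + Q0 • H (Q1 • x) + Q1 • H (Q0 • x) + Q0 • Q1 • H x := rfl

/-- A trace factors through a free module. -/
theorem exists_factorization_trace {M : GrMod piece} (κ : Type) (deg : κ → ℤ)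
    (s : κ → M.carrier) (hs : ∀ k, s k ∈ M.grading (deg k)) (ℓ : M.carrier →+ (κ →₀ ZMod 2))
    (hℓ : ∀ d, ∀ x ∈ M.grading d, ∀ k, ℓ x k ≠ 0 → deg k + 4 = d) :
    ∃ (P : GrMod piece) (_ : P.IsFree) (u : M ⟶ P) (v : P ⟶ M) (h : M.carrier →+ M.carrier),
      (∀ x, h x = (ℓ x).sum fun k c => (algebraMap _ E1 c) • s k) ∧
      ∀ x, v.toLin (u.toLin x) =
        h (Q0 • Q1 • x) + Q0 • h (Q1 • x) + Q1 • h (Q0 • x) + Q0 • Q1 • h x := by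
  let P := GrMod.free piece_gradedMonoid piece_isInternal κ deg
  let ι : (κ →₀ ZMod 2) →+ P.carrier :=
    Finsupp.mapRange.addMonoidHom (algebraMap (ZMod 2) E1 : ZMod 2 →+ E1)
  let H : M.carrier →+ P.carrier := ι.comp ℓ
  have hH : ∀ d, ∀ x ∈ M.grading d, H x ∈ P.grading (d - 4) := by
    intro d x hx k
    change algebraMap (ZMod 2) E1 (ℓ x k) ∈ piece (d - 4 - deg k)
    by_cases hk : ℓ x k = 0
    · rw [hk, map_zero]; exact zero_mem _
    · rw [show d - 4 - deg k = 0 by have := hℓ d x hx k hk; omega]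
      rw [Algebra.algebraMap_eq_smul_one]
      exact Submodule.smul_mem _ _ (one_mem_wordPiece gen wt)
  let v : P ⟶ M := GrMod.freeLift piece_gradedMonoid piece_isInternal M s hs
  refine ⟨P, GrMod.free_isFree _ _ _ _, trace H hH, v,
    (v.toLin : P.carrier →+ M.carrier).comp H, fun x => ?_, fun x => ?_⟩
  · exact Finsupp.sum_mapRange_index (f := (algebraMap (ZMod 2) E1 : ZMod 2 →+ E1))
      (hf := map_zero _) (h := fun k a => a • s k) fun k => zero_smul _ _
  · have hv : ∀ (a : E1) (p : P.carrier), v.toLin (a • p) = a • v.toLin p := v.toLin.map_smul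
    rw [trace_apply, map_add, map_add, map_add, hv, hv, hv, hv]
    rfl

end E1

/-! ### The module `N` and frames -/

namespace moduleN

/-- The coordinates with respect to the basis `n₋₁, n₀, n₁, n₂` of `N`. -/
def coord (k : Fin 4) : moduleN.carrier →+ ZMod 2 := Pi.evalAddMonoidHom (fun _ : Fin 4 => ZMod 2) k

/-- The basis `n₋₁, n₀, n₁, n₂` of `N`. -/
def basis (k : Fin 4) : moduleN.carrier := (Pi.single k 1 : Fin 4 → ZMod 2)

theorem coord_ext {x y : moduleN.carrier} (h : ∀ k, coord k x = coord k y) : x = y := funext h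

theorem coord_basis (k l : Fin 4) : coord k (basis l) = if k = l then 1 else 0 :=
  Pi.single_apply l (1 : ZMod 2) k

theorem basis_mem (k : Fin 4) : basis k ∈ moduleN.grading (deg k) :=
  coordGrading_single_mem deg k 1

theorem coord_eq_zero {d : ℤ} {x : moduleN.carrier} (hx : x ∈ moduleN.grading d) {k : Fin 4}
    (hk : deg k ≠ d) : coord k x = 0 := hx k hk

theorem coord_Q0_smul (x : moduleN.carrier) (k : Fin 4) :
    coord k (E1.Q0 • x) = ![0, coord 0 x, 0, coord 2 x] k := by
  have h : moduleN.action (E1.gen QGen.q0) = Matrix.toLinAlgEquiv' moduleN.matQ0 :=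
    congrArg Matrix.toLinAlgEquiv' (E1.lift_Q0 _ _ _ _ _)
  change (moduleN.action (E1.gen QGen.q0)) x k = _
  rw [h]
  change (moduleN.matQ0.mulVec (show Fin 4 → ZMod 2 from x)) k = _
  rw [Matrix.mulVec, dotProduct, Fin.sum_univ_four]
  fin_cases k <;> simp [moduleN.matQ0] <;> rfl

theorem coord_Q1_smul (x : moduleN.carrier) (k : Fin 4) :
    coord k (E1.Q1 • x) = ![0, 0, 0, coord 0 x] k := by
  have h : moduleN.action (E1.gen QGen.q1) = Matrix.toLinAlgEquiv' moduleN.matQ1 :=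
    congrArg Matrix.toLinAlgEquiv' (E1.lift_Q1 _ _ _ _ _)
  change (moduleN.action (E1.gen QGen.q1)) x k = _
  rw [h]
  change (moduleN.matQ1.mulVec (show Fin 4 → ZMod 2 from x)) k = _
  rw [Matrix.mulVec, dotProduct, Fin.sum_univ_four]
  fin_cases k <;> simp [moduleN.matQ1]; rfl

theorem Q0_basis_zero : E1.Q0 • basis 0 = basis 1 :=
  coord_ext fun k => by rw [coord_Q0_smul]; fin_cases k <;> simp [coord_basis]

theorem Q0_basis_two : E1.Q0 • basis 2 = basis 3 :=
  coord_ext fun k => by rw [coord_Q0_smul]; fin_cases k <;> simp [coord_basis]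

theorem Q1_basis_zero : E1.Q1 • basis 0 = basis 3 :=
  coord_ext fun k => by rw [coord_Q1_smul]; fin_cases k <;> simp [coord_basis]

theorem Q1_basis_two : E1.Q1 • basis 2 = 0 :=
  coord_ext fun k => by rw [coord_Q1_smul]; fin_cases k <;> simp [coord_basis]

theorem Q0_Q1_smul (x : moduleN.carrier) : E1.Q0 • E1.Q1 • x = 0 :=
  coord_ext fun k => by rw [coord_Q0_smul]; fin_cases k <;> simp [coord_Q1_smul]

theorem eq_zero_or_eq_basis {d : ℤ} {x : moduleN.carrier} (hx : x ∈ moduleN.grading d) :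
    x = 0 ∨ ∃ k, deg k = d ∧ x = basis k := by
  have hinj : ∀ k l, deg k = deg l → k = l := by decide
  by_cases h : ∃ k, coord k x ≠ 0
  · obtain ⟨k, hk⟩ := h
    have hd : deg k = d := by
      by_contra h
      exact hk (coord_eq_zero hx h)
    refine Or.inr ⟨k, hd, coord_ext fun l => ?_⟩
    rw [coord_basis]
    split_ifs with hl
    · subst hl
      exact (by decide : ∀ c : ZMod 2, c ≠ 0 → c = 1) _ hk
    · exact coord_eq_zero hx fun h => hl (hinj _ _ (h.trans hd.symm))
  · push Not at h
    exact Or.inl (coord_ext fun k => by rw [h k, map_zero])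

end moduleN

/-- A frame of a graded group with two operations `Q₀` and `Q₁` is a pair of elements `n`, `m` that
generate a copy of `N`, such that this copy accounts for all elements killed by `Q₀ Q₁` up to
decomposables, and is independent of the decomposables and of the multiples of `Q₀ Q₁`. -/
structure Frame {X : Type} [AddCommGroup X] (G : ℤ → AddSubgroup X) (Q₀ Q₁ : X → X) (n m : X) :
    Prop where
  n_mem : n ∈ G (-1)
  m_mem : m ∈ G 1
  Q1_n : Q₁ n = Q₀ m
  Q1_m : Q₁ m = 0
  span : ∀ d, ∀ z ∈ G d, Q₀ (Q₁ z) = 0 →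
    ∃ p ∈ G (d - 1), ∃ q ∈ G (d - 3), z = Q₀ p + Q₁ q ∨
      (d = -1 ∧ z = n + (Q₀ p + Q₁ q)) ∨ (d = 1 ∧ z = m + (Q₀ p + Q₁ q))
  n_ne : ∀ p q, n ≠ Q₀ p + Q₁ q
  m_ne : ∀ p q, m ≠ Q₀ p + Q₁ q
  Q0_n_ne : ∀ z, Q₀ n ≠ Q₀ (Q₁ z)
  Q0_m_ne : ∀ z, Q₀ m ≠ Q₀ (Q₁ z)

namespace E1

/-- A module stably isomorphic to `N` has a frame: the images of `n₋₁` and `n₁`. -/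
theorem exists_frame (X : GrMod piece) (e : StCat.of X ≅ StCat.of moduleN) :
    ∃ n m, Frame X.grading (fun x => Q0 • x) (fun x => Q1 • x) n m := by
  obtain ⟨f, g, ⟨P, _, _, _, u, v, h⟩, ⟨P', _, _, _, u', v', h'⟩⟩ := GrMod.exists_of_stable_iso e
  -- on `N` the composite agrees with the identity modulo decomposables
  have hN : ∀ x, ∃ y z, f.toLin (g.toLin x) = x + (Q0 • y + Q1 • z) := by
    intro x
    have hx := h' x
    rw [GrMod.comp_toLin, GrMod.id_toLin] at hx
    obtain ⟨y, z, hyz⟩ := exists_of_Q0_Q1_smul_eq_zero (p := u' x) (by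
      rw [← map_smul, ← map_smul, moduleN.Q0_Q1_smul, map_zero])
    exact ⟨v' y, v' z, by
      rw [← map_smul, ← map_smul, ← map_add, ← hyz, ← hx, add_sub_cancel]⟩
  have hfg0 : moduleN.coord 0 (f.toLin (g.toLin (moduleN.basis 0))) = 1 := by
    obtain ⟨y, z, e⟩ := hN (moduleN.basis 0)
    rw [e, map_add, map_add, moduleN.coord_Q0_smul, moduleN.coord_Q1_smul, moduleN.coord_basis]
    simp
  have hfg2 : moduleN.coord 2 (f.toLin (g.toLin (moduleN.basis 2))) = 1 := by
    obtain ⟨y, z, e⟩ := hN (moduleN.basis 2)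
    rw [e, map_add, map_add, moduleN.coord_Q0_smul, moduleN.coord_Q1_smul, moduleN.coord_basis]
    simp
  -- the four inequalities are detected by the coordinates of the images in `N`
  refine ⟨g.toLin (moduleN.basis 0), g.toLin (moduleN.basis 2),
    g.map_mem _ _ (moduleN.basis_mem 0), g.map_mem _ _ (moduleN.basis_mem 2), ?_, ?_, ?_, ?_, ?_,
    ?_, ?_⟩
  · rw [← map_smul, ← map_smul, moduleN.Q1_basis_zero, moduleN.Q0_basis_two]
  · rw [← map_smul, moduleN.Q1_basis_two, map_zero]
  · intro d z hz hTz
    have hz' := h z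
    rw [GrMod.comp_toLin, GrMod.id_toLin] at hz'
    obtain ⟨p, q, hpq⟩ := exists_of_Q0_Q1_smul_eq_zero (p := u z) (by
      rw [← map_smul, ← map_smul]
      exact (congrArg u hTz).trans (map_zero u))
    have hzz : z = g.toLin (f.toLin z) + (Q0 • v p + Q1 • v q) := by
      rw [← map_smul, ← map_smul, ← map_add, ← hpq, ← hz', sub_eq_add_of_algebra E1, ← add_assoc,
        add_self_of_algebra E1, zero_add]
    -- the components of the degrees that matter
    have hom : ∀ y p q : X.carrier, y ∈ X.grading d → z = y + (Q0 • p + Q1 • q) →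
        ∃ p ∈ X.grading (d - 1), ∃ q ∈ X.grading (d - 3), z = y + (Q0 • p + Q1 • q) := by
      intro y p q hy e
      refine ⟨X.proj (d - 1) p, X.proj_mem _ _, X.proj (d - 3) q, X.proj_mem _ _, ?_⟩
      have h0 := X.proj_smul (gen_mem_wordPiece gen wt QGen.q0) (d - 1) p
      have h1 := X.proj_smul (gen_mem_wordPiece gen wt QGen.q1) (d - 3) q
      rw [show wt QGen.q0 + (d - 1) = d from add_sub_cancel 1 d] at h0
      rw [show wt QGen.q1 + (d - 3) = d from add_sub_cancel 3 d] at h1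
      have := congrArg (X.proj d) e
      rw [map_add, map_add, X.proj_same hz, X.proj_same hy] at this
      exact this.trans (congrArg (y + ·) (congrArg₂ (· + ·) h0 h1))
    have hom0 : ∀ p q : X.carrier, z = Q0 • p + Q1 • q →
        ∃ p ∈ X.grading (d - 1), ∃ q ∈ X.grading (d - 3), z = Q0 • p + Q1 • q ∨
        (d = -1 ∧ z = g.toLin (moduleN.basis 0) + (Q0 • p + Q1 • q)) ∨
        (d = 1 ∧ z = g.toLin (moduleN.basis 2) + (Q0 • p + Q1 • q)) := by
      intro p q e
      obtain ⟨p, hp, q, hq, e⟩ := hom 0 p q (zero_mem _) (by rw [zero_add, e])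
      exact ⟨p, hp, q, hq, Or.inl (by rw [e, zero_add])⟩
    rcases moduleN.eq_zero_or_eq_basis (f.map_mem d z hz) with h0 | ⟨k, rfl, hk⟩
    · exact hom0 (v p) (v q) (by rw [hzz, h0, map_zero, zero_add])
    · rw [hk] at hzz
      have hk := g.map_mem _ _ (moduleN.basis_mem k)
      fin_cases k
      · obtain ⟨p, hp, q, hq, e⟩ := hom _ _ _ hk hzz
        exact ⟨p, hp, q, hq, Or.inr (Or.inl ⟨rfl, e⟩)⟩
      · refine hom0 (g.toLin (moduleN.basis 0) + v p) (v q) (hzz.trans ?_)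
        rw [smul_add, ← map_smul g.toLin Q0 (moduleN.basis 0), moduleN.Q0_basis_zero, add_assoc]
        rfl
      · obtain ⟨p, hp, q, hq, e⟩ := hom _ _ _ hk hzz
        exact ⟨p, hp, q, hq, Or.inr (Or.inr ⟨rfl, e⟩)⟩
      · refine hom0 (g.toLin (moduleN.basis 2) + v p) (v q) (hzz.trans ?_)
        rw [smul_add, ← map_smul g.toLin Q0 (moduleN.basis 2), moduleN.Q0_basis_two, add_assoc]
        rfl
  · intro p q hpq
    have := congrArg (fun x => moduleN.coord 0 (f.toLin x)) hpq
    simp only [hfg0, map_add, map_smul, moduleN.coord_Q0_smul, moduleN.coord_Q1_smul] at this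
    simp at this
  · intro p q hpq
    have := congrArg (fun x => moduleN.coord 2 (f.toLin x)) hpq
    simp only [hfg2, map_add, map_smul, moduleN.coord_Q0_smul, moduleN.coord_Q1_smul] at this
    simp at this
  · intro z hz
    have := congrArg (fun x => moduleN.coord 1 (f.toLin x)) hz
    simp only [map_smul, moduleN.Q0_Q1_smul, moduleN.coord_Q0_smul, map_zero] at this
    simp [hfg0] at this
  · intro z hz
    have := congrArg (fun x => moduleN.coord 3 (f.toLin x)) hz
    simp only [map_smul, moduleN.Q0_Q1_smul, moduleN.coord_Q0_smul, map_zero] at this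
    simp [hfg2] at this

end E1

theorem underlyingE1_Q0_smul (M : GrMod A1.piece) :
    (fun x : (underlyingE1 M).carrier => E1.Q0 • x) = fun x : M.carrier => A1.Q0 • x := by
  rw [← E1.toA1_Q0]
  rfl

theorem underlyingE1_Q1_smul (M : GrMod A1.piece) :
    (fun x : (underlyingE1 M).carrier => E1.Q1 • x) = fun x : M.carrier => A1.Q1 • x := by
  rw [← E1.toA1_Q1]
  rfl

theorem A1.exists_frame (M : GrMod A1.piece)
    (e : StCat.of (underlyingE1 M) ≅ StCat.of moduleN) :
    ∃ n m, Frame M.grading (fun x => A1.Q0 • x) (fun x => A1.Q1 • x) n m := by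
  obtain ⟨n, m, h⟩ := E1.exists_frame _ e
  rw [underlyingE1_Q0_smul, underlyingE1_Q1_smul] at h
  exact ⟨n, m, h⟩

/-! ### Classification of the reduced lifts -/

namespace A1

section Module

variable {X : Type} [AddCommGroup X] [Module A1 X]

theorem Q0_Q0_smul (x : X) : Q0 • Q0 • x = 0 := Sq1_Sq1_smul x

theorem Q1_Q1_smul (x : X) : Q1 • Q1 • x = 0 := by rw [← mul_smul, Q1_mul_Q1, zero_smul]

theorem Q1_Q0_smul (x : X) : Q1 • Q0 • x = Q0 • Q1 • x := by
  rw [← mul_smul, ← Q0_mul_Q1, mul_smul]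

theorem Sq2_Sq2_smul_eq (x : X) : Sq2 • Sq2 • x = Q0 • Q1 • x := by
  rw [Q1_smul, smul_add, Q0_smul, Q0_smul, Sq1_Sq1_smul, zero_add, Sq2_Sq2_smul]

theorem Sq2_Q0_smul (x : X) : Sq2 • Q0 • x = Q0 • Sq2 • x + Q1 • x := by
  rw [Q1_smul, Q0_smul, Q0_smul, ← add_assoc, add_self_smul (Sq1 • Sq2 • x), zero_add]

theorem Sq2_Q1_smul (x : X) : Sq2 • Q1 • x = Q1 • Sq2 • x := by
  simp only [Q1_smul, smul_add, Sq2_Sq2_smul, Sq1_Sq1_smul, smul_zero, add_zero, zero_add]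

theorem eq_of_add_eq_zero {x y : X} (h : x + y = 0) : x = y := eq_of_add_eq_zero_of_algebra A1 h

theorem two_zsmul_eq_zero (x : X) : (2 : ℤ) • x = 0 := by rw [two_zsmul, add_self_smul]

end Module

theorem Q0_mem {M : GrMod piece} {d e : ℤ} {x : M.carrier} (hx : x ∈ M.grading d)
    (he : e = d + 1) : Q0 • x ∈ M.grading e := Sq1_mem hx he

theorem Q1_mem {M : GrMod piece} {d e : ℤ} {x : M.carrier} (hx : x ∈ M.grading d)
    (he : e = d + 3) : Q1 • x ∈ M.grading e := by
  rw [Q1_smul]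
  exact add_mem (Sq1_mem (Sq2_mem hx rfl) (by rw [he]; ring))
    (Sq2_mem (Sq1_mem hx rfl) (by rw [he]; ring))

end A1

open A1

/-- A frame of a graded `𝒜(1)`-module, with respect to the Milnor operations. -/
abbrev A1.Frame (M : GrMod piece) (n m : M.carrier) : Prop :=
  _root_.Frame M.grading (fun x => Q0 • x) (fun x => Q1 • x) n m

namespace A1.Frame

variable {M : GrMod piece} {n m : M.carrier}

theorem top_n (F : A1.Frame M n m) : Q0 • Q1 • n = 0 := by
  rw [show Q1 • n = Q0 • m from F.Q1_n, Q0_Q0_smul]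

/-- The two members of a frame may be changed by decomposables. -/
theorem change (F : A1.Frame M n m) {p q p' q' n' m' : M.carrier} (hp : p ∈ M.grading (-2))
    (hq : q ∈ M.grading (-4)) (hp' : p' ∈ M.grading 0) (hq' : q' ∈ M.grading (-2))
    (hn : n' = n + (Q0 • p + Q1 • q)) (hm : m' = m + (Q0 • p' + Q1 • q'))
    (h : Q1 • n' = Q0 • m') (h' : Q1 • m' = 0) : A1.Frame M n' m' where
  n_mem := by
    rw [hn]
    exact add_mem F.n_mem (add_mem (Q0_mem hp (by norm_num)) (Q1_mem hq (by norm_num)))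
  m_mem := by
    rw [hm]
    exact add_mem F.m_mem (add_mem (Q0_mem hp' (by norm_num)) (Q1_mem hq' (by norm_num)))
  Q1_n := h
  Q1_m := h'
  span d z hz hTz := by
    obtain ⟨s, hs, t, ht, e | ⟨rfl, e⟩ | ⟨rfl, e⟩⟩ := F.span d z hz hTz
    · exact ⟨s, hs, t, ht, Or.inl e⟩
    · refine ⟨s + p, add_mem hs hp, t + q, add_mem ht hq, Or.inr (Or.inl ⟨rfl, ?_⟩)⟩
      rw [hn, e]
      apply eq_of_add_eq_zero
      simp only [smul_add]
      abel_nf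
      simp only [two_zsmul_eq_zero, add_zero]
    · refine ⟨s + p', add_mem hs hp', t + q', add_mem ht hq', Or.inr (Or.inr ⟨rfl, ?_⟩)⟩
      rw [hm, e]
      apply eq_of_add_eq_zero
      simp only [smul_add]
      abel_nf
      simp only [two_zsmul_eq_zero, add_zero]
  n_ne s t e := F.n_ne (s + p) (t + q) (by
    rw [hn] at e
    simp only [smul_add]
    rw [add_add_add_comm, ← e, add_assoc, add_self_smul, add_zero])
  m_ne s t e := F.m_ne (s + p') (t + q') (by
    rw [hm] at e
    simp only [smul_add]
    rw [add_add_add_comm, ← e, add_assoc, add_self_smul, add_zero])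
  Q0_n_ne z e := F.Q0_n_ne (z + q) (by
    simp only [hn, smul_add, Q0_Q0_smul, zero_add] at e ⊢
    rw [← e, add_assoc, add_self_smul, add_zero])
  Q0_m_ne z e := F.Q0_m_ne (z + q') (by
    simp only [hm, smul_add, Q0_Q0_smul, zero_add] at e ⊢
    rw [← e, add_assoc, add_self_smul, add_zero])

/-- `Sq²` of a homogeneous element of a reduced module is a member of the frame up to
decomposables. -/
theorem exists_Sq2_smul (F : A1.Frame M n m) (hM : ∀ x : M.carrier, Sq2 • Sq2 • Sq2 • x = 0)
    {d : ℤ} {w : M.carrier} (hw : w ∈ M.grading d) :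
    ∃ p ∈ M.grading (d + 1), ∃ q ∈ M.grading (d - 1), Sq2 • w = Q0 • p + Q1 • q ∨
      (d = -3 ∧ Sq2 • w = n + (Q0 • p + Q1 • q)) ∨ (d = -1 ∧ Sq2 • w = m + (Q0 • p + Q1 • q)) := by
  obtain ⟨p, hp, q, hq, h⟩ := F.span (d + 2) (Sq2 • w) (Sq2_mem hw rfl) (by
    rw [← Sq2_Sq2_smul_eq]; exact hM w)
  rw [show d + 2 - 1 = d + 1 by ring] at hp
  rw [show d + 2 - 3 = d - 1 by ring] at hq
  exact ⟨p, hp, q, hq, h.imp id (Or.imp (fun h => ⟨by omega, h.2⟩) (fun h => ⟨by omega, h.2⟩))⟩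

/-- If `Sq² w` is decomposable although `Q₀ Q₁ w ≠ 0`, then `w` can be changed, keeping `Q₀ Q₁ w`,
in such a way that `Sq² w` is `Q₀ n` or `Q₀ m`. -/
theorem exists_of_Sq2_smul_decomposable (F : A1.Frame M n m)
    (hM : ∀ x : M.carrier, Sq2 • Sq2 • Sq2 • x = 0) {d : ℤ} {w p q : M.carrier}
    (hw : w ∈ M.grading d) (hTw : Q0 • Q1 • w ≠ 0) (hp : p ∈ M.grading (d + 1))
    (hq : q ∈ M.grading (d - 1)) (h : Sq2 • w = Q0 • p + Q1 • q) :
    ∃ w' ∈ M.grading d, Q0 • Q1 • w' = Q0 • Q1 • w ∧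
      ((d = -2 ∧ Sq2 • w' = Q0 • n) ∨ (d = 0 ∧ Sq2 • w' = Q0 • m)) := by
  have hM' : ∀ x : M.carrier, Q0 • Q1 • Sq2 • x = 0 := fun x => by
    rw [← Sq2_Sq2_smul_eq, hM]
  -- first remove the multiple of `Q₁` by passing to `w + Q₀ q`
  have h1 : Sq2 • (w + Q0 • q) = Q0 • (p + Sq2 • q) := by
    apply eq_of_add_eq_zero
    simp only [smul_add, h, Sq2_Q0_smul]
    abel_nf
    simp only [two_zsmul_eq_zero, add_zero]
  have hTw1 : Q0 • Q1 • (w + Q0 • q) = Q0 • Q1 • w := by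
    rw [smul_add, smul_add, Q1_Q0_smul, Q0_Q0_smul, add_zero]
  have hTp : Q0 • Q1 • (p + Sq2 • q) = 0 := by
    have h2 : Q0 • Q1 • w = Sq2 • Q0 • (p + Sq2 • q) := by
      rw [← h1, Sq2_Sq2_smul_eq, hTw1]
    have h3 := congrArg (fun x => Q0 • x) h2
    simpa only [Sq2_Q0_smul, smul_add, Q0_Q0_smul, zero_add, add_zero, eq_comm] using h3
  obtain ⟨s, hs, r, hr, e⟩ := F.span (d + 1) (p + Sq2 • q)
    (add_mem hp (Sq2_mem hq (by ring))) hTp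
  have hr' : Sq2 • r ∈ M.grading d := Sq2_mem hr (by ring)
  refine ⟨w + Q0 • q + Sq2 • r, add_mem (add_mem hw (Q0_mem hq (by ring))) hr', ?_, ?_⟩
  · rw [smul_add, smul_add, hTw1, hM', add_zero]
  -- then remove `Q₀ Q₁ r` by passing to `w + Q₀ q + Sq² r`
  have h2 : Sq2 • (w + Q0 • q + Sq2 • r) = Q0 • (p + Sq2 • q) + Q0 • Q1 • r := by
    rw [smul_add, h1, Sq2_Sq2_smul_eq]
  rcases e with e | ⟨hd, e⟩ | ⟨hd, e⟩
  · exfalso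
    have h3 : Sq2 • (w + Q0 • q + Sq2 • r) = 0 := by
      rw [h2, e, smul_add, Q0_Q0_smul, zero_add, add_self_smul]
    have h4 := Sq2_Sq2_smul_eq (w + Q0 • q + Sq2 • r)
    rw [h3, smul_zero, smul_add, smul_add, hM', add_zero, hTw1] at h4
    exact hTw h4.symm
  · refine Or.inl ⟨by omega, ?_⟩
    rw [h2, e, smul_add, smul_add, Q0_Q0_smul, zero_add, add_assoc, add_self_smul, add_zero]
  · refine Or.inr ⟨by omega, ?_⟩
    rw [h2, e, smul_add, smul_add, Q0_Q0_smul, zero_add, add_assoc, add_self_smul, add_zero]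

/-- The possible degrees and shapes of the elements `w` with `Q₀ Q₁ w ≠ 0`. -/
theorem cases_of_top_ne_zero (F : A1.Frame M n m)
    (hM : ∀ x : M.carrier, Sq2 • Sq2 • Sq2 • x = 0) {d : ℤ} {w : M.carrier}
    (hw : w ∈ M.grading d) (hTw : Q0 • Q1 • w ≠ 0) :
    ∃ w' ∈ M.grading d, Q0 • Q1 • w' = Q0 • Q1 • w ∧
      ((d = -3 ∧ ∃ p ∈ M.grading (-2), ∃ q ∈ M.grading (-4), Sq2 • w' = n + (Q0 • p + Q1 • q)) ∨
        (d = -2 ∧ Sq2 • w' = Q0 • n) ∨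
        (d = -1 ∧ ∃ p ∈ M.grading 0, ∃ q ∈ M.grading (-2), Sq2 • w' = m + (Q0 • p + Q1 • q)) ∨
        (d = 0 ∧ Sq2 • w' = Q0 • m)) := by
  obtain ⟨p, hp, q, hq, h | ⟨rfl, h⟩ | ⟨rfl, h⟩⟩ := F.exists_Sq2_smul hM hw
  · obtain ⟨w', hw', e, h | h⟩ := F.exists_of_Sq2_smul_decomposable hM hw hTw hp hq h
    · exact ⟨w', hw', e, Or.inr (Or.inl h)⟩
    · exact ⟨w', hw', e, Or.inr (Or.inr (Or.inr h))⟩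
  · exact ⟨w, hw, rfl, Or.inl ⟨rfl, p, hp, q, hq, h⟩⟩
  · exact ⟨w, hw, rfl, Or.inr (Or.inr (Or.inl ⟨rfl, p, hp, q, hq, h⟩))⟩

/-- In a reduced module, `Q₀ Q₁` has rank at most one in each degree: if it took distinct nonzero
values at `w` and `v`, then `w` and `v` could be chosen such that `Sq² (w + v)` is zero or
decomposable, which is impossible in the degree in question. -/
theorem top_smul_eq (F : A1.Frame M n m) (hM : ∀ x : M.carrier, Sq2 • Sq2 • Sq2 • x = 0) {d : ℤ}
    {w v : M.carrier} (hw : w ∈ M.grading d) (hv : v ∈ M.grading d) (hTw : Q0 • Q1 • w ≠ 0)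
    (hTv : Q0 • Q1 • v ≠ 0) : Q0 • Q1 • w = Q0 • Q1 • v := by
  by_contra hne
  obtain ⟨w', hw', ew, h⟩ := F.cases_of_top_ne_zero hM hw hTw
  obtain ⟨v', hv', ev, h'⟩ := F.cases_of_top_ne_zero hM hv hTv
  have hne' : Q0 • Q1 • (w' + v') ≠ 0 := by
    rw [smul_add, smul_add, ew, ev]
    exact fun h => hne (eq_of_add_eq_zero h)
  have hz : ∀ z : M.carrier, Sq2 • w' = z → Sq2 • v' = z → False := by
    intro z h1 h2
    apply hne'
    rw [← Sq2_Sq2_smul_eq, smul_add, h1, h2, add_self_smul, smul_zero]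
  have hdec : ∀ p ∈ M.grading (d + 1), ∀ q ∈ M.grading (d - 1),
      Sq2 • (w' + v') = Q0 • p + Q1 • q → d = -2 ∨ d = 0 := by
    intro p hp q hq h
    obtain ⟨_, _, _, h | h⟩ :=
      F.exists_of_Sq2_smul_decomposable hM (add_mem hw' hv') hne' hp hq h
    · exact Or.inl h.1
    · exact Or.inr h.1
  rcases h with ⟨rfl, p, hp, q, hq, h⟩ | ⟨rfl, h⟩ | ⟨rfl, p, hp, q, hq, h⟩ | ⟨rfl, h⟩ <;>
    rcases h' with ⟨h0, p', hp', q', hq', h'⟩ | ⟨h0, h'⟩ | ⟨h0, p', hp', q', hq', h'⟩ | ⟨h0, h'⟩ <;>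
    norm_num at h0
  · have := hdec (p + p') (add_mem hp hp') (q + q') (add_mem hq hq') (by
      apply eq_of_add_eq_zero
      simp only [smul_add, h, h']
      abel_nf
      simp only [two_zsmul_eq_zero, add_zero])
    norm_num at this
  · exact hz _ h h'
  · have := hdec (p + p') (add_mem hp hp') (q + q') (add_mem hq hq') (by
      apply eq_of_add_eq_zero
      simp only [smul_add, h, h']
      abel_nf
      simp only [two_zsmul_eq_zero, add_zero])
    norm_num at this
  · exact hz _ h h'

end A1.Frame

/-- The normal forms of the reduced lifts of `N`. The parameter `c` is the coefficient of `m` in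
`Sq² n`; the parameters `px` and `py` tell whether the generators `x` and `y` of free summands over
`ℰ(1)` are present. An absent generator is zero. -/
structure A1.NormalForm (M : GrMod piece) (c px py : Bool) (n m x y : M.carrier) : Prop where
  frame : A1.Frame M n m
  x_mem : x ∈ M.grading (if c then -2 else -3)
  y_mem : y ∈ M.grading (if c then 0 else -1)
  x_eq_zero : px = false → x = 0
  y_eq_zero : py = false → y = 0
  top_x : px = true → Q0 • Q1 • x ≠ 0
  top_y : py = true → Q0 • Q1 • y ≠ 0
  top : ∀ d, ∀ z ∈ M.grading d, Q0 • Q1 • z = 0 ∨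
    (d = (if c then -2 else -3) ∧ Q0 • Q1 • z = Q0 • Q1 • x) ∨
    (d = (if c then 0 else -1) ∧ Q0 • Q1 • z = Q0 • Q1 • y)
  Sq2_n : Sq2 • n = if c then m + Q1 • x + Q0 • y else Q0 • Q1 • x
  Sq2_m : Sq2 • m = if c then Q1 • y else Q0 • Q1 • y
  Sq2_x : px = true → Sq2 • x = if c then Q0 • n else n
  Sq2_y : py = true → Sq2 • y = if c then Q0 • m else m

namespace A1.Frame

variable {M : GrMod piece} {n m : M.carrier}

/-- The multiples of `Q₀ Q₁` in a given degree form a space of dimension at most one; a generator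
with a prescribed property is chosen if there is one. -/
theorem exists_generator (F : A1.Frame M n m) (hM : ∀ x : M.carrier, Sq2 • Sq2 • Sq2 • x = 0)
    (d : ℤ) (C : M.carrier → Prop) (hC : ∀ w ∈ M.grading d, Q0 • Q1 • w ≠ 0 →
      ∃ w' ∈ M.grading d, Q0 • Q1 • w' = Q0 • Q1 • w ∧ C w') :
    ∃ (px : Bool) (x : M.carrier), x ∈ M.grading d ∧ (px = false → x = 0) ∧
      (px = true → Q0 • Q1 • x ≠ 0) ∧ (px = true → C x) ∧
      ∀ z ∈ M.grading d, Q0 • Q1 • z = 0 ∨ px = true ∧ Q0 • Q1 • z = Q0 • Q1 • x := by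
  by_cases h : ∃ w ∈ M.grading d, Q0 • Q1 • w ≠ 0
  · obtain ⟨w, hw, hTw⟩ := h
    obtain ⟨x, hx, e, hCx⟩ := hC w hw hTw
    rw [← e] at hTw
    refine ⟨true, x, hx, by simp, fun _ => hTw, fun _ => hCx, fun z hz => ?_⟩
    by_cases hTz : Q0 • Q1 • z = 0
    · exact Or.inl hTz
    · exact Or.inr ⟨rfl, F.top_smul_eq hM hz hx hTz hTw⟩
  · push Not at h
    exact ⟨false, 0, zero_mem _, fun _ => rfl, by simp, by simp, fun z hz => Or.inl (h z hz)⟩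

/-- The normal form in the case that `Sq² n` involves `m`. The element `x` is normalized by
`Sq² x = Q₀ n` and `y` by `Sq² y = Q₀ m`, and then `m` is replaced by `Sq² n + Q₁ x + Q₀ y`. -/
theorem exists_normalForm_true (F : A1.Frame M n m)
    (hM : ∀ x : M.carrier, Sq2 • Sq2 • Sq2 • x = 0) {p q : M.carrier} (hp : p ∈ M.grading 0)
    (hq : q ∈ M.grading (-2)) (h : Sq2 • n = m + (Q0 • p + Q1 • q)) :
    ∃ (px py : Bool) (n m x y : M.carrier), A1.NormalForm M true px py n m x y := by
  -- In degree `-3` the element `m` would be decomposable; in degree `-1` the element `w' + n`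
  -- would have decomposable `Sq²`.
  have hdeg : ∀ d, ∀ w ∈ M.grading d, Q0 • Q1 • w ≠ 0 → d = -2 ∨ d = 0 := by
    intro d w hw hTw
    obtain ⟨w', hw', e, h'⟩ := F.cases_of_top_ne_zero hM hw hTw
    rcases h' with ⟨rfl, p', hp', q', hq', h'⟩ | ⟨rfl, -⟩ | ⟨rfl, p', hp', q', hq', h'⟩ | ⟨rfl, -⟩
    · exfalso
      have h2 := Sq2_Sq2_smul_eq w'
      rw [h', smul_add, h] at h2
      refine F.m_ne (Q1 • w' + p + Sq2 • p') (q + p' + Sq2 • q') (eq_of_add_eq_zero ?_)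
      simp only [smul_add, ← h2, Sq2_Q0_smul, Sq2_Q1_smul]
      abel_nf
      simp only [two_zsmul_eq_zero, add_zero]
    · exact Or.inl rfl
    · exfalso
      obtain ⟨_, _, _, h | h⟩ := F.exists_of_Sq2_smul_decomposable hM (add_mem hw' F.n_mem)
        (by rw [smul_add, smul_add, F.top_n, add_zero, e]; exact hTw) (add_mem hp' hp)
        (add_mem hq' hq) (by
          apply eq_of_add_eq_zero
          simp only [smul_add, h, h']
          abel_nf
          simp only [two_zsmul_eq_zero, add_zero])
      · norm_num at h
      · norm_num at h
    · exact Or.inr rfl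
  obtain ⟨px, x, hx, hx0, hxT, hxb, hxtop⟩ := F.exists_generator hM (-2)
    (fun w => Sq2 • w = Q0 • n) (fun w hw hTw => by
      obtain ⟨w', hw', e, h'⟩ := F.cases_of_top_ne_zero hM hw hTw
      norm_num at h'
      exact ⟨w', hw', e, h'⟩)
  obtain ⟨py, y, hy, hy0, hyT, hyb, hytop⟩ := F.exists_generator hM 0
    (fun w => Sq2 • w = Q0 • m) (fun w hw hTw => by
      obtain ⟨w', hw', e, h'⟩ := F.cases_of_top_ne_zero hM hw hTw
      norm_num at h'
      exact ⟨w', hw', e, h'⟩)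
  have hnm : Q1 • n = Q0 • m := F.Q1_n
  have hm0 : Q1 • m = 0 := F.Q1_m
  -- the terms of `Sq² n` outside `m` are those of the normal form up to elements killed by `Q₀ Q₁`
  have hTq : Q0 • Q1 • q = Q0 • Q1 • x := by
    cases px with
    | false => simpa [hx0 rfl] using hxtop q hq
    | true =>
      rw [← Sq2_Sq2_smul_eq x, hxb rfl, Sq2_Q0_smul, h, hnm]
      simp only [smul_add, Q0_Q0_smul, zero_add]
      rw [add_comm, ← add_assoc, add_self_smul, zero_add]
  have hTp : Q0 • Q1 • p = Q0 • Q1 • y := by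
    cases py with
    | false => simpa [hy0 rfl] using hytop p hp
    | true =>
      rw [← Sq2_Sq2_smul_eq y, hyb rfl, ← hnm, Sq2_Q1_smul, h]
      simp only [smul_add, hm0, Q1_Q0_smul, Q1_Q1_smul, zero_add, add_zero]
  have hxQ : Q1 • Sq2 • x = 0 := by
    cases px with
    | false => simp [hx0 rfl]
    | true => rw [hxb rfl, Q1_Q0_smul, F.top_n]
  have hyQ : Q0 • Sq2 • y = 0 := by
    cases py with
    | false => simp [hy0 rfl]
    | true => rw [hyb rfl, Q0_Q0_smul]
  have hm' : Sq2 • n + Q1 • x + Q0 • y = m + (Q0 • (p + y) + Q1 • (q + x)) := by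
    rw [h, smul_add, smul_add]
    abel
  have hQm : Q0 • (Sq2 • n + Q1 • x + Q0 • y) = Q0 • m := by
    rw [h]
    simp only [smul_add, Q0_Q0_smul, zero_add, add_zero, hTq]
    rw [add_assoc, add_self_smul, add_zero]
  have F' : A1.Frame M n (Sq2 • n + Q1 • x + Q0 • y) := by
    refine F.change (zero_mem _) (zero_mem _) (add_mem hp hy) (add_mem hq hx) (by simp) hm'
      (by rw [hnm, hQm]) ?_
    rw [hm']
    simp only [smul_add, hm0, Q1_Q0_smul, Q1_Q1_smul, hTp, add_self_smul]
  refine ⟨px, py, n, _, x, y, F', hx, hy, hx0, hy0, hxT, hyT, fun d z hz => ?_, ?_, ?_, ?_, ?_⟩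
  · by_cases hTz : Q0 • Q1 • z = 0
    · exact Or.inl hTz
    · rcases hdeg d z hz hTz with rfl | rfl
      · exact (hxtop z hz).imp id fun h => Or.inl ⟨rfl, h.2⟩
      · exact (hytop z hz).imp id fun h => Or.inr ⟨rfl, h.2⟩
  · rw [if_pos rfl]
    apply eq_of_add_eq_zero
    abel_nf
    simp only [two_zsmul_eq_zero, add_zero]
  · rw [if_pos rfl]
    simp only [smul_add, Sq2_Sq2_smul_eq, F.top_n, Sq2_Q1_smul, Sq2_Q0_smul, hxQ, hyQ, zero_add]
  · exact hxb
  · intro hpy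
    rw [if_pos rfl, hQm]
    exact hyb hpy

/-- The normal form in the case that `Sq² n` is decomposable. If `x` is present, then `n` is
replaced by `Sq² x`, and if `y` is present, then `m` is replaced by `Sq² y`; otherwise `n` or `m` is
changed by a multiple of `Q₀` such that `Sq²` annihilates it. -/
theorem exists_normalForm_false (F : A1.Frame M n m)
    (hM : ∀ x : M.carrier, Sq2 • Sq2 • Sq2 • x = 0) {p q : M.carrier} (hp : p ∈ M.grading 0)
    (hq : q ∈ M.grading (-2)) (h : Sq2 • n = Q0 • p + Q1 • q) :
    ∃ (px py : Bool) (n m x y : M.carrier), A1.NormalForm M false px py n m x y := by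
  have hnm : Q1 • n = Q0 • m := F.Q1_n
  have hm0 : Q1 • m = 0 := F.Q1_m
  -- In degree `-2` the element `Q₀ m` would be a multiple of `Q₀ Q₁`; in degree `0` the element
  -- `Q₀ Q₁ w` would vanish.
  have hdeg : ∀ d, ∀ w ∈ M.grading d, Q0 • Q1 • w ≠ 0 → d = -3 ∨ d = -1 := by
    intro d w hw hTw
    obtain ⟨w', hw', e, h'⟩ := F.cases_of_top_ne_zero hM hw hTw
    rcases h' with ⟨rfl, -⟩ | ⟨rfl, h'⟩ | ⟨rfl, -⟩ | ⟨rfl, h'⟩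
    · exact Or.inl rfl
    · exfalso
      refine F.Q0_m_ne (w' + q) ?_
      rw [smul_add, smul_add, ← Sq2_Sq2_smul_eq w', h', Sq2_Q0_smul, h, hnm, smul_add, Q0_Q0_smul,
        zero_add, add_right_comm, add_self_smul, zero_add]
    · exact Or.inr rfl
    · exfalso
      apply hTw
      have h2 := Sq2_Sq2_smul_eq n
      rw [h, F.top_n] at h2
      have h3 := congrArg (fun z => Q0 • z) h2
      simp only [smul_add, Sq2_Q0_smul, Sq2_Q1_smul, Q0_Q0_smul, zero_add, smul_zero] at h3
      rw [← Sq2_Sq2_smul_eq (Sq2 • q), hM, add_zero] at h3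
      rw [← e, ← Sq2_Sq2_smul_eq w', h', ← hnm, Sq2_Q1_smul, h, smul_add, Q1_Q1_smul, Q1_Q0_smul,
        add_zero, h3]
  obtain ⟨px, x, hx, hx0, hxT, hxb, hxtop⟩ := F.exists_generator hM (-3)
    (fun w => ∃ p ∈ M.grading (-2), ∃ q ∈ M.grading (-4), Sq2 • w = n + (Q0 • p + Q1 • q))
    (fun w hw hTw => by
      obtain ⟨w', hw', e, h'⟩ := F.cases_of_top_ne_zero hM hw hTw
      norm_num at h'
      exact ⟨w', hw', e, h'⟩)
  obtain ⟨py, y, hy, hy0, hyT, hyb, hytop⟩ := F.exists_generator hM (-1)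
    (fun w => ∃ p ∈ M.grading 0, ∃ q ∈ M.grading (-2), Sq2 • w = m + (Q0 • p + Q1 • q))
    (fun w hw hTw => by
      obtain ⟨w', hw', e, h'⟩ := F.cases_of_top_ne_zero hM hw hTw
      norm_num at h'
      exact ⟨w', hw', e, h'⟩)
  have hT0 : ∀ d, d ≠ -3 → d ≠ -1 → ∀ w ∈ M.grading d, Q0 • Q1 • w = 0 := by
    intro d h1 h2 w hw
    by_contra hTw
    exact (hdeg d w hw hTw).elim h1 h2
  obtain ⟨n', p₀, hp₀, q₀, hq₀, hn', hbn', hxn'⟩ : ∃ n' : M.carrier, ∃ p₀ ∈ M.grading (-2),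
      ∃ q₀ ∈ M.grading (-4), n' = n + (Q0 • p₀ + Q1 • q₀) ∧ Sq2 • n' = Q0 • Q1 • x ∧
        (px = true → Sq2 • x = n') := by
    cases px with
    | true =>
      obtain ⟨p₀, hp₀, q₀, hq₀, e⟩ := hxb rfl
      exact ⟨Sq2 • x, p₀, hp₀, q₀, hq₀, e, Sq2_Sq2_smul_eq x, fun _ => rfl⟩
    | false =>
      obtain ⟨s, -, r, hr, e⟩ := F.span 0 (p + Sq2 • q) (add_mem hp (Sq2_mem hq (by norm_num)))
        (hT0 0 (by norm_num) (by norm_num) _ (add_mem hp (Sq2_mem hq (by norm_num))))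
      norm_num at e hr
      refine ⟨n + Q0 • q, q, hq, 0, zero_mem _, by simp, ?_, by simp⟩
      have hr0 : Q0 • Q1 • r = 0 := by simpa using hxtop r hr
      have h1 : Sq2 • (n + Q0 • q) = Q0 • (p + Sq2 • q) := by
        apply eq_of_add_eq_zero
        simp only [smul_add, h, Sq2_Q0_smul]
        abel_nf
        simp only [two_zsmul_eq_zero, add_zero]
      rw [h1, e, smul_add, Q0_Q0_smul, hr0, hx0 rfl, smul_zero, smul_zero, add_zero]
  obtain ⟨m', p₁, hp₁, q₁, hq₁, hm', hbm', hym'⟩ : ∃ m' : M.carrier, ∃ p₁ ∈ M.grading 0,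
      ∃ q₁ ∈ M.grading (-2), m' = m + (Q0 • p₁ + Q1 • q₁) ∧ Sq2 • m' = Q0 • Q1 • y ∧
        (py = true → Sq2 • y = m') := by
    cases py with
    | true =>
      obtain ⟨p₁, hp₁, q₁, hq₁, e⟩ := hyb rfl
      exact ⟨Sq2 • y, p₁, hp₁, q₁, hq₁, e, Sq2_Sq2_smul_eq y, fun _ => rfl⟩
    | false =>
      obtain ⟨s, hs, t, ht, e⟩ := F.exists_Sq2_smul hM F.m_mem
      norm_num at e hs ht
      have hst : s + Sq2 • t ∈ M.grading 2 := add_mem hs (Sq2_mem ht (by norm_num))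
      obtain ⟨u, -, r, hr, e'⟩ := F.span 2 (s + Sq2 • t) hst
        (hT0 2 (by norm_num) (by norm_num) _ hst)
      norm_num at e' hr
      refine ⟨m + Q0 • t, t, ht, 0, zero_mem _, by simp, ?_, by simp⟩
      have hr0 : Q0 • Q1 • r = 0 := by simpa using hytop r hr
      have h1 : Sq2 • (m + Q0 • t) = Q0 • (s + Sq2 • t) := by
        apply eq_of_add_eq_zero
        simp only [smul_add, e, Sq2_Q0_smul]
        abel_nf
        simp only [two_zsmul_eq_zero, add_zero]
      rw [h1, e', smul_add, Q0_Q0_smul, hr0, hy0 rfl, smul_zero, smul_zero, add_zero]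
  have hTneg2 := hT0 (-2) (by norm_num) (by norm_num)
  have F' : A1.Frame M n' m' := by
    refine F.change hp₀ hq₀ hp₁ hq₁ hn' hm' ?_ ?_
    · rw [hn', hm']
      simp only [smul_add, Q1_Q0_smul, Q1_Q1_smul, Q0_Q0_smul, hTneg2 _ hp₀, hTneg2 _ hq₁, add_zero,
        hnm]
    · rw [hm']
      simp only [smul_add, Q1_Q0_smul, Q1_Q1_smul, hT0 0 (by norm_num) (by norm_num) _ hp₁,
        add_zero, hm0]
  refine ⟨px, py, n', m', x, y, F', hx, hy, hx0, hy0, hxT, hyT, fun d z hz => ?_, hbn', hbm',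
    hxn', hym'⟩
  by_cases hTz : Q0 • Q1 • z = 0
  · exact Or.inl hTz
  · rcases hdeg d z hz hTz with rfl | rfl
    · exact (hxtop z hz).imp id fun h => Or.inl ⟨rfl, h.2⟩
    · exact (hytop z hz).imp id fun h => Or.inr ⟨rfl, h.2⟩

theorem exists_normalForm (F : A1.Frame M n m)
    (hM : ∀ x : M.carrier, Sq2 • Sq2 • Sq2 • x = 0) :
    ∃ (c px py : Bool) (n m x y : M.carrier), A1.NormalForm M c px py n m x y := by
  obtain ⟨p, hp, q, hq, h⟩ := F.exists_Sq2_smul hM F.n_mem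
  norm_num at h hp hq
  rcases h with h | h
  · exact ⟨false, F.exists_normalForm_false hM hp hq h⟩
  · exact ⟨true, F.exists_normalForm_true hM hp hq h⟩

end A1.Frame

/-! ### The eight models -/

namespace Model

/-- The indices of the basis `n, Q₀n, m, Q₀m, x, Q₀x, Q₁x, Q₀Q₁x, y, Q₀y, Q₁y, Q₀Q₁y` of a model,
where the part belonging to `x` or `y` may be absent. -/
def Idx (px py : Bool) : Type :=
  {i : Fin 12 // (4 ≤ i → i < 8 → px = true) ∧ (8 ≤ i → py = true)}

instance (px py : Bool) : DecidableEq (Idx px py) := inferInstanceAs (DecidableEq (Subtype _))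

instance (px py : Bool) : Fintype (Idx px py) := inferInstanceAs (Fintype (Subtype _))

/-- The degrees of the basis elements. The parameter `c`, which tells whether `Sq² n` involves `m`,
decides about the degrees of `x` and `y`. -/
def deg : Bool → Fin 12 → ℤ
  | true => ![-1, 0, 1, 2, -2, -1, 1, 2, 0, 1, 3, 4]
  | false => ![-1, 0, 1, 2, -3, -2, 0, 1, -1, 0, 2, 3]

/-- `imQ0 j` is the list of the basis elements whose sum is `Q₀` of the basis element `j`. -/
def imQ0 : Fin 12 → List (Fin 12) := ![[1], [], [3], [], [5], [], [7], [], [9], [], [11], []]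

/-- `imQ1 j` is the list of the basis elements whose sum is `Q₁` of the basis element `j`. -/
def imQ1 : Fin 12 → List (Fin 12) := ![[3], [], [], [], [6], [7], [], [], [10], [11], [], []]

/-- `imT j` is the list of the basis elements whose sum is `Q₀ Q₁` of the basis element `j`. -/
def imT : Fin 12 → List (Fin 12) := ![[], [], [], [], [7], [], [], [], [11], [], [], []]

/-- `imSq2 c j` is the list of the basis elements whose sum is `Sq²` of the basis element `j`; the
absent ones have to be discarded. -/
def imSq2 : Bool → Fin 12 → List (Fin 12)
  | true => ![[2, 6, 9], [7], [10], [11], [1], [6], [], [], [3], [10], [], []]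
  | false => ![[7], [3], [11], [], [0], [1, 6], [3], [], [2], [3, 10], [], []]

/-- The partial inverse of `Q₀ Q₁`, sending `Q₀ Q₁ x` to `x` and `Q₀ Q₁ y` to `y`. -/
def imH : Fin 12 → List (Fin 12) := ![[], [], [], [], [], [], [], [4], [], [], [], [8]]

/-- The matrix of a map given by lists of basis elements; absent basis elements are discarded. -/
def mat (px py : Bool) (f : Fin 12 → List (Fin 12)) : Matrix (Idx px py) (Idx px py) (ZMod 2) :=
  Matrix.of fun i j => if i.1 ∈ f j.1 then 1 else 0

/-- The matrix of the inclusion of `N`. -/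
def matIncl (px py : Bool) : Matrix (Idx px py) (Fin 4) (ZMod 2) :=
  Matrix.of fun i j => if i.1 = j.castLE (by decide) then 1 else 0

/-- The matrix of the projection to `N`. -/
def matProj (px py : Bool) : Matrix (Fin 4) (Idx px py) (ZMod 2) := (matIncl px py).transpose

theorem mat_Sq1_mul_Sq1 : ∀ px py, mat px py imQ0 * mat px py imQ0 = 0 := by decide +kernel

theorem mat_Sq2_mul_Sq2 : ∀ c px py, mat px py (imSq2 c) * mat px py (imSq2 c) =
    mat px py imQ0 * mat px py (imSq2 c) * mat px py imQ0 := by decide +kernel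

theorem mat_Q1 : ∀ c px py, mat px py imQ0 * mat px py (imSq2 c) +
    mat px py (imSq2 c) * mat px py imQ0 = mat px py imQ1 := by decide +kernel

theorem mat_Sq2_pow_three : ∀ c px py, mat px py (imSq2 c) * mat px py (imSq2 c) *
    mat px py (imSq2 c) = 0 := by decide +kernel

theorem mat_T : ∀ px py, mat px py imQ0 * mat px py imQ1 = mat px py imT := by decide +kernel

theorem matProj_mul_matIncl : ∀ px py, matProj px py * matIncl px py = 1 := by decide +kernel

theorem matProj_mul_Q0 : ∀ px py, matProj px py * mat px py imQ0 =
    moduleN.matQ0 * matProj px py := by decide +kernel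

theorem matProj_mul_Q1 : ∀ px py, matProj px py * mat px py imQ1 =
    moduleN.matQ1 * matProj px py := by decide +kernel

theorem Q0_mul_matIncl : ∀ px py, matIncl px py * moduleN.matQ0 =
    mat px py imQ0 * matIncl px py := by decide +kernel

theorem Q1_mul_matIncl : ∀ px py, matIncl px py * moduleN.matQ1 =
    mat px py imQ1 * matIncl px py := by decide +kernel

/-- The projection away from `N` is the trace of the partial inverse of `Q₀ Q₁`. -/
theorem mat_trace : ∀ px py, matIncl px py * matProj px py - 1 =
    mat px py imH * mat px py imT + mat px py imQ0 * (mat px py imH * mat px py imQ1) +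
      mat px py imQ1 * (mat px py imH * mat px py imQ0) + mat px py imT * mat px py imH := by
  decide +kernel

theorem mulVec_mulVec_eq {ι κ κ' μ : Type} [Fintype κ] [Fintype κ'] [Fintype μ]
    {A : Matrix ι κ (ZMod 2)} {B : Matrix κ μ (ZMod 2)} {C : Matrix ι κ' (ZMod 2)}
    {D : Matrix κ' μ (ZMod 2)} (h : A * B = C * D) (v : μ → ZMod 2) :
    A.mulVec (B.mulVec v) = C.mulVec (D.mulVec v) := by
  rw [Matrix.mulVec_mulVec, Matrix.mulVec_mulVec, h]

/-- The identity `mat_trace`, in the form of the trace over `ℰ(1)` of the partial inverse. -/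
theorem mulVec_trace (px py : Bool) (v : Idx px py → ZMod 2) :
    (matIncl px py).mulVec ((matProj px py).mulVec v) - v =
      (mat px py imH).mulVec ((mat px py imQ0).mulVec ((mat px py imQ1).mulVec v)) +
      (mat px py imQ0).mulVec ((mat px py imH).mulVec ((mat px py imQ1).mulVec v)) +
      (mat px py imQ1).mulVec ((mat px py imH).mulVec ((mat px py imQ0).mulVec v)) +
      (mat px py imQ0).mulVec ((mat px py imQ1).mulVec ((mat px py imH).mulVec v)) := by
  have h := congrArg (fun A => A.mulVec v) (mat_trace px py)
  simp only [Matrix.sub_mulVec, Matrix.add_mulVec, ← Matrix.mulVec_mulVec, Matrix.one_mulVec,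
    ← mat_T] at h
  exact h

theorem mulVec_mem {ι κ : Type} [Fintype κ] (A : Matrix ι κ (ZMod 2)) (deg : ι → ℤ)
    (deg' : κ → ℤ) (k : ℤ) (hA : ∀ i j, A i j ≠ 0 → deg i = k + deg' j) (d : ℤ)
    (v : κ → ZMod 2) (hv : v ∈ coordGrading deg' d) :
    A.mulVec v ∈ coordGrading deg (k + d) := by
  intro i hi
  refine Finset.sum_eq_zero fun j _ => ?_
  change A i j * v j = 0
  by_cases h : A i j = 0
  · rw [h, zero_mul]
  · rw [hv j fun hj => hi (by rw [hA i j h, hj]), mul_zero]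

theorem mat_deg (px py c : Bool) (f : Fin 12 → List (Fin 12)) (k : ℤ)
    (h : ∀ j, ∀ i ∈ f j, deg c i = k + deg c j) (i j : Idx px py)
    (hij : mat px py f i j ≠ 0) : deg c i.1 = k + deg c j.1 := by
  by_cases hi : i.1 ∈ f j.1
  · exact h j.1 i.1 hi
  · exact absurd (if_neg hi) hij

theorem deg_imQ0 : ∀ c, ∀ j, ∀ i ∈ imQ0 j, deg c i = 1 + deg c j := by decide

theorem deg_imSq2 : ∀ c, ∀ j, ∀ i ∈ imSq2 c j, deg c i = 2 + deg c j := by decide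

theorem deg_imH : ∀ c, ∀ j, ∀ i ∈ imH j, deg c i = -4 + deg c j := by decide

theorem deg_castLE : ∀ (c : Bool) (j : Fin 4),
    deg c (j.castLE (by decide)) = moduleN.deg j := by decide

/-- The action of `𝒜(1)` on a model. -/
noncomputable def action (c px py : Bool) :
    A1 →ₐ[ZMod 2] Module.End (ZMod 2) (Idx px py → ZMod 2) :=
  (Matrix.toLinAlgEquiv' :
    Matrix (Idx px py) (Idx px py) (ZMod 2) ≃ₐ[ZMod 2] _).toAlgHom.comp
    (A1.lift (mat px py imQ0) (mat px py (imSq2 c)) (mat_Sq1_mul_Sq1 px py)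
      (mat_Sq2_mul_Sq2 c px py))

theorem action_Sq1 (c px py : Bool) (v : Idx px py → ZMod 2) :
    action c px py A1.Sq1 v = (mat px py imQ0).mulVec v := by
  have h : action c px py A1.Sq1 = Matrix.toLinAlgEquiv' (mat px py imQ0) :=
    congrArg Matrix.toLinAlgEquiv' (A1.lift_Sq1 _ _ _ _)
  rw [h, Matrix.toLinAlgEquiv'_apply]

theorem action_Sq2 (c px py : Bool) (v : Idx px py → ZMod 2) :
    action c px py A1.Sq2 v = (mat px py (imSq2 c)).mulVec v := by
  have h : action c px py A1.Sq2 = Matrix.toLinAlgEquiv' (mat px py (imSq2 c)) :=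
    congrArg Matrix.toLinAlgEquiv' (A1.lift_Sq2 _ _ _ _)
  rw [h, Matrix.toLinAlgEquiv'_apply]

end Model

/-- The models of the reduced lifts of `N`, corresponding to the normal forms. -/
noncomputable def model (c px py : Bool) : GrMod A1.piece :=
  letI : Module A1 (Model.Idx px py → ZMod 2) := Module.compHom _ (Model.action c px py).toRingHom
  { carrier := Model.Idx px py → ZMod 2
    grading := coordGrading fun i => Model.deg c i.1
    isInternal := coordGrading_isInternal _
    smul_mem := smul_mem_of_gen A1.gen A1.wt _ (by
      rintro (_ | _) j x hx
      · change Model.action c px py A1.Sq1 x ∈ _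
        rw [Model.action_Sq1]
        exact Model.mulVec_mem _ _ _ 1
          (Model.mat_deg px py c _ 1 (Model.deg_imQ0 c)) j x hx
      · change Model.action c px py A1.Sq2 x ∈ _
        rw [Model.action_Sq2]
        exact Model.mulVec_mem _ _ _ 2
          (Model.mat_deg px py c _ 2 (Model.deg_imSq2 c)) j x hx) }

namespace Model

variable (c px py : Bool)

theorem Sq1_smul (v : Idx px py → ZMod 2) :
    A1.Sq1 • (show (model c px py).carrier from v) = (mat px py imQ0).mulVec v :=
  action_Sq1 c px py v

theorem Sq2_smul (v : Idx px py → ZMod 2) :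
    A1.Sq2 • (show (model c px py).carrier from v) = (mat px py (imSq2 c)).mulVec v :=
  action_Sq2 c px py v

theorem Q1_smul (v : Idx px py → ZMod 2) :
    A1.Q1 • (show (model c px py).carrier from v) = (mat px py imQ1).mulVec v := by
  rw [A1.Q1_smul, Sq1_smul, Sq2_smul]
  refine Eq.trans (congrArg₂ (· + ·) (Sq1_smul c px py _) (Sq2_smul c px py _)) ?_
  change (mat px py imQ0).mulVec ((mat px py (imSq2 c)).mulVec v) +
    (mat px py (imSq2 c)).mulVec ((mat px py imQ0).mulVec v) = _
  rw [Matrix.mulVec_mulVec, Matrix.mulVec_mulVec, ← Matrix.add_mulVec, mat_Q1]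

theorem top_smul (v : (model c px py).carrier) : A1.Sq2 • A1.Sq2 • A1.Sq2 • v = 0 := by
  refine (congrArg (A1.Sq2 • A1.Sq2 • ·) (Sq2_smul c px py v)).trans ?_
  refine (congrArg (A1.Sq2 • ·) (Sq2_smul c px py _)).trans ((Sq2_smul c px py _).trans ?_)
  have h : ∀ w : Idx px py → ZMod 2, (mat px py (imSq2 c)).mulVec
      ((mat px py (imSq2 c)).mulVec ((mat px py (imSq2 c)).mulVec w)) = 0 := fun w => by
    rw [Matrix.mulVec_mulVec, Matrix.mulVec_mulVec, mat_Sq2_pow_three, Matrix.zero_mulVec]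
  exact h v

theorem Q0_smul_underlying (v : Idx px py → ZMod 2) :
    E1.Q0 • (show (underlyingE1 (model c px py)).carrier from v) = (mat px py imQ0).mulVec v :=
  (congrFun (underlyingE1_Q0_smul (model c px py)) v).trans (Sq1_smul c px py v)

theorem Q1_smul_underlying (v : Idx px py → ZMod 2) :
    E1.Q1 • (show (underlyingE1 (model c px py)).carrier from v) = (mat px py imQ1).mulVec v :=
  (congrFun (underlyingE1_Q1_smul (model c px py)) v).trans (Q1_smul c px py v)

end Model

theorem moduleN.Q0_smul (v : Fin 4 → ZMod 2) :
    E1.Q0 • (show moduleN.carrier from v) = moduleN.matQ0.mulVec v := by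
  have h : moduleN.action (E1.gen QGen.q0) = Matrix.toLinAlgEquiv' moduleN.matQ0 :=
    congrArg Matrix.toLinAlgEquiv' (E1.lift_Q0 _ _ _ _ _)
  change moduleN.action (E1.gen QGen.q0) v = _
  rw [h, Matrix.toLinAlgEquiv'_apply]

theorem moduleN.Q1_smul (v : Fin 4 → ZMod 2) :
    E1.Q1 • (show moduleN.carrier from v) = moduleN.matQ1.mulVec v := by
  have h : moduleN.action (E1.gen QGen.q1) = Matrix.toLinAlgEquiv' moduleN.matQ1 :=
    congrArg Matrix.toLinAlgEquiv' (E1.lift_Q1 _ _ _ _ _)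
  change moduleN.action (E1.gen QGen.q1) v = _
  rw [h, Matrix.toLinAlgEquiv'_apply]

namespace Model

variable (c px py : Bool)

theorem matIncl_deg (i : Idx px py) (j : Fin 4) (h : matIncl px py i j ≠ 0) :
    deg c i.1 = moduleN.deg j := by
  by_cases hi : i.1 = j.castLE (by decide)
  · rw [hi]
    exact deg_castLE c j
  · exact absurd (if_neg hi) h

/-- The inclusion of `N` into a model. -/
noncomputable def incl : moduleN ⟶ underlyingE1 (model c px py) where
  toLin := E1.linOfCommutes
    (Matrix.mulVecLin (matIncl px py) : (Fin 4 → ZMod 2) →+ (Idx px py → ZMod 2))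
    (fun v => by
      refine Eq.trans ?_ (Q0_smul_underlying c px py _).symm
      refine (congrArg (matIncl px py).mulVec (moduleN.Q0_smul v)).trans ?_
      exact mulVec_mulVec_eq (Q0_mul_matIncl px py) v)
    (fun v => by
      refine Eq.trans ?_ (Q1_smul_underlying c px py _).symm
      refine (congrArg (matIncl px py).mulVec (moduleN.Q1_smul v)).trans ?_
      exact mulVec_mulVec_eq (Q1_mul_matIncl px py) v)
  map_mem d v hv := by
    have := mulVec_mem (matIncl px py) (fun i => deg c i.1) moduleN.deg 0
      (fun i j h => by rw [zero_add]; exact matIncl_deg c px py i j h) d v hv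
    rwa [zero_add] at this

/-- The projection of a model to `N`. -/
noncomputable def proj : underlyingE1 (model c px py) ⟶ moduleN where
  toLin := E1.linOfCommutes
    (Matrix.mulVecLin (matProj px py) : (Idx px py → ZMod 2) →+ (Fin 4 → ZMod 2))
    (fun v => by
      refine Eq.trans ?_ (moduleN.Q0_smul _).symm
      refine (congrArg (matProj px py).mulVec (Q0_smul_underlying c px py v)).trans ?_
      exact mulVec_mulVec_eq (matProj_mul_Q0 px py) v)
    (fun v => by
      refine Eq.trans ?_ (moduleN.Q1_smul _).symm
      refine (congrArg (matProj px py).mulVec (Q1_smul_underlying c px py v)).trans ?_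
      exact mulVec_mulVec_eq (matProj_mul_Q1 px py) v)
  map_mem d v hv := by
    have := mulVec_mem (matProj px py) moduleN.deg (fun i => deg c i.1) 0
      (fun i j h => by rw [zero_add]; exact (matIncl_deg c px py j i h).symm) d v hv
    rwa [zero_add] at this

theorem scalar_smul (r : ZMod 2) (v : (underlyingE1 (model c px py)).carrier) :
    algebraMap (ZMod 2) E1 r • v = (r • (show Idx px py → ZMod 2 from v) : Idx px py → ZMod 2) := by
  have hr : r = 0 ∨ r = 1 := (by decide : ∀ c : ZMod 2, c = 0 ∨ c = 1) r
  rcases hr with rfl | rfl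
  · rw [map_zero, zero_smul, zero_smul]
    rfl
  · rw [map_one, one_smul, one_smul]

theorem sum_single (w : Idx px py → ZMod 2) :
    ((Finsupp.linearEquivFunOnFinite (ZMod 2) (ZMod 2) (Idx px py)).symm w).sum (fun k r =>
      algebraMap (ZMod 2) E1 r •
        (show (underlyingE1 (model c px py)).carrier from (Pi.single k 1 : Idx px py → ZMod 2))) =
      w := by
  refine (Finsupp.sum_fintype _ _ fun k => ?_).trans ?_
  · rw [map_zero, zero_smul]
  refine (Finset.sum_congr rfl fun k _ => (scalar_smul c px py _ _).trans ?_).trans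
    (Finset.univ_sum_single w)
  change w k • (Pi.single k 1 : Idx px py → ZMod 2) = Pi.single k (w k)
  rw [← Pi.single_smul, smul_eq_mul, mul_one]

/-- The models are lifts of `N`: the complement of `N` in a model is free over `ℰ(1)`. -/
theorem nonempty_stable_iso :
    Nonempty (StCat.of (underlyingE1 (model c px py)) ≅ StCat.of moduleN) := by
  obtain ⟨P, hP, u, v, h, hh, huv⟩ := E1.exists_factorization_trace
    (M := underlyingE1 (model c px py)) (Idx px py) (fun i => deg c i.1)
    (fun i => (Pi.single i 1 : Idx px py → ZMod 2))
    (fun i => coordGrading_single_mem _ i 1)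
    ((Finsupp.linearEquivFunOnFinite (ZMod 2) (ZMod 2) (Idx px py)).symm.toLinearMap.comp
      (Matrix.mulVecLin (mat px py imH)) : (Idx px py → ZMod 2) →+ (Idx px py →₀ ZMod 2))
    (fun d x hx k hk => by
      by_contra hne
      refine hk ?_
      have := mulVec_mem (mat px py imH) _ _ (-4)
        (mat_deg px py c _ (-4) (deg_imH c)) d x hx
      refine this k fun h => hne ?_
      change deg c k.1 = -4 + d at h
      omega)
  have hh' : ∀ x : Idx px py → ZMod 2, h x = (mat px py imH).mulVec x :=
    fun x => (hh x).trans (sum_single c px py _)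
  have q0 := Q0_smul_underlying c px py
  have q1 := Q1_smul_underlying c px py
  refine GrMod.nonempty_stable_iso (proj c px py) (incl c px py) ⟨P, hP, u, v, fun x => ?_⟩
    ⟨P, hP, ⟨0, fun _ _ _ => zero_mem _⟩, ⟨0, fun _ _ _ => zero_mem _⟩, fun x => ?_⟩
  · refine (mulVec_trace px py x).trans ((huv x).trans ?_).symm
    refine congrArg₂ (· + ·) (congrArg₂ (· + ·) (congrArg₂ (· + ·) ?_ ?_) ?_) ?_
    · exact (congrArg (fun w => h (E1.Q0 • w)) (q1 x)).trans ((congrArg h (q0 _)).trans (hh' _))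
    · exact (congrArg (fun w => E1.Q0 • h w) (q1 x)).trans
        ((congrArg (E1.Q0 • ·) (hh' _)).trans (q0 _))
    · exact (congrArg (fun w => E1.Q1 • h w) (q0 x)).trans
        ((congrArg (E1.Q1 • ·) (hh' _)).trans (q1 _))
    · exact (congrArg (fun w => E1.Q0 • E1.Q1 • w) (hh' x)).trans
        ((congrArg (E1.Q0 • ·) (q1 _)).trans (q0 _))
  · refine sub_eq_zero.2 ?_
    have hx : ∀ w : Fin 4 → ZMod 2, (matProj px py).mulVec ((matIncl px py).mulVec w) = w :=
      fun w => by rw [Matrix.mulVec_mulVec, matProj_mul_matIncl, Matrix.one_mulVec]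
    exact hx x

end Model

/-! ### Modules in normal form are models -/

namespace Model

/-- The linear combinations of elements of an `𝒜(1)`-module with coefficients in the prime field. -/
noncomputable def comb {ι X : Type} [Fintype ι] [AddCommGroup X] [Module A1 X] (B : ι → X) :
    (ι → ZMod 2) →+ X where
  toFun v := ∑ i, algebraMap (ZMod 2) A1 (v i) • B i
  map_zero' := by simp
  map_add' v w := by simp [add_smul, Finset.sum_add_distrib]

theorem comb_apply {ι X : Type} [Fintype ι] [AddCommGroup X] [Module A1 X] (B : ι → X)
    (v : ι → ZMod 2) : comb B v = ∑ i, algebraMap (ZMod 2) A1 (v i) • B i := rfl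

theorem comb_single {ι X : Type} [Fintype ι] [DecidableEq ι] [AddCommGroup X] [Module A1 X]
    (B : ι → X) (i : ι) : comb B (Pi.single i 1) = B i := by
  rw [comb_apply, Finset.sum_eq_single i (fun j _ hj => by
    rw [Pi.single_eq_of_ne hj, map_zero, zero_smul]) (fun h => absurd (Finset.mem_univ i) h),
    Pi.single_eq_same, map_one, one_smul]

theorem comb_mulVec {ι X : Type} [Fintype ι] [AddCommGroup X] [Module A1 X] (B : ι → X)
    (A : Matrix ι ι (ZMod 2)) (a : A1) (h : ∀ j, comb B (fun i => A i j) = a • B j)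
    (v : ι → ZMod 2) : comb B (A.mulVec v) = a • comb B v := by
  have h1 : comb B (A.mulVec v) =
      ∑ i, ∑ j, algebraMap (ZMod 2) A1 (v j) • algebraMap (ZMod 2) A1 (A i j) • B i := by
    refine Finset.sum_congr rfl fun i _ => ?_
    rw [Matrix.mulVec, dotProduct, map_sum, Finset.sum_smul]
    refine Finset.sum_congr rfl fun j _ => ?_
    rw [mul_comm, map_mul, mul_smul]
  rw [h1, Finset.sum_comm, comb_apply, Finset.smul_sum]
  refine Finset.sum_congr rfl fun j _ => ?_
  rw [← Finset.smul_sum, ← comb_apply B fun i => A i j, h j, ← mul_smul, ← mul_smul,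
    Algebra.commutes]

theorem comb_mem {ι : Type} [Fintype ι] {M : GrMod A1.piece} (B : ι → M.carrier) (deg : ι → ℤ)
    (hB : ∀ i, B i ∈ M.grading (deg i)) (d : ℤ) (v : ι → ZMod 2) (hv : v ∈ coordGrading deg d) :
    comb B v ∈ M.grading d := by
  refine sum_mem fun i _ => ?_
  by_cases hi : deg i = d
  · have hr : v i = 0 ∨ v i = 1 := (by decide : ∀ c : ZMod 2, c = 0 ∨ c = 1) (v i)
    rcases hr with h | h
    · rw [h, map_zero, zero_smul]
      exact zero_mem _
    · rw [h, map_one, one_smul, ← hi]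
      exact hB i
  · rw [hv i hi, map_zero, zero_smul]
    exact zero_mem _

/-- The columns of the matrix of a map, when the absent elements of the family vanish. -/
theorem comb_mat {X : Type} [AddCommGroup X] [Module A1 X] (px py : Bool) (B : Fin 12 → X)
    (hB : ∀ i : Fin 12, ¬((4 ≤ i → i < 8 → px = true) ∧ (8 ≤ i → py = true)) → B i = 0)
    (f : Fin 12 → List (Fin 12)) (j : Idx px py) :
    comb (fun i : Idx px py => B i.1) (fun i => mat px py f i j) =
      ∑ i : Fin 12, if i ∈ f j.1 then B i else 0 := by
  refine Fintype.sum_of_injective (fun i : Idx px py => i.1) Subtype.val_injective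
    (fun i : Idx px py => algebraMap (ZMod 2) A1 (mat px py f i j) • B i.1) _
    (fun i hi => ?_) fun i => ?_
  · rw [hB i fun h => hi ⟨⟨i, h⟩, rfl⟩, ite_self]
  · change algebraMap (ZMod 2) A1 (if i.1 ∈ f j.1 then 1 else 0) • B i.1 = _
    split
    · rw [map_one, one_smul]
    · rw [map_zero, zero_smul]

/-- The elements of a module that correspond to the basis of a model. -/
noncomputable def family {X : Type} [AddCommGroup X] [Module A1 X] (n m x y : X) : Fin 12 → X :=
  ![n, A1.Q0 • n, m, A1.Q0 • m, x, A1.Q0 • x, A1.Q1 • x, A1.Q0 • A1.Q1 • x,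
    y, A1.Q0 • y, A1.Q1 • y, A1.Q0 • A1.Q1 • y]

theorem sum_imQ0 {X : Type} [AddCommGroup X] [Module A1 X] (n m x y : X) (j : Fin 12) :
    (∑ i : Fin 12, if i ∈ imQ0 j then family n m x y i else 0) =
      A1.Sq1 • family n m x y j := by
  rw [← A1.Q0_smul]
  fin_cases j <;> simp [imQ0, family, A1.Q0_Q0_smul]

/-- A partial left inverse of `Q₀`, sending `Q₀z` to `z`. -/
def imQ0inv : Fin 12 → List (Fin 12) := ![[], [0], [], [2], [], [4], [], [6], [], [8], [], [10]]

/-- A partial left inverse of `Q₁`, recovering `Q₀x` and `Q₀y`, on which `Q₀` vanishes. -/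
def imQ1inv : Fin 12 → List (Fin 12) := ![[], [], [], [], [], [], [], [5], [], [], [], [9]]

/-- The projection onto the span of `Q₀n`, `Q₀m`, `Q₀Q₁x` and `Q₀Q₁y`, the basis elements killed by
`Q₀` and `Q₁`. -/
def imSocle : Fin 12 → List (Fin 12) := ![[], [1], [], [3], [], [], [], [7], [], [], [], [11]]

theorem mat_socle : ∀ px py, mat px py imQ0inv * mat px py imQ0 +
    mat px py imQ1inv * mat px py imQ1 + mat px py imSocle = 1 := by decide +kernel

theorem imSocle_eq : ∀ i j, i ∈ imSocle j → i = 1 ∨ i = 3 ∨ i = 7 ∨ i = 11 := by decide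

/-- In a model, the elements killed by `Q₀` and `Q₁` are supported on `Q₀n`, `Q₀m`, `Q₀Q₁x` and
`Q₀Q₁y`. -/
theorem eq_zero_of_socle (c px py : Bool) (v : Idx px py → ZMod 2)
    (h0 : A1.Q0 • (show (model c px py).carrier from v) = 0)
    (h1 : A1.Q1 • (show (model c px py).carrier from v) = 0) (i : Idx px py)
    (hi : ¬(i.1 = 1 ∨ i.1 = 3 ∨ i.1 = 7 ∨ i.1 = 11)) :
    v i = 0 := by
  have key : ∀ v : Idx px py → ZMod 2, (mat px py imQ0).mulVec v = 0 →
      (mat px py imQ1).mulVec v = 0 → v i = 0 := by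
    intro v h0 h1
    have h := congrArg (fun A => A.mulVec v) (mat_socle px py)
    simp only [Matrix.add_mulVec, ← Matrix.mulVec_mulVec, Matrix.one_mulVec, h0, h1,
      Matrix.mulVec_zero, zero_add] at h
    rw [← h]
    change ∑ j, mat px py imSocle i j * v j = 0
    refine Finset.sum_eq_zero fun j _ => ?_
    change (if i.1 ∈ imSocle j.1 then 1 else 0) * v j = 0
    rw [if_neg fun h => hi (imSocle_eq _ _ h), zero_mul]
  exact key v ((Sq1_smul c px py v).symm.trans h0) ((Q1_smul c px py v).symm.trans h1)

end Model

/-- A homomorphism is injective if it is injective on the elements killed by `Q₀` and `Q₁`. -/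
theorem A1.injective_of_socle {M N : GrMod A1.piece} (f : M ⟶ N)
    (h : ∀ d, ∀ x ∈ M.grading d, Q0 • x = 0 → Q1 • x = 0 → f.toLin x = 0 → x = 0) :
    Function.Injective f.toLin := by
  have hom : ∀ d, ∀ x ∈ M.grading d, f.toLin x = 0 → x = 0 := by
    intro d x hx hfx
    have hT : Q0 • Q1 • x = 0 := h _ _ (Q0_mem (Q1_mem hx rfl) rfl) (Q0_Q0_smul _)
      (by rw [Q1_Q0_smul, Q1_Q1_smul, smul_zero])
      (by rw [map_smul, map_smul, hfx, smul_zero, smul_zero])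
    exact h d x hx
      (h _ _ (Q0_mem hx rfl) (Q0_Q0_smul _) (by rw [Q1_Q0_smul, hT])
        (by rw [map_smul, hfx, smul_zero]))
      (h _ _ (Q1_mem hx rfl) hT (Q1_Q1_smul _) (by rw [map_smul, hfx, smul_zero])) hfx
  refine (injective_iff_map_eq_zero f.toLin).2 fun x hx => ?_
  have hp : ∀ d, M.proj d x = 0 := fun d => hom d _ (M.proj_mem d x) (by
    rw [← GrMod.proj_hom, hx, map_zero])
  exact M.eq_zero_of_mem_ne (M.mem_of_proj fun e _ => hp e : x ∈ M.grading 0)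
    (M.mem_of_proj fun e _ => hp e : x ∈ M.grading 1) zero_ne_one

namespace A1.NormalForm

variable {M : GrMod A1.piece} {c px py : Bool} {n m x y : M.carrier}

theorem family_eq_zero (h : NormalForm M c px py n m x y) (i : Fin 12)
    (hi : ¬((4 ≤ i → i < 8 → px = true) ∧ (8 ≤ i → py = true))) :
    Model.family n m x y i = 0 := by
  have hx := h.x_eq_zero
  have hy := h.y_eq_zero
  have key : ∀ (px py : Bool) (i : Fin 12),
      ¬((4 ≤ i → i < 8 → px = true) ∧ (8 ≤ i → py = true)) →
      (px = false ∧ (i = 4 ∨ i = 5 ∨ i = 6 ∨ i = 7)) ∨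
      (py = false ∧ (i = 8 ∨ i = 9 ∨ i = 10 ∨ i = 11)) := by decide
  rcases key px py i hi with ⟨hp, rfl | rfl | rfl | rfl⟩ | ⟨hp, rfl | rfl | rfl | rfl⟩ <;>
    simp [Model.family, hx, hy, hp]

theorem family_mem (h : NormalForm M c px py n m x y) (i : Fin 12) :
    Model.family n m x y i ∈ M.grading (Model.deg c i) := by
  have hn := h.frame.n_mem
  have hm := h.frame.m_mem
  have hx := h.x_mem
  have hy := h.y_mem
  cases c <;> fin_cases i <;> first
    | assumption
    | exact Q0_mem ‹_› (by decide)
    | exact Q1_mem ‹_› (by decide)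
    | exact Q0_mem (Q1_mem ‹_› rfl) (by decide)

/-- The formulas for `Sq²` on the family, most of which follow from those for `n`, `m`, `x`, `y` and
the commutation relations. -/
theorem sum_imSq2 (h : NormalForm M c px py n m x y) (j : Fin 12)
    (hj : (4 ≤ j → j < 8 → px = true) ∧ (8 ≤ j → py = true)) :
    (∑ i : Fin 12, if i ∈ Model.imSq2 c j then Model.family n m x y i else 0) =
      Sq2 • Model.family n m x y j := by
  have hn := h.Sq2_n
  have hm := h.Sq2_m
  have hQn : Q1 • n = Q0 • m := h.frame.Q1_n
  have hQm : Q1 • m = 0 := h.frame.Q1_m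
  have hx : 4 ≤ j → j < 8 → Sq2 • x = if c then Q0 • n else n := fun h4 h8 => h.Sq2_x (hj.1 h4 h8)
  have hy : 8 ≤ j → Sq2 • y = if c then Q0 • m else m := fun h8 => h.Sq2_y (hj.2 h8)
  clear hj
  cases c <;> fin_cases j
  all_goals first
    | replace hx := hx (by decide) (by decide)
    | replace hy := hy (by decide)
    | skip
  all_goals simp [Fin.sum_univ_succ, Model.imSq2, Model.family, *, Q0_Q0_smul, Q1_Q1_smul,
    Q1_Q0_smul, Sq2_Q0_smul, Sq2_Q1_smul]
  · rw [add_assoc]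
  · rw [add_right_comm, add_self_smul, zero_add]

/-- The homomorphism from the model to a module in normal form. -/
noncomputable def hom (h : NormalForm M c px py n m x y) : model c px py ⟶ M where
  toLin := linOfCommutes
    (Model.comb (fun i : Model.Idx px py => Model.family n m x y i.1) :
      (Model.Idx px py → ZMod 2) →+ M.carrier)
    (fun v => (congrArg (Model.comb _) (Model.Sq1_smul c px py v)).trans
      (Model.comb_mulVec _ _ Sq1 (fun j => (Model.comb_mat px py _ h.family_eq_zero _ j).trans
        (Model.sum_imQ0 n m x y j.1)) v))
    (fun v => (congrArg (Model.comb _) (Model.Sq2_smul c px py v)).trans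
      (Model.comb_mulVec _ _ Sq2 (fun j => (Model.comb_mat px py _ h.family_eq_zero _ j).trans
        (h.sum_imSq2 j.1 j.2)) v))
  map_mem d v hv := Model.comb_mem (fun i : Model.Idx px py => Model.family n m x y i.1)
    (fun i => Model.deg c i.1) (fun i => h.family_mem i.1) d v hv

theorem hom_apply (h : NormalForm M c px py n m x y) (v : Model.Idx px py → ZMod 2) :
    h.hom.toLin v = Model.comb (fun i : Model.Idx px py => Model.family n m x y i.1) v := rfl

theorem family_mem_range (h : NormalForm M c px py n m x y) (i : Fin 12) :
    Model.family n m x y i ∈ LinearMap.range h.hom.toLin := by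
  by_cases hi : (4 ≤ i → i < 8 → px = true) ∧ (8 ≤ i → py = true)
  · exact ⟨(Pi.single ⟨i, hi⟩ 1 : Model.Idx px py → ZMod 2),
      Model.comb_single (fun i : Model.Idx px py => Model.family n m x y i.1) ⟨i, hi⟩⟩
  · rw [h.family_eq_zero i hi]
    exact zero_mem _

/-- A module in normal form is generated by `n`, `m`, `x` and `y`. -/
theorem eq_top (h : NormalForm M c px py n m x y) (R : Submodule A1 M.carrier) (hn : n ∈ R)
    (hm : m ∈ R) (hx : x ∈ R) (hy : y ∈ R) : R = ⊤ := by
  -- first arrange that `Q₀ Q₁` vanishes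
  have h1 : ∀ d, ∀ z ∈ M.grading d, ∃ r ∈ R, Q0 • Q1 • (z - r) = 0 ∧ z - r ∈ M.grading d := by
    intro d z hz
    have key : ∀ r ∈ M.grading d, Q0 • Q1 • z = Q0 • Q1 • r →
        Q0 • Q1 • (z - r) = 0 ∧ z - r ∈ M.grading d := fun r hr e =>
      ⟨by rw [smul_sub, smul_sub, e, sub_self], sub_mem hz hr⟩
    rcases h.top d z hz with e | ⟨rfl, e⟩ | ⟨rfl, e⟩
    · exact ⟨0, zero_mem _, key 0 (zero_mem _) (by rw [e, smul_zero, smul_zero])⟩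
    · exact ⟨x, hx, key x h.x_mem e⟩
    · exact ⟨y, hy, key y h.y_mem e⟩
  have hT : ∀ d, ∀ z ∈ M.grading d, Q0 • Q1 • z ∈ R := by
    intro d z hz
    obtain ⟨r, hr, e, _⟩ := h1 d z hz
    rw [smul_sub, smul_sub, sub_eq_zero] at e
    rw [e]
    exact R.smul_mem _ (R.smul_mem _ hr)
  have h0 : ∀ d, ∀ z ∈ M.grading d, Q0 • z ∈ R := by
    intro d z hz
    obtain ⟨r, hr, e, hd⟩ := h1 d z hz
    obtain ⟨p, hp, q, hq, H⟩ := h.frame.span d _ hd e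
    have hpq : Q0 • (Q0 • p + Q1 • q) ∈ R := by
      rw [smul_add, Q0_Q0_smul, zero_add]
      exact hT _ q hq
    rw [← sub_add_cancel z r, smul_add]
    refine R.add_mem ?_ (R.smul_mem _ hr)
    rcases H with H | ⟨_, H⟩ | ⟨_, H⟩
    · rw [H]
      exact hpq
    · rw [H, smul_add]
      exact R.add_mem (R.smul_mem _ hn) hpq
    · rw [H, smul_add]
      exact R.add_mem (R.smul_mem _ hm) hpq
  have h2 : ∀ d, ∀ z ∈ M.grading d, Q1 • z ∈ R := by
    intro d z hz
    obtain ⟨r, hr, e, hd⟩ := h1 d z hz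
    obtain ⟨p, hp, q, hq, H⟩ := h.frame.span d _ hd e
    have hpq : Q1 • (Q0 • p + Q1 • q) ∈ R := by
      rw [smul_add, Q1_Q1_smul, add_zero, Q1_Q0_smul]
      exact hT _ p hp
    rw [← sub_add_cancel z r, smul_add]
    refine R.add_mem ?_ (R.smul_mem _ hr)
    rcases H with H | ⟨_, H⟩ | ⟨_, H⟩
    · rw [H]
      exact hpq
    · rw [H, smul_add]
      exact R.add_mem (R.smul_mem _ hn) hpq
    · rw [H, smul_add]
      exact R.add_mem (R.smul_mem _ hm) hpq
  refine (Submodule.eq_top_iff').2 fun z => ?_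
  refine M.homogeneous_induction (C := (· ∈ R)) (zero_mem _) (fun d z hz => ?_)
    (fun _ _ => R.add_mem) z
  obtain ⟨r, hr, e, hd⟩ := h1 d z hz
  obtain ⟨p, hp, q, hq, H⟩ := h.frame.span d _ hd e
  have hpq : Q0 • p + Q1 • q ∈ R := R.add_mem (h0 _ p hp) (h2 _ q hq)
  rw [← sub_add_cancel z r]
  refine R.add_mem ?_ hr
  rcases H with H | ⟨_, H⟩ | ⟨_, H⟩
  · rw [H]
    exact hpq
  · rw [H]
    exact R.add_mem hn hpq
  · rw [H]
    exact R.add_mem hm hpq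

theorem hom_surjective (h : NormalForm M c px py n m x y) : Function.Surjective h.hom.toLin :=
  LinearMap.range_eq_top.1 (h.eq_top _ (h.family_mem_range 0) (h.family_mem_range 2)
    (h.family_mem_range 4) (h.family_mem_range 8))

/-- By `injective_of_socle`, only combinations of `Q₀n`, `Q₀m`, `Q₀Q₁x` and `Q₀Q₁y` have to be
considered; these elements are independent by the definition of a frame and for degree reasons. -/
theorem hom_injective (h : NormalForm M c px py n m x y) : Function.Injective h.hom.toLin := by
  refine injective_of_socle h.hom fun d (v : Model.Idx px py → ZMod 2) hv h0 h1 hfv => ?_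
  have hsoc := Model.eq_zero_of_socle c px py v h0 h1
  replace hfv := (h.hom_apply v).symm.trans hfv
  -- the coordinates of `v`, including those of the absent basis elements
  let w : Fin 12 → ZMod 2 := fun i =>
    if hi : (4 ≤ i → i < 8 → px = true) ∧ (8 ≤ i → py = true) then
      v ⟨i, hi⟩ else 0
  have hw : ∀ i : Model.Idx px py, v i = w i.1 :=
    fun i => by
      change v i = dite _ _ _
      rw [dif_pos i.2]
      rfl
  have hsum : ∑ i : Fin 12, algebraMap (ZMod 2) A1 (w i) • Model.family n m x y i = 0 := by
    rw [← hfv]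
    refine (Fintype.sum_of_injective (fun i : Model.Idx px py => i.1) Subtype.val_injective
      (fun i => algebraMap (ZMod 2) A1 (v i) •
        Model.family n m x y i.1) _ (fun i hi => ?_) fun i => ?_).symm
    · rw [h.family_eq_zero i fun h => hi ⟨⟨i, h⟩, rfl⟩, smul_zero]
    · rw [hw]
  have hw0 : ∀ i, ¬(i = 1 ∨ i = 3 ∨ i = 7 ∨ i = 11) → w i = 0 := by
    intro i hi
    by_cases hi' : (4 ≤ i → i < 8 → px = true) ∧ (8 ≤ i → py = true)
    · rw [← hw ⟨i, hi'⟩]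
      exact hsoc ⟨i, hi'⟩ hi
    · exact dif_neg hi'
  have hwd : ∀ i, Model.deg c i ≠ d → w i = 0 := by
    intro i hi
    by_cases hi' : (4 ≤ i → i < 8 → px = true) ∧ (8 ≤ i → py = true)
    · rw [← hw ⟨i, hi'⟩]
      exact hv ⟨i, hi'⟩ hi
    · exact dif_neg hi'
  have hwx : w 7 ≠ 0 → px = true := fun h7 => by
    by_contra hp
    exact h7 (dif_neg fun h => hp (h.1 (by decide) (by decide)))
  have hwy : w 11 ≠ 0 → py = true := fun h11 => by
    by_contra hp
    exact h11 (dif_neg fun h => hp (h.2 (by decide)))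
  have hwc : ∀ i, w i ≠ 0 → w i = 1 := fun i => (by decide : ∀ r : ZMod 2, r ≠ 0 → r = 1) (w i)
  clear_value w
  have hsum' : algebraMap (ZMod 2) A1 (w 1) • Q0 • n + algebraMap (ZMod 2) A1 (w 3) • Q0 • m +
      Q0 • Q1 • (algebraMap (ZMod 2) A1 (w 7) • x + algebraMap (ZMod 2) A1 (w 11) • y) = 0 := by
    rw [← hsum, smul_add, smul_add]
    have hcomm : ∀ (r : ZMod 2) (z : M.carrier), Q0 • Q1 • algebraMap (ZMod 2) A1 r • z =
        algebraMap (ZMod 2) A1 r • Q0 • Q1 • z := fun r z => by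
      simp only [← mul_smul, Algebra.commutes, mul_assoc]
    rw [hcomm, hcomm]
    rw [← Finset.sum_subset (Finset.subset_univ {1, 3, 7, 11}) fun i _ hi => by
      rw [hw0 i (by simpa using hi), map_zero, zero_smul],
      Finset.sum_insert (by decide), Finset.sum_insert (by decide),
      Finset.sum_insert (by decide), Finset.sum_singleton]
    simp only [add_assoc]
    rfl
  have hne : ∀ {i j}, w i ≠ 0 → Model.deg c i ≠ Model.deg c j → w j = 0 := by
    intro i j hi hij
    refine hwd j fun hj => hi (hwd i ?_)
    rwa [← hj]
  -- nonzero coefficients belong to basis elements of the same degree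
  have hdeg : ∀ c, Model.deg c 1 ≠ Model.deg c 3 ∧ Model.deg c 7 ≠ Model.deg c 11 := by decide
  have w1 : w 1 = 0 := by
    by_contra hi
    rw [hwc 1 hi, hne hi (hdeg c).1, map_one, map_zero, one_smul, zero_smul,
      add_zero] at hsum'
    exact h.frame.Q0_n_ne _ (eq_of_add_eq_zero hsum')
  have w3 : w 3 = 0 := by
    by_contra hi
    rw [hwc 3 hi, w1, map_one, map_zero, one_smul, zero_smul, zero_add] at hsum'
    exact h.frame.Q0_m_ne _ (eq_of_add_eq_zero hsum')
  rw [w1, w3, map_zero, zero_smul, zero_smul, zero_add, zero_add] at hsum'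
  have w7 : w 7 = 0 := by
    by_contra hi
    rw [hwc 7 hi, hne hi (hdeg c).2, map_one, map_zero, one_smul, zero_smul,
      add_zero] at hsum'
    exact h.top_x (hwx hi) hsum'
  have w11 : w 11 = 0 := by
    by_contra hi
    rw [hwc 11 hi, w7, map_one, map_zero, one_smul, zero_smul, zero_add] at hsum'
    exact h.top_y (hwy hi) hsum'
  refine funext fun i => (hw i).trans ?_
  by_cases hi : i.1 = 1 ∨ i.1 = 3 ∨ i.1 = 7 ∨ i.1 = 11
  · rcases hi with e | e | e | e <;> rw [e] <;> assumption
  · exact hw0 _ hi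

/-- A module in normal form is isomorphic to the corresponding model. -/
theorem nonempty_stable_iso (h : NormalForm M c px py n m x y) :
    Nonempty (StCat.of (model c px py) ≅ StCat.of M) :=
  GrMod.nonempty_stable_iso_of_bijective h.hom ⟨h.hom_injective, h.hom_surjective⟩

end A1.NormalForm

/-! ### Restriction to `ℰ(1)` in the stable category -/

namespace E1

/-- The elements `1` and `Sq²` generate `𝒜(1)` over `ℰ(1)`, because `Sq²` commutes with `ℰ(1)` up
to `ℰ(1)`, and its square lies in `ℰ(1)`. -/
theorem exists_toA1_add (a : A1) : ∃ e e' : E1, a = toA1 e + toA1 e' * A1.Sq2 := by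
  have hSq2 : ∀ e : E1, ∃ e' : E1, A1.Sq2 * toA1 e = toA1 e * A1.Sq2 + toA1 e' := by
    intro e
    obtain ⟨c, rfl⟩ := exists_coords e
    have h0 : A1.Sq2 * A1.Q0 = A1.Q0 * A1.Sq2 + A1.Q1 := by
      simpa only [smul_eq_mul, mul_one] using A1.Sq2_Q0_smul (1 : A1)
    have h1 : A1.Sq2 * A1.Q1 = A1.Q1 * A1.Sq2 := by
      simpa only [smul_eq_mul, mul_one] using A1.Sq2_Q1_smul (1 : A1)
    have h01 : A1.Sq2 * (A1.Q0 * A1.Q1) = A1.Q0 * A1.Q1 * A1.Sq2 := by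
      rw [← mul_assoc, h0, add_mul, mul_assoc, h1, A1.Q1_mul_Q1, add_zero, mul_assoc]
    refine ⟨c 1 • Q1, ?_⟩
    simp only [map_add, map_smul, map_mul, map_one, toA1_Q0, toA1_Q1, mul_add, add_mul,
      mul_smul_comm, smul_mul_assoc, h0, h1, h01, mul_one, one_mul, smul_add]
    abel
  have hSq1 : ∀ e : E1, A1.Sq1 * toA1 e = toA1 (Q0 * e) := fun e => by
    rw [map_mul, toA1_Q0]
    rfl
  have hT : A1.Sq2 * A1.Sq2 = toA1 (Q0 * Q1) := by
    rw [map_mul, toA1_Q0, toA1_Q1]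
    simpa only [smul_eq_mul, mul_one] using A1.Sq2_Sq2_smul_eq (1 : A1)
  let C : A1 → Prop := fun a => ∀ e e' : E1, ∃ f f' : E1,
    a * (toA1 e + toA1 e' * A1.Sq2) = toA1 f + toA1 f' * A1.Sq2
  have h : C a := by
    refine A1.induction (C := C) (fun r e e' => ⟨r • e, r • e', ?_⟩)
      (fun e e' => ⟨Q0 * e, Q0 * e', ?_⟩) (fun e e' => ?_) (fun x y hx hy e e' => ?_)
      (fun x y hx hy e e' => ?_) a
    · rw [← Algebra.smul_def, smul_add, map_smul, map_smul, smul_mul_assoc]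
    · rw [mul_add, ← mul_assoc, hSq1, hSq1]
    · obtain ⟨f, hf⟩ := hSq2 e
      obtain ⟨f', hf'⟩ := hSq2 e'
      refine ⟨f + e' * (Q0 * Q1), e + f', ?_⟩
      rw [mul_add, ← mul_assoc, hf, hf', add_mul, mul_assoc (toA1 e'), hT]
      simp only [map_add, add_mul, map_mul]
      abel
    · obtain ⟨f, f', hf⟩ := hy e e'
      obtain ⟨g, g', hg⟩ := hx f f'
      exact ⟨g, g', by rw [mul_assoc, hf, hg]⟩
    · obtain ⟨f, f', hf⟩ := hx e e'
      obtain ⟨g, g', hg⟩ := hy e e'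
      refine ⟨f + g, f' + g', ?_⟩
      rw [add_mul, hf, hg]
      simp only [map_add, add_mul]
      abel
  obtain ⟨f, f', hf⟩ := h 1 0
  exact ⟨f, f', by simpa using hf⟩

/-- The elements `1` and `Sq²` are independent over `ℰ(1)`: multiplication by elements of `ℰ(1)`
reduces this to the independence of `Q₀ Q₁` and `Q₀ Q₁ Sq²`. -/
theorem eq_zero_of_toA1_add {e e' : E1} (h : toA1 e + toA1 e' * A1.Sq2 = 0) : e = 0 ∧ e' = 0 := by
  have hT : A1.Q0 * A1.Q1 = A1.Sq2 * A1.Sq2 := by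
    simpa only [smul_eq_mul, mul_one] using (A1.Sq2_Sq2_smul_eq (1 : A1)).symm
  have h4 : A1.Sq2 * (A1.Sq2 * (A1.Sq2 * A1.Sq2)) = 0 := by
    simpa only [smul_eq_mul, mul_one] using A1.top_smul_Sq2_smul (1 : A1)
  have key : ∀ c c' : ZMod 2, c • (A1.Q0 * A1.Q1) + c' • (A1.Q0 * A1.Q1 * A1.Sq2) = 0 →
      c = 0 ∧ c' = 0 := by
    intro c c' h
    rw [hT] at h
    have h' := congrArg (A1.Sq2 * ·) h
    simp only [mul_add, mul_smul_comm, mul_assoc, h4, smul_zero, add_zero, mul_zero] at h'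
    have hc : c = 0 := by
      refine (smul_eq_zero.1 h').resolve_right fun h => A1.Sq2_pow_three_ne_zero ?_
      rw [mul_assoc, h]
    rw [hc, zero_smul, zero_add] at h
    exact ⟨hc, (smul_eq_zero.1 h).resolve_right A1.Sq2_pow_three_ne_zero⟩
  obtain ⟨c, rfl⟩ := exists_coords e
  obtain ⟨c', rfl⟩ := exists_coords e'
  have h00 := A1.Q0_mul_Q0
  have h11 := A1.Q1_mul_Q1
  have h10 := A1.Q0_mul_Q1.symm
  have h000 : ∀ z, A1.Q0 * (A1.Q0 * z) = 0 := fun z => A1.Q0_Q0_smul z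
  have h111 : ∀ z, A1.Q1 * (A1.Q1 * z) = 0 := fun z => A1.Q1_Q1_smul z
  have h110 : ∀ z, A1.Q1 * (A1.Q0 * z) = A1.Q0 * (A1.Q1 * z) :=
    fun z => A1.Q1_Q0_smul z
  simp only [map_add, map_smul, map_mul, map_one, toA1_Q0, toA1_Q1, add_mul, smul_mul_assoc,
    one_mul] at h
  have e0 : c 0 = 0 ∧ c' 0 = 0 := key _ _ (by
    have := congrArg (A1.Q0 * A1.Q1 * ·) h
    simpa only [mul_add, mul_smul_comm, mul_assoc, h00, h11, h10, h000, h111, h110, smul_zero,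
      add_zero, mul_zero, mul_one] using this)
  have e1 : c 1 = 0 ∧ c' 1 = 0 := key _ _ (by
    have := congrArg (A1.Q1 * ·) h
    simpa only [e0.1, e0.2, zero_smul, zero_add, mul_add, mul_smul_comm, mul_assoc, h00, h11, h10,
      h000, h111, h110, smul_zero, add_zero, mul_zero, mul_one] using this)
  have e2 : c 2 = 0 ∧ c' 2 = 0 := key _ _ (by
    have := congrArg (A1.Q0 * ·) h
    simpa only [e0.1, e0.2, e1.1, e1.2, zero_smul, zero_add, mul_add, mul_smul_comm, mul_assoc,
      h00, h11, h10, h000, h111, h110, smul_zero, add_zero, mul_zero, mul_one] using this)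
  have e3 : c 3 = 0 ∧ c' 3 = 0 := key _ _ (by
    simpa only [e0.1, e0.2, e1.1, e1.2, e2.1, e2.2, zero_smul, zero_add] using h)
  simp [e0, e1, e2, e3]

/-- The algebra `𝒜(1)` is free over `ℰ(1)` with basis `1`, `Sq²`. -/
theorem exists_basis_toA1 : letI : Module E1 A1 := Module.compHom A1 toA1.toRingHom
    ∃ b : Module.Basis (Fin 2) E1 A1, b 0 = 1 ∧ b 1 = A1.Sq2 := by
  let _ : Module E1 A1 := Module.compHom A1 toA1.toRingHom
  have hs : ∀ (e : E1) (a : A1), e • a = toA1 e * a := fun _ _ => rfl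
  refine ⟨Module.Basis.mk (v := ![1, A1.Sq2]) ?_ ?_, ?_, ?_⟩
  · refine LinearIndependent.pair_iff.2 fun e e' h => eq_zero_of_toA1_add ?_
    rwa [hs, hs, mul_one] at h
  · rintro a -
    obtain ⟨e, e', rfl⟩ := exists_toA1_add a
    have h0 : (1 : A1) ∈ Submodule.span E1 (Set.range ![1, A1.Sq2]) :=
      Submodule.subset_span ⟨0, rfl⟩
    have h1 : A1.Sq2 ∈ Submodule.span E1 (Set.range ![1, A1.Sq2]) :=
      Submodule.subset_span ⟨1, rfl⟩
    have := add_mem (Submodule.smul_mem _ e h0) (Submodule.smul_mem _ e' h1)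
    rwa [hs, hs, mul_one] at this
  · rw [Module.Basis.mk_apply]; rfl
  · rw [Module.Basis.mk_apply]; rfl

end E1

/-- Restriction to `ℰ(1)` preserves free graded modules, as `𝒜(1)` is free over `ℰ(1)`. -/
theorem isFree_underlyingE1 {P : GrMod A1.piece} (hP : P.IsFree) : (underlyingE1 P).IsFree := by
  obtain ⟨κ, b, deg, hb⟩ := hP
  let _ : Module E1 A1 := Module.compHom A1 E1.toA1.toRingHom
  let _ : Module E1 P.carrier := Module.compHom P.carrier E1.toA1.toRingHom
  have : IsScalarTower E1 A1 P.carrier := ⟨fun e a x => mul_smul (E1.toA1 e) a x⟩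
  obtain ⟨s, hs0, hs1⟩ := E1.exists_basis_toA1
  refine ⟨Fin 2 × κ, (s.smulTower b : Module.Basis (Fin 2 × κ) E1 P.carrier),
    fun i => deg i.2 + ![0, 2] i.1, ?_⟩
  rintro ⟨i, k⟩
  change (s.smulTower b : Module.Basis (Fin 2 × κ) E1 P.carrier) (i, k) ∈ P.grading _
  rw [Module.Basis.smulTower_apply]
  fin_cases i
  · change s 0 • b k ∈ P.grading (deg k + 0)
    rw [hs0, one_smul, add_zero]
    exact hb k
  · change s 1 • b k ∈ P.grading (deg k + 2)
    rw [hs1]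
    exact A1.Sq2_mem (hb k) rfl

/-- Restriction of graded modules to `ℰ(1)`, as a functor. -/
noncomputable def restrictionE1 : GrMod A1.piece ⥤ GrMod E1.piece where
  obj := underlyingE1
  map {M N} f :=
    { toLin :=
        { toFun := f.toLin
          map_add' := f.toLin.map_add
          map_smul' := fun e x => f.toLin.map_smul (E1.toA1 e) x }
      map_mem := f.map_mem }

/-- Restriction to `ℰ(1)` preserves stable isomorphisms. -/
theorem nonempty_stable_iso_underlyingE1 {M N : GrMod A1.piece} (e : StCat.of M ≅ StCat.of N) :
    Nonempty (StCat.of (underlyingE1 M) ≅ StCat.of (underlyingE1 N)) :=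
  ⟨(CategoryTheory.Quotient.lift (GrMod.StablyEqual A1.piece)
    (restrictionE1 ⋙ CategoryTheory.Quotient.functor (GrMod.StablyEqual E1.piece))
    (fun _ _ _ _ ⟨P, hP, u, v, h⟩ => CategoryTheory.Quotient.sound _
      ⟨underlyingE1 P, isFree_underlyingE1 hP, restrictionE1.map u, restrictionE1.map v,
        h⟩)).mapIso e⟩

/-! ### The models are pairwise not stably isomorphic -/

namespace A1

/-- An endomorphism of a reduced module that is stably the identity is bijective: it differs from
the identity by an endomorphism with decomposable values, which is nilpotent. -/
theorem bijective_of_stablyEqual {M : GrMod piece} (hM : ∀ x : M.carrier, Sq2 • Sq2 • Sq2 • x = 0)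
    (f : M ⟶ M) (h : GrMod.UngradedStablyEqual piece f (𝟙 M)) : Function.Bijective f.toLin := by
  obtain ⟨P, _, _, _, u, v, h⟩ := h
  let ε : M.carrier →ₗ[A1] M.carrier := f.toLin - LinearMap.id
  have hε : ∀ x, ∃ y z, ε x = Sq1 • y + Sq2 • z := by
    intro x
    obtain ⟨y, z, hyz⟩ := exists_of_top_smul_eq_zero (p := u x) (by
      rw [← map_smul, ← map_smul, ← map_smul, hM, map_zero])
    exact ⟨v y, v z, by rw [← map_smul, ← map_smul, ← map_add, ← hyz]; exact h x⟩
  have h1 : IsUnit (1 + ε) := (isNilpotent_of_rad ε hε).isUnit_one_add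
  have h2 : 1 + ε = f.toLin := add_sub_cancel _ _
  rw [h2] at h1
  exact (Module.End.isUnit_iff _).1 h1

/-- Stably isomorphic reduced modules embed into each other. -/
theorem exists_injective {M N : GrMod piece} (hM : ∀ x : M.carrier, Sq2 • Sq2 • Sq2 • x = 0)
    (e : StCat.of M ≅ StCat.of N) : ∃ f : M ⟶ N, Function.Injective f.toLin := by
  obtain ⟨f, g, h, -⟩ := GrMod.exists_of_stable_iso e
  exact ⟨f, Function.Injective.of_comp (f := g.toLin) (bijective_of_stablyEqual hM _ h).1⟩

end A1

namespace Model

theorem exists_deg_iff (c px py : Bool) (d : ℤ) :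
    (∃ x ∈ (model c px py).grading d, x ≠ 0) ↔ ∃ k : Idx px py, deg c k.1 = d := by
  constructor
  · rintro ⟨x, hx, h⟩
    by_contra! hd
    exact h (funext fun k => hx k (hd k))
  · rintro ⟨k, rfl⟩
    refine ⟨(Pi.single k 1 : Idx px py → ZMod 2),
      coordGrading_single_mem (fun i : Idx px py => deg c i.1) k 1, fun h => ?_⟩
    exact one_ne_zero ((Pi.single_eq_same (M := fun _ : Idx px py => ZMod 2) k 1).symm.trans
      (congrFun h k))

theorem exists_Sq2_smul_iff (c px py : Bool) (d : ℤ) :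
    (∃ x ∈ (model c px py).grading d, A1.Sq2 • x ≠ 0) ↔
      ∃ j k : Idx px py, deg c k.1 = d ∧ j.1 ∈ imSq2 c k.1 := by
  constructor
  · rintro ⟨x, hx, h⟩
    by_contra! hd
    refine h ((Sq2_smul c px py x).trans (funext fun j => ?_))
    change ∑ k, mat px py (imSq2 c) j k * (show Idx px py → ZMod 2 from x) k = 0
    refine Finset.sum_eq_zero fun k _ => ?_
    by_cases hk : deg c k.1 = d
    · refine (congrArg (· * _) ?_).trans (zero_mul _)
      exact if_neg (hd j k hk)
    · exact (congrArg (_ * ·) (hx k hk)).trans (mul_zero _)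
  · rintro ⟨j, k, rfl, hj⟩
    refine ⟨(Pi.single k 1 : Idx px py → ZMod 2),
      coordGrading_single_mem (fun i : Idx px py => deg c i.1) k 1, fun h => ?_⟩
    have h' := congrFun ((Sq2_smul c px py _).symm.trans h) j
    have h'' : (mat px py (imSq2 c)).mulVec (Pi.single k 1) j = 0 := h'
    rw [Matrix.mulVec_single_one] at h''
    exact one_ne_zero ((if_pos hj).symm.trans h'')

/-- The degrees that occur, and the action of `Sq²` in degree `-1`, determine the parameters. -/
theorem eq_of_invariants : ∀ c px py c' px' py' : Bool,
    (∀ d ∈ [(-3 : ℤ), -2, 3, 4], (∃ k : Idx px py, deg c k.1 = d) ↔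
      ∃ k : Idx px' py', deg c' k.1 = d) →
    ((∃ j k : Idx px py, deg c k.1 = -1 ∧ j.1 ∈ imSq2 c k.1) ↔
      ∃ j k : Idx px' py', deg c' k.1 = -1 ∧ j.1 ∈ imSq2 c' k.1) →
    c = c' ∧ px = px' ∧ py = py' := by decide +kernel

theorem eq_of_stable_iso {c px py c' px' py' : Bool}
    (e : StCat.of (model c px py) ≅ StCat.of (model c' px' py')) :
    c = c' ∧ px = px' ∧ py = py' := by
  obtain ⟨f, hf⟩ := A1.exists_injective (top_smul c px py) e
  obtain ⟨g, hg⟩ := A1.exists_injective (top_smul c' px' py') e.symm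
  refine eq_of_invariants _ _ _ _ _ _ (fun d _ => ?_) ?_
  · rw [← exists_deg_iff, ← exists_deg_iff]
    exact ⟨fun ⟨x, hx, h⟩ => ⟨f.toLin x, f.map_mem d x hx, (map_ne_zero_iff f.toLin hf).2 h⟩,
      fun ⟨x, hx, h⟩ => ⟨g.toLin x, g.map_mem d x hx, (map_ne_zero_iff g.toLin hg).2 h⟩⟩
  · rw [← exists_Sq2_smul_iff, ← exists_Sq2_smul_iff]
    exact ⟨fun ⟨x, hx, h⟩ => ⟨f.toLin x, f.map_mem _ x hx, by
        rw [← map_smul]; exact (map_ne_zero_iff f.toLin hf).2 h⟩,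
      fun ⟨x, hx, h⟩ => ⟨g.toLin x, g.map_mem _ x hx, by
        rw [← map_smul]; exact (map_ne_zero_iff g.toLin hg).2 h⟩⟩

end Model

/-- Every lift of `N` is stably isomorphic to a model. -/
theorem exists_model (M : GrMod A1.piece)
    (e : StCat.of (underlyingE1 M) ≅ StCat.of moduleN) :
    ∃ c px py, Nonempty (StCat.of (model c px py) ≅ StCat.of M) := by
  obtain ⟨M', hM', ⟨i⟩⟩ := A1.exists_reduced M
  obtain ⟨i'⟩ := nonempty_stable_iso_underlyingE1 i
  obtain ⟨n, m, F⟩ := A1.exists_frame M' (i' ≪≫ e)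
  obtain ⟨c, px, py, n, m, x, y, h⟩ := A1.Frame.exists_normalForm F hM'
  obtain ⟨j⟩ := h.nonempty_stable_iso
  exact ⟨c, px, py, ⟨j ≪≫ i⟩⟩

theorem mainTheorem12 : (stableLifts moduleN).encard = 8 := by
  let F : Bool × Bool × Bool → Quotient (isIsomorphicSetoid (StCat A1.piece)) := fun p =>
    Quotient.mk _ (StCat.of (model p.1 p.2.1 p.2.2))
  have hF : Function.Injective F := by
    rintro ⟨c, px, py⟩ ⟨c', px', py'⟩ h
    obtain ⟨e⟩ := Quotient.exact h
    obtain ⟨rfl, rfl, rfl⟩ := Model.eq_of_stable_iso e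
    rfl
  have hR : stableLifts moduleN = F '' Set.univ := by
    ext X
    constructor
    · rintro ⟨M, rfl, ⟨e⟩⟩
      obtain ⟨c, px, py, h⟩ := exists_model M e
      exact ⟨(c, px, py), trivial, Quotient.sound h⟩
    · rintro ⟨⟨c, px, py⟩, -, rfl⟩
      exact ⟨model c px py, rfl, Model.nonempty_stable_iso c px py⟩
  rw [hR, hF.encard_image, Set.encard_univ, ENat.card_eq_coe_fintype_card]
  rfl
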